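/- For a real number $x\ge 3$ and an integer $k\ge 1$ put \[ m_k(x)=\mathbb{E}_{n\le x}\Big(\frac{\omega(n)-\log\log x}{\sqrt{\log\log x}}\Big)^k, \] where $\omega(n)$ is the number of distinct prime divisors of $n$ and $n$ is uniformly distributed on the positive integers up to $x$. For integers $k\ge 0$ let $\mu_k=\mathbb{E}(G^k)$ with $G\sim N(0,1)$, and let $M_k=\dfrac{k!}{2^{k/2}\,\Gamma(k/2+1)}$. Let $a=\gamma+\sum_p\big(\log(1-\tfrac1p)+\tfrac1p\big)$ be the Meissel–Mertens constant. (i) Fix $A>0$. Uniformly for $x\ge 3$ and $1\le k\le A(\log\log x)^{1/3}$, \[ m_k(x)=\Big(\mu_k+\Big(\frac{k(k-1)}{6}+ka\Big)\frac{\mu_{k-1}}{\sqrt{\log\log x}}\Big)\Big(1+O_A\Big(\frac{k^3}{\log\log x}\Big)\Big), \] where the implied constant depends only on $A$. (ii) If $x\to\infty$ and $k\asymp(\log\log x)^{1/3}$, then \[ M_k^{-1}m_k(x)\sim\frac12\exp\Big(\frac{k^{3/2}}{6\sqrt{\log\log x}}\Big)\Big(1+(-1)^k\exp\Big(-\frac{k^{3/2}}{3\sqrt{\log\log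 x}}\Big)\Big)\asymp 1. \] (iii) If $x\to\infty$, $k/(\log\log x)^{1/3}\to\infty$ and $k=o(\sqrt{\log\log x})$, then with $r=\sqrt{k/\log\log x}$, \[ M_k^{-1}m_k(x)\sim\frac12(\log x)^{e^r-(1+r+r^2/2)}\to\infty. \] -/

import Mathlib

open Filter Asymptotics
open scoped Nat

noncomputable section

/-- The double logarithm `log log x`. -/
def logLog (x : ℝ) : ℝ := Real.log (Real.log x)

/-- The expectation of `f n`, where `n` is uniform on the positive integers `n ≤ x`. -/
def uniformMean (x : ℝ) (f : ℕ → ℝ) : ℝ :=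
  (∑ n ∈ Finset.Icc 1 ⌊x⌋₊, f n) / (⌊x⌋₊ : ℝ)

/-- The `k`-th moment of `(ω(n) - log log x) / √(log log x)`, with `n` uniform on the positive
integers up to `x`; `ω(n)` is the number of distinct prime divisors of `n`. -/
def omegaMoment (x : ℝ) (k : ℕ) : ℝ :=
  uniformMean x fun n =>
    (((ArithmeticFunction.cardDistinctFactors n : ℝ) - logLog x) / √(logLog x)) ^ k

/-- The `k`-th moment `μ_k` of the standard Gaussian distribution. -/
def gaussMoment (k : ℕ) : ℝ :=
  ∫ t : ℝ, t ^ k ∂(ProbabilityTheory.gaussianReal 0 1)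

/-- `M_k = k! / (2^{k/2} Γ(k/2 + 1))`. -/
def bigM (k : ℕ) : ℝ :=
  (k ! : ℝ) / ((2 : ℝ) ^ ((k : ℝ) / 2) * Real.Gamma ((k : ℝ) / 2 + 1))

/-- The Meissel–Mertens constant `γ + ∑_p (log (1 - 1/p) + 1/p)`. -/
def meisselMertens : ℝ :=
  Real.eulerMascheroniConstant +
    ∑' p : Nat.Primes, (Real.log (1 - 1 / ((p : ℕ) : ℝ)) + 1 / ((p : ℕ) : ℝ))

/-- The series defining the Meissel–Mertens constant converges absolutely. -/
theorem summable_meisselMertens :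
    Summable fun p : Nat.Primes =>
      Real.log (1 - 1 / ((p : ℕ) : ℝ)) + 1 / ((p : ℕ) : ℝ) := by
  have hs : Summable fun p : Nat.Primes => 2 * (1 / ((p : ℕ) : ℝ) ^ 2) :=
    ((Real.summable_one_div_nat_pow.mpr (by norm_num : 1 < 2)).comp_injective
      Nat.Primes.coe_nat_injective).mul_left 2
  refine Summable.of_norm_bounded hs fun p => ?_
  have hp : (2 : ℝ) ≤ ((p : ℕ) : ℝ) := by exact_mod_cast p.2.two_le
  have hpos : (0 : ℝ) < 1 / ((p : ℕ) : ℝ) := by positivity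
  have hle : 1 / ((p : ℕ) : ℝ) ≤ 1 / 2 := one_div_le_one_div_of_le (by norm_num) hp
  have h := Real.abs_log_sub_add_sum_range_le (x := 1 / ((p : ℕ) : ℝ))
    (by rw [abs_of_pos hpos]; linarith) 1
  rw [abs_of_pos hpos] at h
  have h2 : (1 / ((p : ℕ) : ℝ)) ^ (1 + 1) / (1 - 1 / ((p : ℕ) : ℝ))
      ≤ 2 * (1 / ((p : ℕ) : ℝ) ^ 2) := by
    rw [div_le_iff₀ (by linarith), ← one_div_pow]
    nlinarith [sq_nonneg (1 / ((p : ℕ) : ℝ))]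
  rw [Real.norm_eq_abs, add_comm]
  simpa using h.trans h2

/-- `½ exp(k^{3/2} / (6 √(log log x))) (1 + (-1)^k exp(-k^{3/2} / (3 √(log log x))))`. -/
def transitionMain (x : ℝ) (k : ℕ) : ℝ :=
  1 / 2 * Real.exp ((k : ℝ) ^ (3 / 2 : ℝ) / (6 * √(logLog x))) *
    (1 + (-1) ^ k * Real.exp (-((k : ℝ) ^ (3 / 2 : ℝ) / (3 * √(logLog x)))))

/-- `½ (log x)^{e^r - (1 + r + r²/2)}` with `r = √(k / log log x)`. -/
def largeMain (x : ℝ) (k : ℕ) : ℝ :=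
  let r : ℝ := √((k : ℝ) / logLog x)
  1 / 2 * Real.log x ^ (Real.exp r - (1 + r + r ^ 2 / 2))

end

/-! Write `L = log log x` and `F(s) = E exp(s(ω(n) - L)) · exp(-L s²/2)`. The moment `m_k` is `k!
L^{-k/2}` times the `k`-th Taylor coefficient of `exp(L s²/2) F(s)`, a linear functional of `F`
(`omegaMoment_eq_gaussFunctional`). The saddle point of `exp(L s²/2) s^{-k}` is `r = √(k/L)`. After
division by `M_k`, the functional weighs the `i`-th coefficient by `r^i` times `momentWeight k i`,
which is near `1` if `k - i` is even and `i²` is small against `k`, and is `0` if `k - i` is odd.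
With Cauchy's estimate on `|s| = 2r` this gives `norm_gaussFunctional_le`: the functional is at most
`4 M_k` times the supremum on that circle. So it suffices to know `F` near `0`.

There `F(s) = Φ(s) exp(L(e^s - 1 - s - s²/2)) + (error exponentially small in L)`, with `Φ(0) = 1`
and `Φ'(0) = a` (`exists_normalizedMgf_asymptotic`). This is the mean value `H(w) (log x)^w` of
`(1+w)^{ω(n)}` at `w = e^s - 1`. It is obtained by real-variable means: Mertens' first theorem turns
the logarithmic mean of `μ²(m) w^{ω(m)}` into an approximate solution of a first order linear
differential equation. The bounds are uniform in `w`, so `H` is holomorphic, and its derivative at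
`0` is the limit of `∑_{p ≤ x} 1/p - log log x`. That limit is identified with the Meissel–Mertens
constant by comparison with `log ζ(1+ε)`.

When `k = o(√L)` the quartic and later terms of the exponent are `O(L r⁴) = O(k²/L)`, so only `exp(L
s³/6)` matters. Its coefficients sit at `s^{3n}`, and the parity of `k - 3n` selects every second
one, leaving `(e^y + (-1)^k e^{-y})/2` with `y = L r³/6 = k^{3/2}/(6√L)`. This is the profile of the
second range; as `y → ∞` only `e^y/2` survives.

When `κ = L r³ = k^{3/2}/√L` is bounded, `F` is expanded to second order in `κ`: the first order
part `1 + as + L s³/6` gives the main term of (i). For even `k` the main term is `M_k` and the error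
`O(κ²) M_k`. For odd `k` it is only of order `κ M_k`, but the second order terms are even in `s` and
drop out, so the error is `O(κ³) M_k`. Both relative errors are `O(κ²) = O(k³/L)`. The case `k = 1`
uses `a > 0`. -/

/-! ### Mertens' estimates for sums over primes. -/

theorem exists_sum_primesLE_log_div_mul_pred_le :
    ∃ C : ℝ, 0 ≤ C ∧ ∀ N : ℕ,
      ∑ p ∈ N.primesLE, Real.log p / ((p : ℝ) * ((p : ℝ) - 1)) ≤ C := by
  have hs : Summable fun n : ℕ => 4 * (1 / (n : ℝ) ^ (3 / 2 : ℝ)) :=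
    (Real.summable_one_div_nat_rpow.mpr (by norm_num)).mul_left 4
  refine ⟨∑' n : ℕ, 4 * (1 / (n : ℝ) ^ (3 / 2 : ℝ)), tsum_nonneg fun n => by positivity,
    fun N => ?_⟩
  refine le_trans (Finset.sum_le_sum fun p hp => ?_)
    (hs.sum_le_tsum N.primesLE fun n _ => by positivity)
  have h2 : (2 : ℝ) ≤ p := by exact_mod_cast Nat.two_le_of_mem_primesLE hp
  -- `log p ≤ 2√p` and `p - 1 ≥ p/2` reduce the sum to the convergent series of `4 n^{-3/2}`.
  have hlog : Real.log p ≤ (p : ℝ) ^ (1 / 2 : ℝ) / (1 / 2) :=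
    Real.log_le_rpow_div (by linarith) (by norm_num)
  have hpow : (p : ℝ) ^ (1 / 2 : ℝ) * (p : ℝ) ^ (3 / 2 : ℝ) = (p : ℝ) ^ 2 := by
    rw [← Real.rpow_add (by linarith), ← Real.rpow_natCast]
    norm_num
  have hq : (0 : ℝ) < (p : ℝ) ^ (3 / 2 : ℝ) := Real.rpow_pos_of_pos (by linarith) _
  rw [mul_one_div, div_le_div_iff₀ (by nlinarith) hq]
  calc Real.log p * (p : ℝ) ^ (3 / 2 : ℝ)
      ≤ (p : ℝ) ^ (1 / 2 : ℝ) / (1 / 2) * (p : ℝ) ^ (3 / 2 : ℝ) := by gcongr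
    _ = 2 * (p : ℝ) ^ 2 := by rw [← hpow]; ring
    _ ≤ 4 * ((p : ℝ) * ((p : ℝ) - 1)) := by nlinarith

theorem log_factorial_eq_sum_primesLE (N : ℕ) :
    Real.log (N ! : ℝ) = ∑ p ∈ N.primesLE, ((N !).factorization p : ℝ) * Real.log p := by
  rw [Real.log_nat_eq_sum_factorization, Finsupp.sum]
  refine Finset.sum_subset (fun p hp => ?_) fun p _ hp => ?_
  · rw [Nat.support_factorization, Nat.mem_primeFactors] at hp
    exact Nat.mem_primesLE.mpr ⟨(hp.1.dvd_factorial).mp hp.2.1, hp.1⟩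
  · rw [Finsupp.notMem_support_iff] at hp
    simp [hp]

theorem factorization_factorial_le {p : ℕ} (hp : p.Prime) (N : ℕ) :
    ((N !).factorization p : ℝ) ≤ (N : ℝ) / ((p : ℝ) - 1) := by
  have h2 : (2 : ℝ) ≤ p := by exact_mod_cast hp.two_le
  refine (Nat.cast_le.mpr (Nat.factorization_factorial_le_div_pred hp N)).trans ?_
  refine Nat.cast_div_le.trans_eq ?_
  rw [Nat.cast_sub hp.one_le, Nat.cast_one]

theorem le_factorization_factorial {p : ℕ} (hp : p.Prime) (N : ℕ) (hpN : p ≤ N) :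
    (N : ℝ) / p - 1 ≤ ((N !).factorization p : ℝ) := by
  have h1 : N / p ≤ (N !).factorization p := by
    -- Only the first term of Legendre's formula is kept; `p ≤ N` ensures that it occurs.
    rw [Nat.factorization_factorial hp (Nat.lt_add_one (Nat.log p N))]
    have : 1 ∈ Finset.Ico 1 (Nat.log p N + 1) :=
      Finset.mem_Ico.mpr ⟨le_rfl, Nat.lt_add_of_pos_left (Nat.log_pos hp.one_lt hpN)⟩
    simpa using Finset.single_le_sum (f := fun i => N / p ^ i) (fun _ _ => Nat.zero_le _) this
  have h2 : (N : ℝ) / p < (N / p : ℕ) + 1 := by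
    rw [div_lt_iff₀ (by exact_mod_cast hp.pos)]
    have := Nat.lt_div_mul_add (a := N) hp.pos
    have h3 : N < (N / p + 1) * p := by linarith
    exact_mod_cast h3
  have h3 : ((N / p : ℕ) : ℝ) ≤ ((N !).factorization p : ℝ) := by exact_mod_cast h1
  linarith

theorem sum_primesLE_log_le (N : ℕ) : ∑ p ∈ N.primesLE, Real.log p ≤ Real.log 4 * N := by
  rw [← Chebyshev.theta_eq_sum_primesLE_log]
  exact Chebyshev.theta_le_log4_mul_x (by positivity)

/-- Mertens' first theorem. -/
theorem exists_abs_sum_primesLE_log_div_sub_log_le :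
    ∃ C : ℝ, 0 ≤ C ∧ ∀ N : ℕ, 1 ≤ N →
      |∑ p ∈ N.primesLE, Real.log p / (p : ℝ) - Real.log N| ≤ C := by
  obtain ⟨C, hC0, hC⟩ := exists_sum_primesLE_log_div_mul_pred_le
  have h4 : 0 ≤ Real.log 4 := Real.log_nonneg (by norm_num)
  -- Here `log N!` lies between `N log N - N` and `N log N`. The excess of `1/(p-1)` over `1/p`
  -- costs `C`, rounding down costs Chebyshev's `log 4`, and Stirling costs `1`.
  refine ⟨C + Real.log 4 + 1, by positivity, fun N hN => ?_⟩
  have hN0 : (0 : ℝ) < N := by exact_mod_cast hN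
  have hup : Real.log (N ! : ℝ) ≤ N * Real.log N := by
    rw [← Real.log_pow]
    exact Real.log_le_log (by positivity) (by exact_mod_cast Nat.factorial_le_pow N)
  have hlo : (N : ℝ) * Real.log N - N ≤ Real.log (N ! : ℝ) := by
    have := Stirling.le_log_factorial_stirling (n := N) (by omega)
    have h1 : 0 ≤ Real.log (2 * Real.pi) := Real.log_nonneg (by nlinarith [Real.pi_gt_three])
    have h2 : 0 ≤ Real.log (N : ℝ) := Real.log_nonneg (by exact_mod_cast hN)
    linarith
  rw [log_factorial_eq_sum_primesLE] at hup hlo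
  have key1 : ∑ p ∈ N.primesLE, ((N : ℝ) / p - 1) * Real.log p
      ≤ ∑ p ∈ N.primesLE, ((N !).factorization p : ℝ) * Real.log p := by
    refine Finset.sum_le_sum fun p hp => ?_
    obtain ⟨hpN, hpp⟩ := Nat.mem_primesLE.mp hp
    exact mul_le_mul_of_nonneg_right (le_factorization_factorial hpp N hpN)
      (Real.log_natCast_nonneg p)
  have key2 : ∑ p ∈ N.primesLE, ((N !).factorization p : ℝ) * Real.log p
      ≤ ∑ p ∈ N.primesLE, (N : ℝ) / ((p : ℝ) - 1) * Real.log p := by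
    refine Finset.sum_le_sum fun p hp => ?_
    obtain ⟨hpN, hpp⟩ := Nat.mem_primesLE.mp hp
    exact mul_le_mul_of_nonneg_right (factorization_factorial_le hpp N)
      (Real.log_natCast_nonneg p)
  have e1 : ∑ p ∈ N.primesLE, ((N : ℝ) / p - 1) * Real.log p
      = N * ∑ p ∈ N.primesLE, Real.log p / (p : ℝ) - ∑ p ∈ N.primesLE, Real.log p := by
    rw [Finset.mul_sum, ← Finset.sum_sub_distrib]
    exact Finset.sum_congr rfl fun p _ => by ring
  have e2 : ∑ p ∈ N.primesLE, (N : ℝ) / ((p : ℝ) - 1) * Real.log p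
      = N * ∑ p ∈ N.primesLE, Real.log p / (p : ℝ)
        + N * ∑ p ∈ N.primesLE, Real.log p / ((p : ℝ) * ((p : ℝ) - 1)) := by
    rw [← mul_add, ← Finset.sum_add_distrib, Finset.mul_sum]
    refine Finset.sum_congr rfl fun p hp => ?_
    have h2 : (2 : ℝ) ≤ p := by exact_mod_cast Nat.two_le_of_mem_primesLE hp
    have h3 : (p : ℝ) - 1 ≠ 0 := by linarith
    have h4 : (p : ℝ) ≠ 0 := by linarith
    field_simp
    ring
  have hth := sum_primesLE_log_le N
  have hCN := mul_le_mul_of_nonneg_left (hC N) hN0.le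
  rw [abs_le]
  constructor
  · refine le_of_mul_le_mul_left ?_ hN0
    nlinarith
  · refine le_of_mul_le_mul_left ?_ hN0
    nlinarith

/-- The upper bound in Mertens' second theorem. -/
theorem exists_sum_primesLE_inv_le :
    ∃ C : ℝ, ∀ N : ℕ, 2 ≤ N →
      ∑ p ∈ N.primesLE, 1 / (p : ℝ) ≤ Real.log (Real.log N) + C := by
  obtain ⟨C, hC0, hC⟩ := exists_abs_sum_primesLE_log_div_sub_log_le
  have hlogpos : ∀ N : ℕ, 2 ≤ N → 0 < Real.log N := fun N hN =>
    Real.log_pos (by exact_mod_cast hN)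
  -- Partial summation as an induction on `N`, with `D` chosen to give equality at `N = 2`. The
  -- increment is `A(N) (1/log N - 1/log(N+1))` with `A(N) ≤ log N + C`; the `C` part telescopes and
  -- the rest is at most the increment of `log log`.
  obtain ⟨D, hD⟩ : ∃ D : ℝ, ∀ N : ℕ, 2 ≤ N →
      ∑ p ∈ N.primesLE, 1 / (p : ℝ) - (∑ p ∈ N.primesLE, Real.log p / (p : ℝ)) / Real.log N
        ≤ Real.log (Real.log N) - C / Real.log N + D := by
    refine ⟨∑ p ∈ Nat.primesLE 2, 1 / (p : ℝ)
      - (∑ p ∈ Nat.primesLE 2, Real.log p / (p : ℝ)) / Real.log (2 : ℕ)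
      - Real.log (Real.log (2 : ℕ)) + C / Real.log (2 : ℕ), fun N hN => ?_⟩
    induction N, hN using Nat.le_induction with
    | base => linarith
    | succ N hN ih =>
      have h1 := hlogpos N hN
      have h2 := hlogpos (N + 1) (by omega)
      have hle : Real.log N ≤ Real.log (N + 1 : ℕ) :=
        Real.log_le_log (by positivity) (by push_cast; linarith)
      have hA : ∑ p ∈ N.primesLE, Real.log p / (p : ℝ) ≤ Real.log N + C := by
        have := (abs_le.mp (hC N (by omega))).2
        linarith
      -- If `N + 1` is prime, its two contributions cancel because the divisor is `log (N + 1)`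
      -- itself.
      have hstep : ∑ p ∈ (N + 1).primesLE, 1 / (p : ℝ)
          - (∑ p ∈ (N + 1).primesLE, Real.log p / (p : ℝ)) / Real.log (N + 1 : ℕ)
          = ∑ p ∈ N.primesLE, 1 / (p : ℝ)
            - (∑ p ∈ N.primesLE, Real.log p / (p : ℝ)) / Real.log (N + 1 : ℕ) := by
        rw [Nat.primesLE_succ]
        split_ifs with hp
        · rw [Finset.sum_insert (Nat.notMem_primesLE N), Finset.sum_insert (Nat.notMem_primesLE N)]
          field_simp
          ring
        · rfl
      have hinv : 0 ≤ 1 / Real.log N - 1 / Real.log (N + 1 : ℕ) :=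
        sub_nonneg.mpr (one_div_le_one_div_of_le h1 hle)
      have hmul := mul_le_mul_of_nonneg_right hA hinv
      have hlog : 1 - Real.log N / Real.log (N + 1 : ℕ)
          ≤ Real.log (Real.log (N + 1 : ℕ)) - Real.log (Real.log N) := by
        have := Real.log_le_sub_one_of_pos (div_pos h1 h2)
        rw [Real.log_div h1.ne' h2.ne'] at this
        linarith
      have e : (Real.log N + C) * (1 / Real.log N - 1 / Real.log (N + 1 : ℕ))
          = 1 - Real.log N / Real.log (N + 1 : ℕ) + C / Real.log N
            - C / Real.log (N + 1 : ℕ) := by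
        field_simp
        ring
      rw [hstep]
      rw [e, mul_sub, mul_one_div, mul_one_div] at hmul
      linarith
  refine ⟨1 + D, fun N hN => ?_⟩
  have h1 := hlogpos N hN
  have hA : (∑ p ∈ N.primesLE, Real.log p / (p : ℝ)) / Real.log N ≤ 1 + C / Real.log N := by
    have := (abs_le.mp (hC N (by omega))).2
    rw [div_le_iff₀ h1, add_mul, div_mul_cancel₀ _ h1.ne']
    linarith
  linarith [hD N hN]


/-! ### Upper bounds for sums of `μ²(m) ρ^{ω(m)}`. -/

/-- Summing an additive function against a multiplicative one supported on squarefree integers. -/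
theorem sum_mul_sum_primeFactors {R : Type*} [CommSemiring R] {f g lam : ℕ → R}
    (hf0 : ∀ m, ¬ Squarefree m → f m = 0)
    (hf : ∀ p m, p.Prime → ¬ p ∣ m → f (p * m) = g p * f m) (N : ℕ) :
    ∑ m ∈ Finset.Icc 1 N, f m * ∑ p ∈ m.primeFactors, lam p
      = ∑ m ∈ Finset.Icc 1 N, f m * ∑ p ∈ (N / m).primesLE with ¬ p ∣ m, g p * lam p := by
  rw [← Finset.sum_filter_of_ne (p := Squarefree) (s := Finset.Icc 1 N)
      (f := fun m => f m * ∑ p ∈ m.primeFactors, lam p),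
    ← Finset.sum_filter_of_ne (p := Squarefree) (s := Finset.Icc 1 N)
      (f := fun m => f m * ∑ p ∈ (N / m).primesLE with ¬ p ∣ m, g p * lam p)]
  · simp_rw [Finset.mul_sum]
    rw [Finset.sum_sigma', Finset.sum_sigma']
    -- Pairs `(m, p)` with `p ∣ m` correspond to pairs `(m/p, p)`; squarefreeness of `m` is what
    -- makes `p` prime to `m/p`.
    refine Finset.sum_nbij' (fun a => ⟨a.1 / a.2, a.2⟩) (fun a => ⟨a.2 * a.1, a.2⟩) ?_ ?_ ?_ ?_ ?_
    · rintro ⟨m, p⟩ h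
      simp only [Finset.mem_sigma, Finset.mem_filter, Finset.mem_Icc, Nat.mem_primeFactors,
        Nat.mem_primesLE] at h ⊢
      obtain ⟨⟨⟨h1, h2⟩, hsq⟩, hp, ⟨c, rfl⟩, h0⟩ := h
      rw [Nat.mul_div_cancel_left c hp.pos]
      have hc : 0 < c := Nat.pos_of_ne_zero fun h => by simp [h] at h0
      refine ⟨⟨⟨hc, le_trans (Nat.le_mul_of_pos_left c hp.pos) h2⟩, hsq.of_mul_right⟩,
        ⟨(Nat.le_div_iff_mul_le hc).mpr h2, hp⟩, fun hd => ?_⟩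
      exact hp.not_isUnit (hsq p (mul_dvd_mul_left p hd))
    · rintro ⟨m, p⟩ h
      simp only [Finset.mem_sigma, Finset.mem_filter, Finset.mem_Icc, Nat.mem_primeFactors,
        Nat.mem_primesLE] at h ⊢
      obtain ⟨⟨⟨h1, h2⟩, hsq⟩, ⟨hpm, hp⟩, hd⟩ := h
      have hcop : Nat.Coprime p m := (Nat.Prime.coprime_iff_not_dvd hp).mpr hd
      refine ⟨⟨⟨Nat.mul_pos hp.pos h1, (Nat.le_div_iff_mul_le h1).mp hpm⟩, ?_⟩, hp,
        dvd_mul_right p m, (Nat.mul_pos hp.pos h1).ne'⟩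
      exact (Nat.squarefree_mul hcop).mpr ⟨hp.prime.squarefree, hsq⟩
    · rintro ⟨m, p⟩ h
      simp only [Finset.mem_sigma, Finset.mem_filter, Nat.mem_primeFactors] at h
      simp [Nat.mul_div_cancel' h.2.2.1]
    · rintro ⟨m, p⟩ h
      simp only [Finset.mem_sigma, Finset.mem_filter, Nat.mem_primesLE] at h
      simp [Nat.mul_div_cancel_left m h.2.1.2.pos]
    · rintro ⟨m, p⟩ h
      simp only [Finset.mem_sigma, Finset.mem_filter, Finset.mem_Icc, Nat.mem_primeFactors] at h
      obtain ⟨⟨⟨h1, h2⟩, hsq⟩, hp, ⟨c, rfl⟩, h0⟩ := h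
      dsimp only
      rw [Nat.mul_div_cancel_left c hp.pos, hf p c hp fun hd =>
        hp.not_isUnit (hsq p (mul_dvd_mul_left p hd))]
      ring
  · intro m _ hm
    by_contra h
    simp [hf0 m h] at hm
  · intro m _ hm
    by_contra h
    simp [hf0 m h] at hm

/-- The coefficient `μ²(m) w^{ω(m)}`. -/
noncomputable def sqfreePow {R : Type*} [CommSemiring R] (w : R) (m : ℕ) : R :=
  if Squarefree m then w ^ ArithmeticFunction.cardDistinctFactors m else 0

theorem sqfreePow_of_not_squarefree {R : Type*} [CommSemiring R] (w : R) {m : ℕ}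
    (h : ¬ Squarefree m) : sqfreePow w m = 0 := if_neg h

theorem sqfreePow_one {R : Type*} [CommSemiring R] (w : R) : sqfreePow w 1 = 1 := by
  simp [sqfreePow]

theorem sqfreePow_prime_mul {R : Type*} [CommSemiring R] (w : R) {p m : ℕ} (hp : p.Prime)
    (h : ¬ p ∣ m) : sqfreePow w (p * m) = w * sqfreePow w m := by
  have hcop : Nat.Coprime p m := (Nat.Prime.coprime_iff_not_dvd hp).mpr h
  unfold sqfreePow
  simp only [Nat.squarefree_mul hcop, ArithmeticFunction.cardDistinctFactors_mul hcop,
    ArithmeticFunction.cardDistinctFactors_apply_prime hp, pow_add, pow_one]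
  simp [hp.prime.squarefree]

theorem norm_sqfreePow (w : ℂ) (m : ℕ) : ‖sqfreePow w m‖ = sqfreePow ‖w‖ m := by
  unfold sqfreePow
  split_ifs <;> simp

theorem sqfreePow_nonneg {w : ℝ} (hw : 0 ≤ w) (m : ℕ) : 0 ≤ sqfreePow w m := by
  unfold sqfreePow
  split_ifs <;> positivity

theorem log_eq_sum_primeFactors {m : ℕ} (hm : Squarefree m) :
    Real.log m = ∑ p ∈ m.primeFactors, Real.log p := by
  conv_lhs => rw [← Nat.prod_primeFactors_of_squarefree hm]
  rw [Nat.cast_prod, Real.log_prod]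
  intro p hp
  exact_mod_cast (Nat.prime_of_mem_primeFactors hp).ne_zero

/-- The product expands over sets of primes `≤ N`. A squarefree `m` is determined by its set of
prime factors, so the left side is a subsum of nonnegative terms. -/
theorem sum_sqfreePow_div_le_prod {ρ : ℝ} (hρ : 0 ≤ ρ) (N : ℕ) :
    ∑ m ∈ Finset.Icc 1 N, sqfreePow ρ m / m ≤ ∏ p ∈ N.primesLE, (1 + ρ / p) := by
  rw [Finset.prod_one_add]
  rw [← Finset.sum_filter_of_ne (p := Squarefree) (s := Finset.Icc 1 N)]
  · have hinj : Set.InjOn (fun m : ℕ => m.primeFactors)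
        ((Finset.Icc 1 N).filter Squarefree : Finset ℕ) := by
      intro a ha b hb hab
      simp only [Finset.coe_filter, Set.mem_ofPred_eq] at ha hb
      rw [← Nat.prod_primeFactors_of_squarefree ha.2, ← Nat.prod_primeFactors_of_squarefree hb.2]
      exact congrArg (fun t : Finset ℕ => ∏ p ∈ t, p) hab
    have hterm : ∀ m ∈ (Finset.Icc 1 N).filter Squarefree,
        sqfreePow ρ m / m = ∏ p ∈ m.primeFactors, ρ / (p : ℝ) := by
      intro m hm
      rw [Finset.mem_filter] at hm
      rw [sqfreePow, if_pos hm.2, Finset.prod_div_distrib, Finset.prod_const,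
        ArithmeticFunction.cardDistinctFactors_apply, ← Nat.cast_prod,
        Nat.prod_primeFactors_of_squarefree hm.2]
      rfl
    rw [Finset.sum_congr rfl hterm,
      ← Finset.sum_image (f := fun t : Finset ℕ => ∏ p ∈ t, ρ / (p : ℝ)) hinj]
    refine Finset.sum_le_sum_of_subset_of_nonneg ?_ fun t _ _ =>
      Finset.prod_nonneg fun p _ => by positivity
    intro t ht
    obtain ⟨m, hm, rfl⟩ := Finset.mem_image.mp ht
    rw [Finset.mem_filter, Finset.mem_Icc] at hm
    refine Finset.mem_powerset.mpr fun p hp => Nat.mem_primesLE.mpr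
      ⟨(Nat.le_of_mem_primeFactors hp).trans hm.1.2, Nat.prime_of_mem_primeFactors hp⟩
  · intro m _ hm
    by_contra h
    simp [sqfreePow_of_not_squarefree ρ h] at hm

/-- Follows from `1 + t ≤ e^t` and Mertens' second theorem; `ρ ≤ 1` keeps the constant uniform. -/
theorem exists_sum_sqfreePow_div_le :
    ∃ C : ℝ, 0 < C ∧ ∀ ρ : ℝ, 0 ≤ ρ → ρ ≤ 1 → ∀ N : ℕ, 2 ≤ N →
      ∑ m ∈ Finset.Icc 1 N, sqfreePow ρ m / m ≤ C * Real.log N ^ ρ := by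
  obtain ⟨C, hC⟩ := exists_sum_primesLE_inv_le
  refine ⟨Real.exp |C|, Real.exp_pos _, fun ρ hρ hρ1 N hN => ?_⟩
  have hlog : 0 < Real.log N := Real.log_pos (by exact_mod_cast hN)
  calc ∑ m ∈ Finset.Icc 1 N, sqfreePow ρ m / m
      ≤ ∏ p ∈ N.primesLE, (1 + ρ / p) := sum_sqfreePow_div_le_prod hρ N
    _ ≤ ∏ p ∈ N.primesLE, Real.exp (ρ * (1 / p)) := by
        refine Finset.prod_le_prod (fun p _ => by positivity) fun p _ => ?_
        rw [mul_one_div, add_comm]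
        exact Real.add_one_le_exp _
    _ = Real.exp (ρ * ∑ p ∈ N.primesLE, 1 / (p : ℝ)) := by
        rw [Finset.mul_sum, Real.exp_sum]
    _ ≤ Real.exp (|C| + Real.log (Real.log N) * ρ) := by
        refine Real.exp_le_exp.mpr ?_
        have h1 := mul_le_mul_of_nonneg_left (hC N hN) hρ
        have h2 : ρ * C ≤ |C| := by
          nlinarith [le_abs_self C, abs_nonneg C, mul_le_mul_of_nonneg_left (le_abs_self C) hρ]
        linarith
    _ = Real.exp |C| * Real.log N ^ ρ := by rw [Real.exp_add, Real.rpow_def_of_pos hlog]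


/-- Saves a factor `log N` over the trivial passage from the logarithmic sum. Split `log N = log m +
log (N/m)`: the first part is a sum over `p ∣ m` and yields to Chebyshev's bound after exchanging
summations, the second is at most `N/m`. -/
theorem exists_sum_sqfreePow_le :
    ∃ C : ℝ, 0 < C ∧ ∀ ρ : ℝ, 0 ≤ ρ → ρ ≤ 1 → ∀ N : ℕ, 2 ≤ N →
      (∑ m ∈ Finset.Icc 1 N, sqfreePow ρ m) * Real.log N ≤ C * (N * Real.log N ^ ρ) := by
  obtain ⟨C, hC0, hC⟩ := exists_sum_sqfreePow_div_le
  have h4 : 0 ≤ Real.log 4 := Real.log_nonneg (by norm_num)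
  refine ⟨(Real.log 4 + 1) * C, by positivity, fun ρ hρ hρ1 N hN => ?_⟩
  have hN0 : (0 : ℝ) < N := by positivity
  have hid := sum_mul_sum_primeFactors (f := fun m => sqfreePow ρ m) (g := fun _ => ρ)
    (lam := fun p => Real.log p) (fun m hm => sqfreePow_of_not_squarefree ρ hm)
    (fun p m hp h => sqfreePow_prime_mul ρ hp h) N
  have h1 : ∑ m ∈ Finset.Icc 1 N, sqfreePow ρ m * ∑ p ∈ m.primeFactors, Real.log p
      = ∑ m ∈ Finset.Icc 1 N, sqfreePow ρ m * Real.log m := by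
    refine Finset.sum_congr rfl fun m _ => ?_
    by_cases hm : Squarefree m
    · rw [log_eq_sum_primeFactors hm]
    · simp [sqfreePow_of_not_squarefree ρ hm]
  have h2 : ∑ m ∈ Finset.Icc 1 N, sqfreePow ρ m * Real.log m
      ≤ Real.log 4 * N * ∑ m ∈ Finset.Icc 1 N, sqfreePow ρ m / m := by
    rw [← h1, hid, Finset.mul_sum]
    refine Finset.sum_le_sum fun m hm => ?_
    have hm1 : 1 ≤ m := (Finset.mem_Icc.mp hm).1
    have hin : ∑ p ∈ (N / m).primesLE with ¬ p ∣ m, ρ * Real.log p ≤ Real.log 4 * (N / m) := by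
      calc ∑ p ∈ (N / m).primesLE with ¬ p ∣ m, ρ * Real.log p
          ≤ ∑ p ∈ (N / m).primesLE, ρ * Real.log p :=
            Finset.sum_le_sum_of_subset_of_nonneg (Finset.filter_subset _ _) fun p _ _ =>
              mul_nonneg hρ (Real.log_natCast_nonneg p)
        _ ≤ ∑ p ∈ (N / m).primesLE, Real.log p :=
            Finset.sum_le_sum fun p _ =>
              mul_le_of_le_one_left (Real.log_natCast_nonneg p) hρ1
        _ ≤ Real.log 4 * (N / m : ℕ) := sum_primesLE_log_le _
        _ ≤ Real.log 4 * (N / m) := by gcongr; exact Nat.cast_div_le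
    calc _ ≤ sqfreePow ρ m * (Real.log 4 * (N / m)) :=
          mul_le_mul_of_nonneg_left hin (sqfreePow_nonneg hρ m)
      _ = _ := by ring
  have h3 : ∑ m ∈ Finset.Icc 1 N, sqfreePow ρ m * (Real.log N - Real.log m)
      ≤ N * ∑ m ∈ Finset.Icc 1 N, sqfreePow ρ m / m := by
    rw [Finset.mul_sum]
    refine Finset.sum_le_sum fun m hm => ?_
    have hm1 : (0 : ℝ) < m := by exact_mod_cast (Finset.mem_Icc.mp hm).1
    have := Real.log_le_sub_one_of_pos (div_pos hN0 hm1)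
    rw [Real.log_div hN0.ne' hm1.ne'] at this
    calc _ ≤ sqfreePow ρ m * (N / m) :=
          mul_le_mul_of_nonneg_left (by linarith) (sqfreePow_nonneg hρ m)
      _ = _ := by ring
  have h4' : (∑ m ∈ Finset.Icc 1 N, sqfreePow ρ m) * Real.log N
      = ∑ m ∈ Finset.Icc 1 N, sqfreePow ρ m * (Real.log N - Real.log m)
        + ∑ m ∈ Finset.Icc 1 N, sqfreePow ρ m * Real.log m := by
    rw [← Finset.sum_add_distrib, Finset.sum_mul]
    exact Finset.sum_congr rfl fun m _ => by ring
  calc _ ≤ (Real.log 4 + 1) * N * ∑ m ∈ Finset.Icc 1 N, sqfreePow ρ m / m := by linarith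
    _ ≤ (Real.log 4 + 1) * N * (C * Real.log N ^ ρ) := by
        gcongr
        exact hC ρ hρ hρ1 N hN
    _ = _ := by ring

/-! ### Asymptotics of the logarithmic mean through a differential equation. -/

/-- `∑_{m ≤ e^v} μ²(m) w^{ω(m)} / m`. -/
noncomputable def logMean (w : ℂ) (v : ℝ) : ℂ :=
  ∑ m ∈ Finset.Icc 1 ⌊Real.exp v⌋₊, sqfreePow w m / m

/-- `∑_{m ≤ e^v} μ²(m) w^{ω(m)} (v - log m) / m`, a primitive of `logMean w`. -/
noncomputable def logMeanPrimitive (w : ℂ) (v : ℝ) : ℂ :=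
  ∑ m ∈ Finset.Icc 1 ⌊Real.exp v⌋₊, sqfreePow w m / m * ((v - Real.log m : ℝ) : ℂ)

theorem two_le_floor_exp {v : ℝ} (hv : 1 ≤ v) : 2 ≤ ⌊Real.exp v⌋₊ :=
  Nat.le_floor (by
    have := Real.add_one_le_exp v
    push_cast
    linarith)

theorem log_floor_exp_le {v : ℝ} (hv : 1 ≤ v) : Real.log ⌊Real.exp v⌋₊ ≤ v := by
  have h2 : (2 : ℝ) ≤ (⌊Real.exp v⌋₊ : ℝ) := by exact_mod_cast two_le_floor_exp hv
  calc Real.log ⌊Real.exp v⌋₊ ≤ Real.log (Real.exp v) :=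
        Real.log_le_log (by linarith) (Nat.floor_le (Real.exp_pos v).le)
    _ = v := Real.log_exp v

theorem exists_sum_sqfreePow_div_floor_exp_le :
    ∃ C : ℝ, 0 < C ∧ ∀ ρ : ℝ, 0 ≤ ρ → ρ ≤ 1 / 4 → ∀ v : ℝ, 1 ≤ v →
      ∑ m ∈ Finset.Icc 1 ⌊Real.exp v⌋₊, sqfreePow ρ m / m ≤ C * v ^ (1 / 4 : ℝ) := by
  obtain ⟨C, hC0, hC⟩ := exists_sum_sqfreePow_div_le
  refine ⟨C, hC0, fun ρ hρ hρ1 v hv => ?_⟩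
  have h2 := two_le_floor_exp hv
  have hlog : 0 ≤ Real.log ⌊Real.exp v⌋₊ := Real.log_natCast_nonneg _
  refine (hC ρ hρ (by linarith) _ h2).trans ?_
  gcongr
  calc Real.log ⌊Real.exp v⌋₊ ^ ρ ≤ v ^ ρ :=
        Real.rpow_le_rpow hlog (log_floor_exp_le hv) hρ
    _ ≤ v ^ (1 / 4 : ℝ) := Real.rpow_le_rpow_of_exponent_le hv hρ1

/-- Rounding `e^v/m ≥ 1` down loses at most a factor `2`, and `log 2 ≤ 1`. -/
theorem abs_log_floor_div_sub_le {v : ℝ} {m : ℕ} (hm : m ∈ Finset.Icc 1 ⌊Real.exp v⌋₊) :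
    1 ≤ ⌊Real.exp v⌋₊ / m ∧
      |Real.log (⌊Real.exp v⌋₊ / m : ℕ) - (v - Real.log m)| ≤ 1 := by
  obtain ⟨h1, h2⟩ := Finset.mem_Icc.mp hm
  have hm0 : (0 : ℝ) < m := by exact_mod_cast h1
  have hn : 1 ≤ ⌊Real.exp v⌋₊ / m := (Nat.le_div_iff_mul_le h1).mpr (by simpa using h2)
  refine ⟨hn, ?_⟩
  have hn0 : (1 : ℝ) ≤ (⌊Real.exp v⌋₊ / m : ℕ) := by exact_mod_cast hn
  have e : v - Real.log m = Real.log (Real.exp v / m) := by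
    rw [Real.log_div (Real.exp_pos v).ne' hm0.ne', Real.log_exp]
  have hfl : ⌊Real.exp v⌋₊ / m = ⌊Real.exp v / m⌋₊ := (Nat.floor_div_natCast _ _).symm
  have hup : ((⌊Real.exp v⌋₊ / m : ℕ) : ℝ) ≤ Real.exp v / m := by
    rw [hfl]
    exact Nat.floor_le (by positivity)
  have hlo : Real.exp v / m ≤ 2 * ((⌊Real.exp v⌋₊ / m : ℕ) : ℝ) := by
    have := Nat.lt_floor_add_one (Real.exp v / m)
    rw [← hfl] at this
    linarith
  have hup' := Real.log_le_log (by linarith) hup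
  have hlo' := Real.log_le_log (by positivity) hlo
  rw [Real.log_mul (by norm_num) (by linarith)] at hlo'
  have hl2 : Real.log 2 ≤ 1 := Real.log_two_lt_d9.le.trans (by norm_num)
  rw [e, abs_le]
  constructor <;> linarith

/-- This is the approximate equation `v V' = (1 + w) V` for the primitive `V`. Writing `v = (v - log
m) + log m`, the first part gives `V`; the second, after exchanging summations, contains `w ∑_{p ≤
e^v/m} log p / p`, which Mertens' first theorem replaces by `w (v - log m)`, giving `wV`. -/
theorem exists_norm_mul_logMean_sub_le :
    ∃ C : ℝ, 0 < C ∧ ∀ w : ℂ, ‖w‖ ≤ 1 / 4 → ∀ v : ℝ, 1 ≤ v →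
      ‖v * logMean w v - (1 + w) * logMeanPrimitive w v‖ ≤ C * v ^ (1 / 4 : ℝ) := by
  obtain ⟨A, hA0, hA⟩ := exists_sum_sqfreePow_div_floor_exp_le
  obtain ⟨C₁, hC₁0, hC₁⟩ := exists_abs_sum_primesLE_log_div_sub_log_le
  obtain ⟨C₂, hC₂0, hC₂⟩ := exists_sum_primesLE_log_div_mul_pred_le
  refine ⟨(C₁ + 1 + C₂) * A, by positivity, fun w hw v hv => ?_⟩
  set N := ⌊Real.exp v⌋₊ with hNdef
  have hid := sum_mul_sum_primeFactors (f := fun m => sqfreePow w m / (m : ℂ))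
    (g := fun p => w / (p : ℂ)) (lam := fun p => (Real.log p : ℂ))
    (fun m hm => by simp [sqfreePow_of_not_squarefree w hm])
    (fun p m hp h => by rw [sqfreePow_prime_mul w hp h]; push_cast; ring) N
  -- The same exchange for absolute values, with `log p / p`: it bounds on average the loss from the
  -- excluded primes `p ∣ m`, through the convergent sum `C₂`.
  have hidr := sum_mul_sum_primeFactors (f := fun m => sqfreePow ‖w‖ m / (m : ℝ))
    (g := fun p => ‖w‖ / (p : ℝ)) (lam := fun p => Real.log p / p)
    (fun m hm => by simp [sqfreePow_of_not_squarefree ‖w‖ hm])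
    (fun p m hp h => by rw [sqfreePow_prime_mul ‖w‖ hp h]; push_cast; ring) N
  have hlogs : ∑ m ∈ Finset.Icc 1 N, sqfreePow w m / (m : ℂ) * (Real.log m : ℂ)
      = ∑ m ∈ Finset.Icc 1 N, sqfreePow w m / (m : ℂ) *
          ∑ p ∈ (N / m).primesLE with ¬ p ∣ m, w / (p : ℂ) * (Real.log p : ℂ) := by
    rw [← hid]
    refine Finset.sum_congr rfl fun m _ => ?_
    by_cases hm : Squarefree m
    · rw [log_eq_sum_primeFactors hm, Complex.ofReal_sum]
    · simp [sqfreePow_of_not_squarefree w hm]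
  have hnn : ∀ m, 0 ≤ sqfreePow ‖w‖ m / (m : ℝ) := fun m =>
    div_nonneg (sqfreePow_nonneg (norm_nonneg w) m) (Nat.cast_nonneg m)
  have hsplit : v * logMean w v - (1 + w) * logMeanPrimitive w v
      = ∑ m ∈ Finset.Icc 1 N, sqfreePow w m / (m : ℂ) * (w *
          ((∑ p ∈ (N / m).primesLE with ¬ p ∣ m, Real.log p / (p : ℝ)
            - (v - Real.log m) : ℝ) : ℂ)) := by
    have e1 : (v : ℂ) * logMean w v = logMeanPrimitive w v
        + ∑ m ∈ Finset.Icc 1 N, sqfreePow w m / (m : ℂ) * (Real.log m : ℂ) := by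
      rw [logMean, logMeanPrimitive, ← Finset.sum_add_distrib, Finset.mul_sum]
      refine Finset.sum_congr rfl fun m _ => ?_
      push_cast
      ring
    rw [e1, hlogs, logMeanPrimitive, add_mul, one_mul, add_sub_add_left_eq_sub, Finset.mul_sum,
      ← Finset.sum_sub_distrib]
    refine Finset.sum_congr rfl fun m _ => ?_
    have e2 : ∑ p ∈ (N / m).primesLE with ¬ p ∣ m, w / (p : ℂ) * (Real.log p : ℂ)
        = w * ((∑ p ∈ (N / m).primesLE with ¬ p ∣ m, Real.log p / (p : ℝ) : ℝ) : ℂ) := by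
      rw [Complex.ofReal_sum, Finset.mul_sum]
      refine Finset.sum_congr rfl fun p _ => ?_
      push_cast
      ring
    rw [e2]
    push_cast
    ring
  have hterm : ∀ m ∈ Finset.Icc 1 N,
      |∑ p ∈ (N / m).primesLE with ¬ p ∣ m, Real.log p / (p : ℝ) - (v - Real.log m)|
        ≤ C₁ + 1 + ∑ p ∈ m.primeFactors, Real.log p / (p : ℝ) := by
    intro m hm
    obtain ⟨hn, hlog⟩ := abs_log_floor_div_sub_le hm
    have hmert := hC₁ _ hn
    rw [← hNdef] at hmert hlog
    have hsum := Finset.sum_filter_add_sum_filter_not (N / m).primesLE (fun p => p ∣ m)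
      (fun p => Real.log p / (p : ℝ))
    have hnonneg : 0 ≤ ∑ p ∈ (N / m).primesLE with p ∣ m, Real.log p / (p : ℝ) :=
      Finset.sum_nonneg fun p _ => div_nonneg (Real.log_natCast_nonneg p) (Nat.cast_nonneg p)
    have hle : ∑ p ∈ (N / m).primesLE with p ∣ m, Real.log p / (p : ℝ)
        ≤ ∑ p ∈ m.primeFactors, Real.log p / (p : ℝ) := by
      refine Finset.sum_le_sum_of_subset_of_nonneg (fun p hp => ?_) fun p _ _ =>
        div_nonneg (Real.log_natCast_nonneg p) (Nat.cast_nonneg p)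
      rw [Finset.mem_filter, Nat.mem_primesLE] at hp
      have := (Finset.mem_Icc.mp hm).1
      exact Nat.mem_primeFactors.mpr ⟨hp.1.2, hp.2, by omega⟩
    rw [abs_le] at hmert hlog ⊢
    constructor <;> linarith
  have hsecond : ∑ m ∈ Finset.Icc 1 N, sqfreePow ‖w‖ m / (m : ℝ) *
      ∑ p ∈ m.primeFactors, Real.log p / (p : ℝ)
        ≤ C₂ * ∑ m ∈ Finset.Icc 1 N, sqfreePow ‖w‖ m / (m : ℝ) := by
    rw [hidr, Finset.mul_sum]
    refine Finset.sum_le_sum fun m _ => ?_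
    rw [mul_comm C₂]
    refine mul_le_mul_of_nonneg_left (le_trans ?_ (hC₂ (N / m))) (hnn m)
    refine le_trans (Finset.sum_le_sum_of_subset_of_nonneg (Finset.filter_subset _ _)
      fun p _ _ => ?_) (Finset.sum_le_sum fun p hp => ?_)
    · have := Real.log_natCast_nonneg p
      positivity
    · have h2 : (2 : ℝ) ≤ p := by exact_mod_cast Nat.two_le_of_mem_primesLE hp
      have hl := Real.log_natCast_nonneg p
      rw [div_mul_div_comm]
      refine div_le_div₀ hl (mul_le_of_le_one_left hl (by linarith)) (by nlinarith) (by nlinarith)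
  rw [hsplit]
  calc ‖∑ m ∈ Finset.Icc 1 N, sqfreePow w m / (m : ℂ) * (w *
          ((∑ p ∈ (N / m).primesLE with ¬ p ∣ m, Real.log p / (p : ℝ)
            - (v - Real.log m) : ℝ) : ℂ))‖
      ≤ ∑ m ∈ Finset.Icc 1 N, sqfreePow ‖w‖ m / (m : ℝ) *
          (C₁ + 1 + ∑ p ∈ m.primeFactors, Real.log p / (p : ℝ)) := by
        refine (norm_sum_le _ _).trans (Finset.sum_le_sum fun m hm => ?_)
        rw [norm_mul, norm_div, norm_sqfreePow, Complex.norm_natCast, norm_mul,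
          Complex.norm_real, Real.norm_eq_abs]
        refine mul_le_mul_of_nonneg_left ?_ (hnn m)
        exact (mul_le_of_le_one_left (abs_nonneg _) (by linarith)).trans (hterm m hm)
    _ = (C₁ + 1) * ∑ m ∈ Finset.Icc 1 N, sqfreePow ‖w‖ m / (m : ℝ)
        + ∑ m ∈ Finset.Icc 1 N, sqfreePow ‖w‖ m / (m : ℝ) *
          ∑ p ∈ m.primeFactors, Real.log p / (p : ℝ) := by
        rw [Finset.mul_sum, ← Finset.sum_add_distrib]
        exact Finset.sum_congr rfl fun m _ => by ring
    _ ≤ (C₁ + 1 + C₂) * ∑ m ∈ Finset.Icc 1 N, sqfreePow ‖w‖ m / (m : ℝ) := by linarith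
    _ ≤ (C₁ + 1 + C₂) * (A * v ^ (1 / 4 : ℝ)) := by
        gcongr
        exact hA ‖w‖ (norm_nonneg w) hw v hv
    _ = _ := by ring


/-- The primitive is piecewise linear with kinks at the points `log m`; a right derivative
everywhere is all that the mean value inequality requires. -/
theorem logMeanPrimitive_hasDerivWithinAt (w : ℂ) (v : ℝ) :
    HasDerivWithinAt (logMeanPrimitive w) (logMean w v) (Set.Ici v) v := by
  have hfl : ∀ᶠ t in nhdsWithin v (Set.Ici v), ⌊Real.exp t⌋₊ = ⌊Real.exp v⌋₊ := by
    have h1 : ∀ᶠ t in nhds v, Real.exp t < ⌊Real.exp v⌋₊ + 1 :=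
      Real.continuous_exp.continuousAt.eventually_lt_const (Nat.lt_floor_add_one _)
    filter_upwards [h1.filter_mono nhdsWithin_le_nhds, self_mem_nhdsWithin] with t ht htv
    refine le_antisymm ?_ (Nat.floor_le_floor (Real.exp_le_exp.mpr htv))
    refine Nat.lt_succ_iff.mp ((Nat.floor_lt (Real.exp_pos t).le).mpr ?_)
    push_cast
    exact ht
  have hd : HasDerivAt (fun t : ℝ => ∑ m ∈ Finset.Icc 1 ⌊Real.exp v⌋₊,
      sqfreePow w m / m * ((t - Real.log m : ℝ) : ℂ)) (logMean w v) v := by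
    unfold logMean
    refine HasDerivAt.fun_sum fun m _ => ?_
    have := (((hasDerivAt_id v).sub_const (Real.log m)).ofReal_comp).const_mul
      (sqfreePow w m / (m : ℂ))
    simpa using this
  refine hd.hasDerivWithinAt.congr_of_eventuallyEq ?_ rfl
  filter_upwards [hfl] with t ht
  rw [logMeanPrimitive, ht]

/-- A new term enters with the value `0`: on `[a, b]` the function is a fixed finite sum of
multiples of `max (t - log m) 0`. -/
theorem logMeanPrimitive_continuousOn (w : ℂ) (a b : ℝ) :
    ContinuousOn (logMeanPrimitive w) (Set.Icc a b) := by
  have hc : Continuous fun t : ℝ => ∑ m ∈ Finset.Icc 1 ⌊Real.exp b⌋₊,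
      sqfreePow w m / m * ((max (t - Real.log m) 0 : ℝ) : ℂ) := by
    fun_prop
  refine hc.continuousOn.congr fun t ht => ?_
  have hsub : Finset.Icc 1 ⌊Real.exp t⌋₊ ⊆ Finset.Icc 1 ⌊Real.exp b⌋₊ :=
    Finset.Icc_subset_Icc le_rfl (Nat.floor_le_floor (Real.exp_le_exp.mpr ht.2))
  dsimp only
  rw [logMeanPrimitive, ← Finset.sum_subset hsub]
  · refine Finset.sum_congr rfl fun m hm => ?_
    obtain ⟨h1, h2⟩ := Finset.mem_Icc.mp hm
    have hm0 : (0 : ℝ) < m := by exact_mod_cast h1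
    have hle : Real.log m ≤ t :=
      (Real.log_le_iff_le_exp hm0).mpr ((Nat.le_floor_iff (Real.exp_pos t).le).mp h2)
    rw [max_eq_left (by linarith)]
  · intro m hm hm'
    rw [Finset.mem_Icc] at hm hm'
    have hm0 : (0 : ℝ) < m := by exact_mod_cast hm.1
    have hlt : Real.exp t < m := (Nat.floor_lt (Real.exp_pos t).le).mp (by omega)
    have : t < Real.log m := (Real.lt_log_iff_exp_lt hm0).mpr hlt
    rw [max_eq_right (by linarith)]
    simp

theorem norm_exp_mul_log_le {c : ℂ} {v : ℝ} (hv : 1 ≤ v) {e : ℝ} (hc : c.re ≤ e) :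
    ‖Complex.exp (c * (Real.log v : ℂ))‖ ≤ v ^ e := by
  rw [Complex.norm_exp, Complex.re_mul_ofReal, Real.rpow_def_of_pos (by linarith), mul_comm]
  exact Real.exp_le_exp.mpr (mul_le_mul_of_nonneg_left hc (Real.log_nonneg hv))

/-- With the integrating factor `v^{-(1+w)}`, the derivative of `V v^{-(1+w)}` is `O(v^{-1} ·
v^{-3/4} · v^{1/4}) = O(v^{-3/2})`. The bound is the integral of this from `a` to `∞`. -/
theorem exists_norm_normalized_primitive_sub_le :
    ∃ C : ℝ, 0 < C ∧ ∀ w : ℂ, ‖w‖ ≤ 1 / 4 → ∀ a b : ℝ, 1 ≤ a → a ≤ b →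
      ‖logMeanPrimitive w b * Complex.exp (-(1 + w) * (Real.log b : ℂ))
        - logMeanPrimitive w a * Complex.exp (-(1 + w) * (Real.log a : ℂ))‖
        ≤ C * a ^ (-(1 / 2) : ℝ) := by
  obtain ⟨C, hC0, hC⟩ := exists_norm_mul_logMean_sub_le
  refine ⟨2 * C, by positivity, fun w hw a b ha hab => ?_⟩
  have hre : |w.re| ≤ 1 / 4 := (Complex.abs_re_le_norm w).trans hw
  set V : ℝ → ℂ := fun t => logMeanPrimitive w t * Complex.exp (-(1 + w) * (Real.log t : ℂ))
    with hV
  have hder : ∀ t : ℝ, 1 ≤ t → HasDerivWithinAt V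
      ((t : ℂ)⁻¹ * Complex.exp (-(1 + w) * (Real.log t : ℂ)) *
        (t * logMean w t - (1 + w) * logMeanPrimitive w t)) (Set.Ici t) t := by
    intro t ht
    have ht0 : (t : ℂ) ≠ 0 := by exact_mod_cast (by linarith : t ≠ 0)
    have h1 : HasDerivAt (fun t : ℝ => Complex.exp (-(1 + w) * (Real.log t : ℂ)))
        (Complex.exp (-(1 + w) * (Real.log t : ℂ)) * (-(1 + w) * ((t⁻¹ : ℝ) : ℂ))) t :=
      (((Real.hasDerivAt_log (by linarith : t ≠ 0)).ofReal_comp).const_mul _).cexp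
    convert! (logMeanPrimitive_hasDerivWithinAt w t).mul h1.hasDerivWithinAt using 1
    push_cast
    field_simp
    ring
  have hcont : ContinuousOn V (Set.Icc a b) := by
    refine (logMeanPrimitive_continuousOn w a b).mul ?_
    have : ContinuousOn Real.log (Set.Icc a b) :=
      Real.continuousOn_log.mono fun t ht => by
        simp only [Set.mem_compl_iff, Set.mem_singleton_iff]
        linarith [ht.1]
    fun_prop
  have hBder : ∀ t : ℝ, 1 ≤ t → HasDerivAt
      (fun t : ℝ => 2 * C * a ^ (-(1 / 2) : ℝ) - 2 * C * t ^ (-(1 / 2) : ℝ))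
      (C * t ^ (-(3 / 2) : ℝ)) t := by
    intro t ht
    have := (Real.hasDerivAt_rpow_const (x := t) (p := -(1 / 2))
      (Or.inl (by linarith))).const_mul (2 * C)
    convert! this.const_sub (2 * C * a ^ (-(1 / 2) : ℝ)) using 1
    norm_num
    ring
  have hmain := image_norm_le_of_norm_deriv_right_le_deriv_boundary' (a := a) (b := b)
    (f := fun t => V t - V a)
    (f' := fun t => (t : ℂ)⁻¹ * Complex.exp (-(1 + w) * (Real.log t : ℂ)) *
        (t * logMean w t - (1 + w) * logMeanPrimitive w t))
    (B := fun t : ℝ => 2 * C * a ^ (-(1 / 2) : ℝ) - 2 * C * t ^ (-(1 / 2) : ℝ))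
    (B' := fun t => C * t ^ (-(3 / 2) : ℝ))
    (hcont.sub continuousOn_const)
    (fun t ht => (hder t (ha.trans ht.1)).sub_const (V a))
    (by simp)
    (fun t ht => (hBder t (ha.trans ht.1)).continuousAt.continuousWithinAt)
    (fun t ht => (hBder t (ha.trans ht.1)).hasDerivWithinAt)
    (fun t ht => by
      have ht1 : 1 ≤ t := ha.trans ht.1
      have ht0 : 0 < t := by linarith
      rw [norm_mul, norm_mul, norm_inv, Complex.norm_real, Real.norm_of_nonneg ht0.le]
      have h1 : ‖Complex.exp (-(1 + w) * (Real.log t : ℂ))‖ ≤ t ^ (-(3 / 4) : ℝ) :=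
        norm_exp_mul_log_le ht1 (by
          simp only [Complex.neg_re, Complex.add_re, Complex.one_re]
          linarith [(abs_le.mp hre).1])
      have h2 := hC w hw t ht1
      calc t⁻¹ * ‖Complex.exp (-(1 + w) * (Real.log t : ℂ))‖ *
            ‖t * logMean w t - (1 + w) * logMeanPrimitive w t‖
          ≤ t⁻¹ * t ^ (-(3 / 4) : ℝ) * (C * t ^ (1 / 4 : ℝ)) := by gcongr
        _ = C * (t ^ (-1 : ℝ) * t ^ (-(3 / 4) : ℝ) * t ^ (1 / 4 : ℝ)) := by
            rw [Real.rpow_neg_one]; ring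
        _ = C * t ^ (-(3 / 2) : ℝ) := by
            rw [← Real.rpow_add ht0, ← Real.rpow_add ht0]; norm_num)
  have hb := hmain ⟨hab, le_rfl⟩
  refine hb.trans ?_
  have : 0 ≤ 2 * C * b ^ (-(1 / 2) : ℝ) := by
    have : 0 ≤ b := by linarith
    positivity
  linarith

theorem tendsto_rpow_neg_half_atTop :
    Tendsto (fun v : ℝ => v ^ (-(1 / 2) : ℝ)) atTop (nhds 0) :=
  tendsto_rpow_neg_atTop (by norm_num)

/-- The logarithmic mean of `μ²(m) w^{ω(m)}` up to `e^v` is asymptotic to `v^w H(w)`. -/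
theorem exists_norm_logMean_sub_le :
    ∃ (H : ℂ → ℂ) (C : ℝ), 0 < C ∧ ∀ w : ℂ, ‖w‖ ≤ 1 / 4 → ∀ v : ℝ, 1 ≤ v →
      ‖logMean w v * Complex.exp (-w * (Real.log v : ℂ)) - H w‖ ≤ C * v ^ (-(1 / 2) : ℝ) := by
  obtain ⟨C₁, hC₁0, hC₁⟩ := exists_norm_normalized_primitive_sub_le
  obtain ⟨C₂, hC₂0, hC₂⟩ := exists_norm_mul_logMean_sub_le
  have hlim : ∀ w : ℂ, ‖w‖ ≤ 1 / 4 → ∃ V : ℂ, ∀ v : ℝ, 1 ≤ v →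
      ‖V - logMeanPrimitive w v * Complex.exp (-(1 + w) * (Real.log v : ℂ))‖
        ≤ C₁ * v ^ (-(1 / 2) : ℝ) := by
    intro w hw
    set V : ℝ → ℂ := fun t => logMeanPrimitive w t * Complex.exp (-(1 + w) * (Real.log t : ℂ))
      with hV
    have hcs : CauchySeq fun n : ℕ => V ((n : ℝ) + 1) := by
      refine cauchySeq_of_le_tendsto_0' (fun n : ℕ => C₁ * ((n : ℝ) + 1) ^ (-(1 / 2) : ℝ)) ?_ ?_
      · intro n m hnm
        rw [dist_comm, dist_eq_norm]
        exact hC₁ w hw _ _ (by simp) (by gcongr)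
      · simpa using (tendsto_rpow_neg_half_atTop.comp (tendsto_atTop_add_const_right _ (1 : ℝ)
          tendsto_natCast_atTop_atTop)).const_mul C₁
    obtain ⟨L, hL⟩ := cauchySeq_tendsto_of_complete hcs
    refine ⟨L, fun v hv => ?_⟩
    refine le_of_tendsto (hL.sub_const (V v)).norm ?_
    filter_upwards [tendsto_natCast_atTop_atTop.eventually_ge_atTop v] with n hn
    exact hC₁ w hw _ _ hv (by linarith)
  choose! V hVlim using hlim
  -- The equation gives `logMean ≈ (1 + w) V / v`, hence `H(w)` is `1 + w` times the limit of the
  -- normalized primitive.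
  refine ⟨fun w => (1 + w) * V w, 2 * C₁ + C₂, by positivity, fun w hw v hv => ?_⟩
  have hv0 : 0 < v := by linarith
  have hvc : (v : ℂ) ≠ 0 := by exact_mod_cast hv0.ne'
  have hre : |w.re| ≤ 1 / 4 := (Complex.abs_re_le_norm w).trans hw
  have hexp : Complex.exp (-(1 + w) * (Real.log v : ℂ))
      = (v : ℂ)⁻¹ * Complex.exp (-w * (Real.log v : ℂ)) := by
    rw [neg_add, add_mul, Complex.exp_add, neg_one_mul, Complex.exp_neg, ← Complex.ofReal_exp,
      Real.exp_log hv0]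
  have e : logMean w v * Complex.exp (-w * (Real.log v : ℂ)) - (1 + w) * V w
      = (v : ℂ)⁻¹ * Complex.exp (-w * (Real.log v : ℂ)) *
          (v * logMean w v - (1 + w) * logMeanPrimitive w v)
        - (1 + w) * (V w - logMeanPrimitive w v * Complex.exp (-(1 + w) * (Real.log v : ℂ))) := by
    rw [hexp]
    field_simp
    ring
  have h1 : ‖Complex.exp (-w * (Real.log v : ℂ))‖ ≤ v ^ (1 / 4 : ℝ) :=
    norm_exp_mul_log_le hv (by
      rw [Complex.neg_re]
      linarith [(abs_le.mp hre).1])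
  have h2 := hC₂ w hw v hv
  have h3 := hVlim w hw v hv
  have h4 : ‖1 + w‖ ≤ 2 := by
    refine (norm_add_le _ _).trans ?_
    rw [norm_one]
    linarith
  rw [e]
  refine (norm_sub_le _ _).trans ?_
  rw [norm_mul, norm_mul, norm_mul, norm_inv, Complex.norm_real, Real.norm_of_nonneg hv0.le]
  calc _ ≤ v⁻¹ * v ^ (1 / 4 : ℝ) * (C₂ * v ^ (1 / 4 : ℝ))
        + 2 * (C₁ * v ^ (-(1 / 2) : ℝ)) := by gcongr
    _ = C₂ * (v ^ (-1 : ℝ) * v ^ (1 / 4 : ℝ) * v ^ (1 / 4 : ℝ))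
        + 2 * (C₁ * v ^ (-(1 / 2) : ℝ)) := by rw [Real.rpow_neg_one]; ring
    _ = _ := by
        rw [← Real.rpow_add hv0, ← Real.rpow_add hv0]
        norm_num
        ring

/-- Terms with `ω(m) ≥ 2` vanish to second order at `w = 0`, so the derivative of the logarithmic
mean at `0` is the sum of `1/p`. -/
theorem hasDerivAt_sqfreePow_zero (m : ℕ) :
    HasDerivAt (fun w : ℂ => sqfreePow w m) (if m.Prime then 1 else 0) 0 := by
  by_cases hm : Squarefree m
  · have hfun : (fun w : ℂ => sqfreePow w m)
        = fun w => w ^ ArithmeticFunction.cardDistinctFactors m := by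
      funext w
      rw [sqfreePow, if_pos hm]
    rw [hfun]
    split_ifs with hp
    · rw [ArithmeticFunction.cardDistinctFactors_apply_prime hp]
      simp only [pow_one]
      exact hasDerivAt_id (0 : ℂ)
    · rcases Nat.lt_trichotomy (ArithmeticFunction.cardDistinctFactors m) 1 with h | h | h
      · rw [Nat.lt_one_iff.mp h]
        simpa using hasDerivAt_const (0 : ℂ) (1 : ℂ)
      · exfalso
        apply hp
        rw [ArithmeticFunction.cardDistinctFactors_apply] at h
        have hcard : m.primeFactors.card = 1 := h
        obtain ⟨p, hpm⟩ := Finset.card_eq_one.mp hcard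
        have := Nat.prod_primeFactors_of_squarefree hm
        rw [hpm, Finset.prod_singleton] at this
        rw [← this]
        exact Nat.prime_of_mem_primeFactors (hpm ▸ Finset.mem_singleton_self p)
      · have := hasDerivAt_pow (ArithmeticFunction.cardDistinctFactors m) (0 : ℂ)
        rwa [zero_pow (by omega), mul_zero] at this
  · have hfun : (fun w : ℂ => sqfreePow w m) = fun _ => 0 := by
      funext w
      exact sqfreePow_of_not_squarefree w hm
    rw [hfun, if_neg fun hp => hm hp.prime.squarefree]
    exact hasDerivAt_const _ _

theorem logMean_zero {v : ℝ} (hv : 0 ≤ v) : logMean 0 v = 1 := by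
  have h1 : 1 ≤ ⌊Real.exp v⌋₊ := Nat.le_floor (by simpa using Real.one_le_exp hv)
  rw [logMean, Finset.sum_eq_single 1]
  · simp [sqfreePow_one]
  · intro m hm hm1
    rw [Finset.mem_Icc] at hm
    unfold sqfreePow
    split_ifs
    · rw [zero_pow, zero_div]
      intro h
      rw [ArithmeticFunction.cardDistinctFactors_apply] at h
      have : m.primeFactors = ∅ := Finset.card_eq_zero.mp h
      rw [Nat.primeFactors_eq_empty] at this
      omega
    · simp
  · intro h
    simp [h1] at h

theorem hasDerivAt_logMean_zero (v : ℝ) :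
    HasDerivAt (fun w => logMean w v)
      ((∑ p ∈ (⌊Real.exp v⌋₊).primesLE, 1 / (p : ℝ) : ℝ) : ℂ) 0 := by
  have h : HasDerivAt (fun w => logMean w v)
      (∑ m ∈ Finset.Icc 1 ⌊Real.exp v⌋₊, (if m.Prime then 1 else 0) / (m : ℂ)) 0 := by
    unfold logMean
    exact HasDerivAt.fun_sum fun m _ => (hasDerivAt_sqfreePow_zero m).div_const _
  convert! h using 1
  rw [Nat.primesLE_eq_filter_Icc_one, Finset.sum_filter]
  push_cast
  refine Finset.sum_congr rfl fun m _ => ?_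
  split_ifs <;> simp

theorem differentiable_sqfreePow (m : ℕ) : Differentiable ℂ fun w : ℂ => sqfreePow w m := by
  unfold sqfreePow
  split_ifs <;> fun_prop

theorem differentiable_logMean (v : ℝ) : Differentiable ℂ fun w => logMean w v := by
  unfold logMean
  exact Differentiable.fun_sum fun m _ => (differentiable_sqfreePow m).div_const _

/-- The error is uniform on the disc, so the limit is holomorphic and derivatives converge. At `w =
0` the derivative of `logMean w v · v^{-w}` is `∑ 1/p - log v`; its convergence is Mertens' second
theorem. -/
theorem exists_logMean_asymptotic :
    ∃ (H : ℂ → ℂ) (C : ℝ), 0 < C ∧ (∀ w : ℂ, ‖w‖ ≤ 1 / 4 → ∀ v : ℝ, 1 ≤ v →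
        ‖logMean w v * Complex.exp (-w * (Real.log v : ℂ)) - H w‖ ≤ C * v ^ (-(1 / 2) : ℝ)) ∧
      DifferentiableOn ℂ H (Metric.ball 0 (1 / 4)) ∧ H 0 = 1 ∧
      Tendsto (fun v : ℝ =>
        ((∑ p ∈ (⌊Real.exp v⌋₊).primesLE, 1 / (p : ℝ) - Real.log v : ℝ) : ℂ))
        atTop (nhds (deriv H 0)) := by
  obtain ⟨H, C, hC0, hC⟩ := exists_norm_logMean_sub_le
  have hdiff : ∀ v : ℝ, Differentiable ℂ
      fun w => logMean w v * Complex.exp (-w * (Real.log v : ℂ)) := fun v =>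
    (differentiable_logMean v).mul (by fun_prop)
  have hunif : TendstoLocallyUniformlyOn
      (fun (v : ℝ) w => logMean w v * Complex.exp (-w * (Real.log v : ℂ))) H atTop
      (Metric.ball 0 (1 / 4)) := by
    refine TendstoUniformlyOn.tendstoLocallyUniformlyOn ?_
    rw [Metric.tendstoUniformlyOn_iff]
    intro ε hε
    have h0 : Tendsto (fun v : ℝ => C * v ^ (-(1 / 2) : ℝ)) atTop (nhds 0) := by
      simpa using tendsto_rpow_neg_half_atTop.const_mul C
    filter_upwards [h0.eventually_lt_const hε, eventually_ge_atTop 1] with v hv hv1 w hw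
    rw [dist_comm, dist_eq_norm]
    exact (hC w (mem_ball_zero_iff.mp hw).le v hv1).trans_lt hv
  have hmem : (0 : ℂ) ∈ Metric.ball (0 : ℂ) (1 / 4) := by simp
  refine ⟨H, C, hC0, hC,
    hunif.differentiableOn (Eventually.of_forall fun v => (hdiff v).differentiableOn)
      Metric.isOpen_ball, ?_, ?_⟩
  · have h1 := hunif.tendsto_at hmem
    refine tendsto_nhds_unique h1 (tendsto_const_nhds.congr' ?_)
    filter_upwards [eventually_ge_atTop 0] with v hv
    simp [logMean_zero hv]
  · have h1 := (hunif.deriv (Eventually.of_forall fun v => (hdiff v).differentiableOn)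
      Metric.isOpen_ball).tendsto_at hmem
    refine h1.congr' ?_
    filter_upwards [eventually_ge_atTop 0] with v hv
    have h2 : HasDerivAt (fun w : ℂ => Complex.exp (-w * (Real.log v : ℂ)))
        (Complex.exp (-0 * (Real.log v : ℂ)) * (-1 * (Real.log v : ℂ))) 0 :=
      (((hasDerivAt_id (0 : ℂ)).neg).mul_const _).cexp
    have h3 := ((hasDerivAt_logMean_zero v).mul h2).deriv
    simp only [Function.comp]
    refine h3.trans ?_
    simp [logMean_zero hv]
    ring


/-! ### Positivity of the Meissel–Mertens constant. -/

theorem abs_log_one_sub_add_self_le {x : ℝ} (h0 : 0 ≤ x) (h1 : x < 1) :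
    |Real.log (1 - x) + x| ≤ x ^ 2 / (1 - x) := by
  have h := Real.abs_log_sub_add_sum_range_le (x := x) (by rwa [abs_of_nonneg h0]) 1
  rw [abs_of_nonneg h0] at h
  simpa [add_comm] using h

theorem neg_log_one_sub_inv_sub_le {n : ℕ} (hn : 2 ≤ n) :
    -(Real.log (1 - 1 / (n : ℝ)) + 1 / (n : ℝ)) ≤ 1 / ((n : ℝ) * (n - 1)) := by
  have h2 : (2 : ℝ) ≤ n := by exact_mod_cast hn
  have h1 : 1 / (n : ℝ) < 1 := by
    rw [div_lt_one (by linarith)]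
    linarith
  refine (neg_le_abs _).trans ((abs_log_one_sub_add_self_le (by positivity) h1).trans_eq ?_)
  have h3 : (n : ℝ) - 1 ≠ 0 := by linarith
  have h4 : (n : ℝ) ≠ 0 := by linarith
  have h5 : 1 - 1 / (n : ℝ) ≠ 0 := by linarith
  field_simp

/-- The primes `2` and `3` contribute `log 3 - 5/6`. Later primes are odd, and the sum of
`1/(n(n-1))` over odd `n ≥ 5` telescopes against the last term, since `1/(n(n-1)) ≤ 1/(2(n-2)) -
1/(2n)`. -/
theorem sum_primesLE_neg_log_one_sub_inv_le (k : ℕ) :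
    ∑ p ∈ (2 * k + 3).primesLE, -(Real.log (1 - 1 / (p : ℝ)) + 1 / (p : ℝ))
      ≤ 9 / 20 - 1 / (2 * (2 * k + 3)) := by
  induction k with
  | zero =>
    have h3 : Nat.primesLE (2 * 0 + 3) = {2, 3} := by decide
    rw [h3, Finset.sum_pair (by norm_num)]
    have e1 : Real.log (1 - 1 / ((2 : ℕ) : ℝ)) = -Real.log 2 := by
      rw [← Real.log_inv]
      norm_num
    have e2 : Real.log (1 - 1 / ((3 : ℕ) : ℝ)) = Real.log 2 - Real.log 3 := by
      rw [← Real.log_div (by norm_num) (by norm_num)]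
      norm_num
    have h3 : Real.log 3 ≤ 1.1 := by
      rw [Real.log_le_iff_le_exp (by norm_num)]
      have := Real.quadratic_le_exp_of_nonneg (x := 0.1) (by norm_num)
      have h1 := Real.exp_one_gt_d9
      have : Real.exp 1.1 = Real.exp 1 * Real.exp 0.1 := by
        rw [← Real.exp_add]
        norm_num
      rw [this]
      nlinarith
    rw [e1, e2]
    norm_num at *
    linarith
  | succ k ih =>
    have hstep : ∑ p ∈ (2 * (k + 1) + 3).primesLE, -(Real.log (1 - 1 / (p : ℝ)) + 1 / (p : ℝ))
        ≤ ∑ p ∈ (2 * k + 3).primesLE, -(Real.log (1 - 1 / (p : ℝ)) + 1 / (p : ℝ))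
          + 1 / (((2 * k + 5 : ℕ) : ℝ) * ((2 * k + 5 : ℕ) - 1)) := by
      have h4 : ¬ (2 * k + 3 + 1).Prime := fun h => by
        have := (Nat.Prime.even_iff h).mp ⟨k + 2, by ring⟩
        omega
      have e : 2 * (k + 1) + 3 = 2 * k + 3 + 1 + 1 := by ring
      have hpos : (0 : ℝ) ≤ 1 / (((2 * k + 5 : ℕ) : ℝ) * ((2 * k + 5 : ℕ) - 1)) := by
        push_cast
        have : (0 : ℝ) ≤ 2 * k + 5 - 1 := by linarith [Nat.cast_nonneg (α := ℝ) k]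
        positivity
      rw [e, Nat.primesLE_succ]
      split_ifs with hp
      · rw [Finset.sum_insert (Nat.notMem_primesLE _), Nat.primesLE_succ, if_neg h4, add_comm]
        gcongr
        exact neg_log_one_sub_inv_sub_le (by omega)
      · rw [Nat.primesLE_succ, if_neg h4]
        linarith
    refine hstep.trans ?_
    have hk : (0 : ℝ) ≤ k := Nat.cast_nonneg k
    have : 1 / (((2 * k + 5 : ℕ) : ℝ) * ((2 * k + 5 : ℕ) - 1))
        ≤ 1 / (2 * (2 * (k : ℝ) + 3)) - 1 / (2 * (2 * ((k + 1 : ℕ) : ℝ) + 3)) := by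
      push_cast
      rw [div_sub_div _ _ (by positivity) (by positivity),
        div_le_div_iff₀ (by nlinarith) (by positivity)]
      nlinarith
    linarith

/-- The prime sum is at least `-9/20`, while `γ > 1/2`. Positivity matters in the first range: at `k
= 1` the main term is `a/√(log log x)` alone, and it must not vanish. -/
theorem meisselMertens_pos : 0 < meisselMertens := by
  have h : ∑' p : Nat.Primes, -(Real.log (1 - 1 / ((p : ℕ) : ℝ)) + 1 / ((p : ℕ) : ℝ))
      ≤ 9 / 20 := by
    refine summable_meisselMertens.neg.tsum_le_of_sum_le fun s => ?_
    obtain ⟨k, hk⟩ : ∃ k : ℕ, ∀ p ∈ s, (p : ℕ) ≤ 2 * k + 3 := by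
      obtain ⟨k, hk⟩ := (s.image fun p : Nat.Primes => (p : ℕ)).bddAbove
      exact ⟨k, fun p hp => (hk (Finset.mem_coe.mpr (Finset.mem_image_of_mem _ hp))).trans
        (by omega)⟩
    have e := Finset.sum_image (s := s) (g := fun p : Nat.Primes => (p : ℕ))
      (f := fun p : ℕ => -(Real.log (1 - 1 / (p : ℝ)) + 1 / (p : ℝ)))
      (Nat.Primes.coe_nat_injective.injOn)
    refine e.symm.trans_le ?_
    refine le_trans (Finset.sum_le_sum_of_subset_of_nonneg ?_ fun p hp _ => ?_)
      ((sum_primesLE_neg_log_one_sub_inv_le k).trans ?_)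
    · intro p hp
      obtain ⟨q, hq, rfl⟩ := Finset.mem_image.mp hp
      exact Nat.mem_primesLE.mpr ⟨hk q hq, q.2⟩
    · have h2 : (2 : ℝ) ≤ p := by exact_mod_cast Nat.two_le_of_mem_primesLE hp
      have h1 : 1 / (p : ℝ) < 1 := by
        rw [div_lt_one (by linarith)]
        linarith
      have := Real.log_le_sub_one_of_pos (sub_pos.mpr h1)
      linarith
    · have : (0 : ℝ) ≤ 1 / (2 * (2 * k + 3)) := by positivity
      linarith
  rw [tsum_neg] at h
  have := Real.one_half_lt_eulerMascheroniConstant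
  unfold meisselMertens
  linarith

/-! ### Identification of the constant in Mertens' second theorem. -/

/-- Abelian theorem for the Laplace transform at `0`. -/
theorem tendsto_integral_mul_exp_neg {D : ℝ → ℝ} {K c : ℝ} (hm : Measurable D)
    (hK : ∀ u, |D u| ≤ K) (hc : Tendsto D atTop (nhds c)) :
    Tendsto (fun ε : ℝ => ∫ u in Set.Ioi 0, D u * (ε * Real.exp (-ε * u)))
      (nhdsWithin 0 (Set.Ioi 0)) (nhds c) := by
  have hsub : ∀ ε : ℝ, 0 < ε → ∫ u in Set.Ioi 0, D (u / ε) * Real.exp (-u)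
      = ∫ u in Set.Ioi 0, D u * (ε * Real.exp (-ε * u)) := by
    intro ε hε
    have := MeasureTheory.integral_comp_mul_left_Ioi
      (fun u => D (u / ε) * Real.exp (-u)) 0 hε
    rw [mul_zero] at this
    rw [eq_inv_smul_iff₀ hε.ne'] at this
    rw [← this, smul_eq_mul, ← MeasureTheory.integral_const_mul]
    refine MeasureTheory.integral_congr_ae (Eventually.of_forall fun u => ?_)
    simp only
    rw [mul_div_cancel_left₀ _ hε.ne', neg_mul]
    ring
  have hint : MeasureTheory.IntegrableOn (fun u : ℝ => Real.exp (-u)) (Set.Ioi 0) :=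
    integrableOn_exp_neg_Ioi 0
  -- After rescaling `u` by `ε`, the integrand is dominated by `K e^{-u}` and `D(u/ε) → c`
  -- pointwise.
  have hlim : Tendsto (fun ε : ℝ => ∫ u in Set.Ioi 0, D (u / ε) * Real.exp (-u))
      (nhdsWithin 0 (Set.Ioi 0)) (nhds (∫ u in Set.Ioi 0, c * Real.exp (-u))) := by
    refine MeasureTheory.tendsto_integral_filter_of_dominated_convergence
      (fun u => K * Real.exp (-u)) ?_ ?_ (hint.const_mul K) ?_
    · refine Eventually.of_forall fun ε => Measurable.aestronglyMeasurable ?_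
      exact (hm.comp (measurable_id.div_const ε)).mul (by fun_prop)
    · refine Eventually.of_forall fun ε => Eventually.of_forall fun u => ?_
      rw [norm_mul, Real.norm_eq_abs, Real.norm_of_nonneg (Real.exp_pos _).le]
      exact mul_le_mul_of_nonneg_right (hK _) (Real.exp_pos _).le
    · refine (MeasureTheory.ae_restrict_mem measurableSet_Ioi).mono fun u hu => ?_
      refine Tendsto.mul_const _ (hc.comp ?_)
      have : Tendsto (fun ε : ℝ => u * ε⁻¹) (nhdsWithin 0 (Set.Ioi 0)) atTop :=
        tendsto_inv_nhdsGT_zero.const_mul_atTop hu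
      exact this
  rw [MeasureTheory.integral_const_mul, integral_exp_neg_Ioi_zero, mul_one] at hlim
  refine hlim.congr' ?_
  filter_upwards [self_mem_nhdsWithin] with ε hε
  exact hsub ε hε

/-- Partial summation: write `e^{-ελ}` as the integral of `ε e^{-εu}` over `u ≥ λ` and interchange
sum and integral. -/
theorem hasSum_mul_exp_neg_integral {ι : Type*} [Countable ι] {a lam : ι → ℝ} {ε : ℝ}
    (hε : 0 < ε) (hlam : ∀ i, 0 < lam i) (hs : Summable fun i => a i * Real.exp (-ε * lam i)) :
    HasSum (fun i => a i * Real.exp (-ε * lam i))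
      (∫ u in Set.Ioi 0, (∑' i, if lam i ≤ u then a i else 0) * (ε * Real.exp (-ε * u))) := by
  have hexp : ∀ i, ∫ u in Set.Ici (lam i), ε * Real.exp (-ε * u) = Real.exp (-ε * lam i) := by
    intro i
    rw [MeasureTheory.integral_Ici_eq_integral_Ioi, MeasureTheory.integral_const_mul,
      integral_exp_mul_Ioi (by linarith)]
    field_simp
  have hexpint : ∀ x : ℝ, MeasureTheory.IntegrableOn (fun u => ε * Real.exp (-ε * u))
      (Set.Ioi x) := fun x => (exp_neg_integrableOn_Ioi x hε).const_mul ε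
  set F : ι → ℝ → ℝ := fun i => (Set.Ici (lam i)).indicator
    (fun u => a i * (ε * Real.exp (-ε * u))) with hF
  have hFint : ∀ i, MeasureTheory.IntegrableOn (F i) (Set.Ioi 0) := fun i =>
    ((hexpint 0).const_mul (a i)).indicator measurableSet_Ici
  have hinter : ∀ i, Set.Ioi 0 ∩ Set.Ici (lam i) = Set.Ici (lam i) := fun i =>
    Set.inter_eq_right.mpr fun u hu => (hlam i).trans_le hu
  have hFval : ∀ i, ∫ u in Set.Ioi 0, F i u = a i * Real.exp (-ε * lam i) := by
    intro i
    rw [hF, MeasureTheory.setIntegral_indicator measurableSet_Ici, hinter,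
      MeasureTheory.integral_const_mul, hexp]
  have hFnorm : ∀ i, ∫ u in Set.Ioi 0, ‖F i u‖ = |a i * Real.exp (-ε * lam i)| := by
    intro i
    have : ∀ u, ‖F i u‖ = (Set.Ici (lam i)).indicator
        (fun u => |a i| * (ε * Real.exp (-ε * u))) u := by
      intro u
      rw [hF, norm_indicator_eq_indicator_norm]
      congr 1
      funext u
      rw [norm_mul, Real.norm_eq_abs, Real.norm_of_nonneg (by positivity)]
    simp_rw [this]
    rw [MeasureTheory.setIntegral_indicator measurableSet_Ici, hinter,
      MeasureTheory.integral_const_mul, hexp, abs_mul, abs_of_pos (Real.exp_pos _)]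
  have h := MeasureTheory.hasSum_integral_of_summable_integral_norm hFint
    (by simp_rw [hFnorm]; exact hs.abs)
  simp_rw [hFval] at h
  convert! h using 2
  funext u
  rw [← tsum_mul_right]
  refine tsum_congr fun i => ?_
  rw [hF]
  simp only [Set.indicator, Set.mem_Ici]
  split_ifs <;> simp


/-- `∑_{p ≤ e^u} 1/p - ∑_{m ≤ u} 1/m`. -/
noncomputable def primeHarmonicDiff (u : ℝ) : ℝ :=
  ∑ p ∈ (⌊Real.exp u⌋₊).primesLE, 1 / (p : ℝ) - ∑ i ∈ Finset.range ⌊u⌋₊, 1 / ((i : ℝ) + 1)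

theorem measurable_primeHarmonicDiff : Measurable primeHarmonicDiff := by
  refine Measurable.sub ?_ ?_
  · exact (measurable_from_top (f := fun n : ℕ => ∑ p ∈ n.primesLE, 1 / (p : ℝ))).comp
      (Nat.measurable_floor.comp Real.measurable_exp)
  · exact (measurable_from_top (f := fun n : ℕ => ∑ i ∈ Finset.range n, 1 / ((i : ℝ) + 1))).comp
      Nat.measurable_floor

/-- The harmonic sum stands in for `log u`: it differs from it by `γ + o(1)`, and its Laplace
transform is the explicit `-log(1 - e^{-ε})`. -/
theorem tendsto_primeHarmonicDiff {B : ℝ}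
    (hB : Tendsto (fun v : ℝ => ∑ p ∈ (⌊Real.exp v⌋₊).primesLE, 1 / (p : ℝ) - Real.log v)
      atTop (nhds B)) :
    Tendsto primeHarmonicDiff atTop (nhds (B - Real.eulerMascheroniConstant)) := by
  have h1 := Real.tendsto_harmonic_sub_log.comp (tendsto_nat_floor_atTop (α := ℝ))
  have h2 : Tendsto (fun u : ℝ => Real.log ((⌊u⌋₊ : ℝ) / u)) atTop (nhds 0) := by
    have := (tendsto_nat_floor_div_atTop (R := ℝ)).log one_ne_zero
    rwa [Real.log_one] at this
  have h3 := (hB.sub h1).sub h2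
  rw [sub_zero] at h3
  refine h3.congr' ?_
  filter_upwards [eventually_ge_atTop 1] with u hu
  have hfl : (0 : ℝ) < ⌊u⌋₊ := by exact_mod_cast Nat.floor_pos.mpr hu
  rw [Real.log_div hfl.ne' (by linarith)]
  simp only [Function.comp, primeHarmonicDiff, harmonic]
  push_cast
  simp only [one_div]
  ring

theorem exists_abs_primeHarmonicDiff_le {c : ℝ}
    (hc : Tendsto primeHarmonicDiff atTop (nhds c)) : ∃ K : ℝ, ∀ u, |primeHarmonicDiff u| ≤ K := by
  have h1 : ∀ᶠ u in atTop, |primeHarmonicDiff u| < |c| + 1 :=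
    hc.abs.eventually_lt_const (by linarith)
  obtain ⟨U, hU⟩ := eventually_atTop.mp h1
  refine ⟨|c| + 1 + (∑ p ∈ (⌊Real.exp U⌋₊).primesLE, 1 / (p : ℝ)
    + ∑ i ∈ Finset.range ⌊U⌋₊, 1 / ((i : ℝ) + 1)), fun u => ?_⟩
  have e1 : 0 ≤ ∑ p ∈ (⌊Real.exp U⌋₊).primesLE, 1 / (p : ℝ) :=
    Finset.sum_nonneg fun p _ => by positivity
  have e2 : 0 ≤ ∑ i ∈ Finset.range ⌊U⌋₊, 1 / ((i : ℝ) + 1) :=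
    Finset.sum_nonneg fun p _ => by positivity
  rcases le_total U u with h | h
  · have := hU u h
    linarith
  · have f1 : 0 ≤ ∑ p ∈ (⌊Real.exp u⌋₊).primesLE, 1 / (p : ℝ) :=
      Finset.sum_nonneg fun p _ => by positivity
    have f2 : 0 ≤ ∑ i ∈ Finset.range ⌊u⌋₊, 1 / ((i : ℝ) + 1) :=
      Finset.sum_nonneg fun p _ => by positivity
    have g1 : ∑ p ∈ (⌊Real.exp u⌋₊).primesLE, 1 / (p : ℝ)
        ≤ ∑ p ∈ (⌊Real.exp U⌋₊).primesLE, 1 / (p : ℝ) :=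
      Finset.sum_le_sum_of_subset_of_nonneg
        (Nat.primesLE_mono (Nat.floor_le_floor (Real.exp_le_exp.mpr h)))
        fun p _ _ => by positivity
    have g2 : ∑ i ∈ Finset.range ⌊u⌋₊, 1 / ((i : ℝ) + 1)
        ≤ ∑ i ∈ Finset.range ⌊U⌋₊, 1 / ((i : ℝ) + 1) :=
      Finset.sum_le_sum_of_subset_of_nonneg
        (Finset.range_mono (Nat.floor_le_floor h)) fun p _ _ => by positivity
    have := abs_nonneg c
    unfold primeHarmonicDiff
    rw [abs_le]
    constructor <;> linarith

theorem tsum_primes_ite_log_le (u : ℝ) :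
    HasSum (fun p : Nat.Primes => if Real.log ((p : ℕ) : ℝ) ≤ u then 1 / ((p : ℕ) : ℝ) else 0)
      (∑ p ∈ (⌊Real.exp u⌋₊).primesLE, 1 / (p : ℝ)) := by
  have h : HasSum (Set.indicator {p : ℕ | p.Prime}
      fun p : ℕ => if Real.log (p : ℝ) ≤ u then 1 / (p : ℝ) else 0)
      (∑ p ∈ (⌊Real.exp u⌋₊).primesLE, 1 / (p : ℝ)) := by
    have hmem : ∀ p : ℕ, p ∈ (⌊Real.exp u⌋₊).primesLE ↔ p.Prime ∧ Real.log (p : ℝ) ≤ u := by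
      intro p
      rw [Nat.mem_primesLE, and_comm]
      refine and_congr_right fun hp => ?_
      rw [Nat.le_floor_iff (Real.exp_pos u).le, Real.log_le_iff_le_exp (by exact_mod_cast hp.pos)]
    have e : ∑ p ∈ (⌊Real.exp u⌋₊).primesLE, 1 / (p : ℝ)
        = ∑ p ∈ (⌊Real.exp u⌋₊).primesLE, (Set.indicator {p : ℕ | p.Prime}
          fun p : ℕ => if Real.log (p : ℝ) ≤ u then 1 / (p : ℝ) else 0) p := by
      refine Finset.sum_congr rfl fun p hp => ?_
      have := (hmem p).mp hp
      simp [Set.indicator, this.1, this.2]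
    rw [e]
    refine hasSum_sum_of_ne_finset_zero fun p hp => ?_
    by_contra h0
    apply hp
    rw [hmem]
    simp only [Set.indicator, Set.mem_ofPred_eq] at h0
    split_ifs at h0 with h1 h2
    · exact ⟨h1, h2⟩
    · simp at h0
    · simp at h0
  exact hasSum_subtype_iff_indicator.mpr h

theorem hasSum_ite_natCast_add_one_le {u : ℝ} (hu : 0 ≤ u) :
    HasSum (fun i : ℕ => if (i : ℝ) + 1 ≤ u then -(1 / ((i : ℝ) + 1)) else 0)
      (-∑ i ∈ Finset.range ⌊u⌋₊, 1 / ((i : ℝ) + 1)) := by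
  have hmem : ∀ i : ℕ, i ∈ Finset.range ⌊u⌋₊ ↔ (i : ℝ) + 1 ≤ u := by
    intro i
    rw [Finset.mem_range, Nat.lt_iff_add_one_le, Nat.le_floor_iff hu]
    push_cast
    rfl
  have e : -∑ i ∈ Finset.range ⌊u⌋₊, 1 / ((i : ℝ) + 1)
      = ∑ i ∈ Finset.range ⌊u⌋₊, if (i : ℝ) + 1 ≤ u then -(1 / ((i : ℝ) + 1)) else 0 := by
    rw [← Finset.sum_neg_distrib]
    exact Finset.sum_congr rfl fun i hi => (if_pos ((hmem i).mp hi)).symm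
  rw [e]
  exact hasSum_sum_of_ne_finset_zero fun i hi => if_neg fun h => hi ((hmem i).mpr h)

theorem hasSum_exp_neg_mul_div {ε : ℝ} (hε : 0 < ε) :
    HasSum (fun i : ℕ => -(1 / ((i : ℝ) + 1)) * Real.exp (-ε * ((i : ℝ) + 1)))
      (Real.log (1 - Real.exp (-ε))) := by
  have h := Real.hasSum_pow_div_log_of_abs_lt_one (x := Real.exp (-ε))
    (by rw [abs_of_pos (Real.exp_pos _), Real.exp_lt_one_iff]; linarith)
  convert! h.neg using 1
  · funext i
    have : Real.exp (-ε * ((i : ℝ) + 1)) = Real.exp (-ε) ^ (i + 1) := by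
      rw [← Real.exp_nat_mul]
      congr 1
      push_cast
      ring
    rw [this]
    ring
  · ring

/-- Primes (at `log p`, weight `1/p`) and positive integers (weight `-1/m` at `m`) are merged into
one series indexed by `Nat.Primes ⊕ ℕ`. -/
theorem integral_primeHarmonicDiff {ε : ℝ} (hε : 0 < ε) :
    ∫ u in Set.Ioi 0, primeHarmonicDiff u * (ε * Real.exp (-ε * u))
      = ∑' p : Nat.Primes, ((p : ℕ) : ℝ) ^ (-(1 + ε)) + Real.log (1 - Real.exp (-ε)) := by
  have hpow : ∀ p : Nat.Primes, 1 / ((p : ℕ) : ℝ) * Real.exp (-ε * Real.log ((p : ℕ) : ℝ))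
      = ((p : ℕ) : ℝ) ^ (-(1 + ε)) := by
    intro p
    have hp : (0 : ℝ) < ((p : ℕ) : ℝ) := by exact_mod_cast p.2.pos
    rw [neg_add, Real.rpow_add hp, Real.rpow_neg_one, Real.rpow_def_of_pos hp, one_div,
      mul_comm (Real.log _)]
  have hs1 : HasSum (fun p : Nat.Primes =>
      1 / ((p : ℕ) : ℝ) * Real.exp (-ε * Real.log ((p : ℕ) : ℝ)))
      (∑' p : Nat.Primes, ((p : ℕ) : ℝ) ^ (-(1 + ε))) := by
    simp_rw [hpow]
    exact (Nat.Primes.summable_rpow.mpr (by linarith)).hasSum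
  set a : Nat.Primes ⊕ ℕ → ℝ := Sum.elim (fun p => 1 / ((p : ℕ) : ℝ))
    (fun i => -(1 / ((i : ℝ) + 1))) with ha
  set lam : Nat.Primes ⊕ ℕ → ℝ := Sum.elim (fun p => Real.log ((p : ℕ) : ℝ))
    (fun i => (i : ℝ) + 1) with hlam
  have hsum : HasSum (fun i => a i * Real.exp (-ε * lam i))
      (∑' p : Nat.Primes, ((p : ℕ) : ℝ) ^ (-(1 + ε)) + Real.log (1 - Real.exp (-ε))) :=
    HasSum.sum hs1 (hasSum_exp_neg_mul_div hε)
  have hlampos : ∀ i, 0 < lam i := by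
    rintro (p | i)
    · exact Real.log_pos (by exact_mod_cast p.2.one_lt)
    · simp only [hlam, Sum.elim_inr]
      positivity
  refine ((MeasureTheory.setIntegral_congr_fun measurableSet_Ioi fun u hu => ?_).trans
    ((hasSum_mul_exp_neg_integral hε hlampos hsum.summable).unique hsum))
  congr 1
  have : HasSum (fun i => if lam i ≤ u then a i else 0) (primeHarmonicDiff u) :=
    HasSum.sum (tsum_primes_ite_log_le u) (hasSum_ite_natCast_add_one_le (le_of_lt hu))
  exact this.tsum_eq.symm


theorem prime_rpow_neg_le {ε : ℝ} (hε : 0 ≤ ε) (p : Nat.Primes) :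
    0 < ((p : ℕ) : ℝ) ^ (-(1 + ε)) ∧ ((p : ℕ) : ℝ) ^ (-(1 + ε)) ≤ 1 / ((p : ℕ) : ℝ) ∧
      ((p : ℕ) : ℝ) ^ (-(1 + ε)) ≤ 1 / 2 := by
  have h2 : (2 : ℝ) ≤ ((p : ℕ) : ℝ) := by exact_mod_cast p.2.two_le
  have h1 : ((p : ℕ) : ℝ) ^ (-(1 + ε)) ≤ 1 / ((p : ℕ) : ℝ) := by
    rw [one_div, ← Real.rpow_neg_one]
    exact Real.rpow_le_rpow_of_exponent_le (by linarith) (by linarith)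
  exact ⟨Real.rpow_pos_of_pos (by linarith) _, h1,
    h1.trans (one_div_le_one_div_of_le (by norm_num) h2)⟩

theorem abs_log_one_sub_prime_rpow_add_le {ε : ℝ} (hε : 0 ≤ ε) (p : Nat.Primes) :
    |Real.log (1 - ((p : ℕ) : ℝ) ^ (-(1 + ε))) + ((p : ℕ) : ℝ) ^ (-(1 + ε))|
      ≤ 2 * (1 / ((p : ℕ) : ℝ) ^ 2) := by
  obtain ⟨h1, h2, h3⟩ := prime_rpow_neg_le hε p
  refine (abs_log_one_sub_add_self_le h1.le (by linarith)).trans ?_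
  rw [div_le_iff₀ (by linarith), ← one_div_pow]
  have h4 : (((p : ℕ) : ℝ) ^ (-(1 + ε))) ^ 2 ≤ (1 / ((p : ℕ) : ℝ)) ^ 2 := by gcongr
  nlinarith [sq_nonneg (1 / ((p : ℕ) : ℝ))]

theorem summable_two_mul_one_div_prime_sq :
    Summable fun p : Nat.Primes => 2 * (1 / ((p : ℕ) : ℝ) ^ 2) :=
  ((Real.summable_one_div_nat_pow.mpr (by norm_num : 1 < 2)).comp_injective
    Nat.Primes.coe_nat_injective).mul_left 2

theorem tendsto_tsum_log_one_sub_prime_rpow_add :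
    Tendsto (fun ε : ℝ => ∑' p : Nat.Primes,
        (Real.log (1 - ((p : ℕ) : ℝ) ^ (-(1 + ε))) + ((p : ℕ) : ℝ) ^ (-(1 + ε))))
      (nhdsWithin 0 (Set.Ioi 0))
      (nhds (∑' p : Nat.Primes, (Real.log (1 - 1 / ((p : ℕ) : ℝ)) + 1 / ((p : ℕ) : ℝ)))) := by
  refine tendsto_tsum_of_dominated_convergence summable_two_mul_one_div_prime_sq ?_ ?_
  · intro p
    have hp : (0 : ℝ) < ((p : ℕ) : ℝ) := by exact_mod_cast p.2.pos
    have h1 : Tendsto (fun ε : ℝ => ((p : ℕ) : ℝ) ^ (-(1 + ε))) (nhdsWithin 0 (Set.Ioi 0))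
        (nhds (1 / ((p : ℕ) : ℝ))) := by
      have hc : ContinuousAt (fun ε : ℝ => ((p : ℕ) : ℝ) ^ (-(1 + ε))) 0 :=
        ContinuousAt.rpow continuousAt_const (by fun_prop) (Or.inl hp.ne')
      have := hc.tendsto.mono_left (nhdsWithin_le_nhds (s := Set.Ioi 0))
      rwa [add_zero, Real.rpow_neg_one, ← one_div] at this
    refine Tendsto.add (Tendsto.log (h1.const_sub 1) ?_) h1
    have := (prime_rpow_neg_le le_rfl p).2.2
    rw [add_zero, Real.rpow_neg_one, ← one_div] at this
    linarith
  · filter_upwards [self_mem_nhdsWithin] with ε hε p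
    exact abs_log_one_sub_prime_rpow_add_le (le_of_lt hε) p

/-- The Euler product of `ζ(1 + ε)`, in logarithmic form. -/
theorem exp_tsum_neg_log_one_sub_prime_rpow {ε : ℝ} (hε : 0 < ε) :
    Real.exp (∑' p : Nat.Primes, -Real.log (1 - ((p : ℕ) : ℝ) ^ (-(1 + ε))))
      = ∑' n : ℕ, 1 / (n : ℝ) ^ (1 + ε) := by
  set f : ℕ →*₀ ℝ :=
    { toFun := fun n => (n : ℝ) ^ (-(1 + ε))
      map_zero' := by rw [Nat.cast_zero, Real.zero_rpow (by linarith)]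
      map_one' := by simp
      map_mul' := fun m n => by
        rw [Nat.cast_mul, Real.mul_rpow (Nat.cast_nonneg m) (Nat.cast_nonneg n)] } with hf
  have hfn : ∀ n : ℕ, f n = 1 / (n : ℝ) ^ (1 + ε) := fun n => by
    rw [one_div, ← Real.rpow_neg (Nat.cast_nonneg n)]
    rfl
  have hsum : Summable fun n => ‖f n‖ := by
    simp_rw [hfn]
    exact (Real.summable_one_div_nat_rpow.mpr (by linarith)).norm
  have hprod := (EulerProduct.eulerProduct_completely_multiplicative_hasProd hsum).tprod_eq
  simp_rw [← hfn]
  rw [← hprod, ← Real.rexp_tsum_eq_tprod]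
  · refine congrArg Real.exp (tsum_congr fun p => ?_)
    rw [Real.log_inv]
    rfl
  · intro p
    have := (prime_rpow_neg_le hε.le p).2.2
    exact inv_pos.mpr (sub_pos.mpr (lt_of_le_of_lt this (by norm_num)))
  · have h1 : Summable fun p : Nat.Primes =>
        (Real.log (1 - ((p : ℕ) : ℝ) ^ (-(1 + ε))) + ((p : ℕ) : ℝ) ^ (-(1 + ε))) :=
      Summable.of_norm_bounded summable_two_mul_one_div_prime_sq
        fun p => abs_log_one_sub_prime_rpow_add_le hε.le p
    refine ((Nat.Primes.summable_rpow.mpr (by linarith : -(1 + ε) < -1)).sub h1).congr fun p => ?_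
    rw [Real.log_inv]
    simp [hf]

/-- The constant in Mertens' second theorem. -/
theorem eq_meisselMertens_of_tendsto {B : ℝ}
    (hB : Tendsto (fun v : ℝ => ∑ p ∈ (⌊Real.exp v⌋₊).primesLE, 1 / (p : ℝ) - Real.log v)
      atTop (nhds B)) : B = meisselMertens := by
  have hD := tendsto_primeHarmonicDiff hB
  obtain ⟨K, hK⟩ := exists_abs_primeHarmonicDiff_le hD
  have hI := tendsto_integral_mul_exp_neg measurable_primeHarmonicDiff hK hD
  have hzeta : Tendsto (fun ε : ℝ => ε * ∑' n : ℕ, 1 / (n : ℝ) ^ (1 + ε))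
      (nhdsWithin 0 (Set.Ioi 0)) (nhds 1) := by
    have hshift : Tendsto (fun ε : ℝ => 1 + ε) (nhdsWithin 0 (Set.Ioi 0))
        (nhdsWithin 1 (Set.Ioi 1)) := by
      refine tendsto_nhdsWithin_iff.mpr ⟨?_, ?_⟩
      · have : Tendsto (fun ε : ℝ => 1 + ε) (nhds 0) (nhds (1 + 0)) :=
          tendsto_const_nhds.add tendsto_id
        rw [add_zero] at this
        exact this.mono_left nhdsWithin_le_nhds
      · filter_upwards [self_mem_nhdsWithin] with ε hε
        simpa using hε
    refine (tendsto_sub_mul_tsum_nat_rpow.comp hshift).congr fun ε => ?_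
    simp
  have hexp : Tendsto (fun ε : ℝ => (1 - Real.exp (-ε)) / ε) (nhdsWithin 0 (Set.Ioi 0))
      (nhds 1) := by
    have h1 : HasDerivAt (fun ε : ℝ => 1 - Real.exp (-ε)) 1 0 := by
      have := ((hasDerivAt_id (0 : ℝ)).neg.exp).const_sub 1
      simpa using this
    have h2 := h1.tendsto_slope_zero_right
    refine h2.congr fun ε => ?_
    simp
    ring
  -- The simple pole of `ζ(1 + ε)` is cancelled by `1 - e^{-ε} ∼ ε`. The Laplace transform then
  -- tends both to `B - γ` and to the prime sum in the definition of the constant.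
  have hlog : Tendsto (fun ε : ℝ => Real.log (∑' n : ℕ, 1 / (n : ℝ) ^ (1 + ε))
      + Real.log (1 - Real.exp (-ε))) (nhdsWithin 0 (Set.Ioi 0)) (nhds 0) := by
    have h1 := (hzeta.mul hexp).log (by norm_num)
    rw [mul_one, Real.log_one] at h1
    refine h1.congr' ?_
    filter_upwards [self_mem_nhdsWithin] with ε hε
    have hε0 : ε ≠ 0 := ne_of_gt hε
    rw [← Real.log_mul]
    · congr 1
      field_simp
    · rw [← exp_tsum_neg_log_one_sub_prime_rpow hε]
      exact (Real.exp_pos _).ne'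
    · have : Real.exp (-ε) < 1 := Real.exp_lt_one_iff.mpr (by simpa using hε)
      linarith
  have hsum := tendsto_tsum_log_one_sub_prime_rpow_add.add hlog
  rw [add_zero] at hsum
  have heq := tendsto_nhds_unique (hI.congr' ?_) hsum
  · unfold meisselMertens
    linarith
  · filter_upwards [self_mem_nhdsWithin] with ε hε
    have hε0 : 0 < ε := hε
    have h1 : Summable fun p : Nat.Primes =>
        (Real.log (1 - ((p : ℕ) : ℝ) ^ (-(1 + ε))) + ((p : ℕ) : ℝ) ^ (-(1 + ε))) :=
      Summable.of_norm_bounded summable_two_mul_one_div_prime_sq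
        fun p => abs_log_one_sub_prime_rpow_add_le hε0.le p
    have h2 : Summable fun p : Nat.Primes => ((p : ℕ) : ℝ) ^ (-(1 + ε)) :=
      Nat.Primes.summable_rpow.mpr (by linarith)
    rw [integral_primeHarmonicDiff hε0, ← exp_tsum_neg_log_one_sub_prime_rpow hε0, Real.log_exp,
      ← add_assoc]
    congr 1
    have h3 : Summable fun p : Nat.Primes => -Real.log (1 - ((p : ℕ) : ℝ) ^ (-(1 + ε))) :=
      (h2.sub h1).congr fun p => by ring
    rw [← h1.tsum_add h3]
    exact tsum_congr fun p => by ring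


/-! ### Mean values of `(1 + w)^{ω(n)}` and the moment generating function. -/

theorem sum_divisors_sqfreePow {R : Type*} [CommSemiring R] (w : R) {n : ℕ} (hn : n ≠ 0) :
    ∑ d ∈ n.divisors, sqfreePow w d = (1 + w) ^ ArithmeticFunction.cardDistinctFactors n := by
  have h1 : (1 + w) ^ ArithmeticFunction.cardDistinctFactors n
      = ∑ t ∈ n.primeFactors.powerset, w ^ t.card := by
    have := Finset.prod_one_add (s := n.primeFactors) (f := fun _ => w)
    simp only [Finset.prod_const] at this
    exact this
  rw [h1, ← Finset.sum_filter_of_ne (p := Squarefree)]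
  · refine Finset.sum_nbij' (fun d => d.primeFactors) (fun t => ∏ p ∈ t, p) ?_ ?_ ?_ ?_ ?_
    · intro d hd
      rw [Finset.mem_filter, Nat.mem_divisors] at hd
      exact Finset.mem_powerset.mpr (Nat.primeFactors_mono hd.1.1 hn)
    · intro t ht
      rw [Finset.mem_powerset] at ht
      have hp : ∀ p ∈ t, p.Prime := fun p hp => Nat.prime_of_mem_primeFactors (ht hp)
      rw [Finset.mem_filter, Nat.mem_divisors]
      refine ⟨⟨(Finset.prod_dvd_prod_of_subset _ _ _ ht).trans (Nat.prod_primeFactors_dvd n), hn⟩,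
        ?_⟩
      refine Finset.squarefree_prod_of_pairwise_isCoprime (fun p hp' q hq hpq => ?_)
        fun p hp' => (hp p hp').prime.squarefree
      exact Nat.coprime_iff_isRelPrime.mp ((Nat.coprime_primes (hp p hp') (hp q hq)).mpr hpq)
    · intro d hd
      rw [Finset.mem_filter] at hd
      exact Nat.prod_primeFactors_of_squarefree hd.2
    · intro t ht
      rw [Finset.mem_powerset] at ht
      exact Nat.primeFactors_prod fun p hp => Nat.prime_of_mem_primeFactors (ht hp)
    · intro d hd
      rw [Finset.mem_filter] at hd
      rw [sqfreePow, if_pos hd.2]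
      rfl
  · intro d _ hd
    by_contra h
    exact hd (sqfreePow_of_not_squarefree w h)

theorem sum_one_add_pow_cardDistinctFactors (w : ℂ) (N : ℕ) :
    ∑ n ∈ Finset.Icc 1 N, (1 + w) ^ ArithmeticFunction.cardDistinctFactors n
      = ∑ d ∈ Finset.Icc 1 N, sqfreePow w d * ((N / d : ℕ) : ℂ) := by
  have h1 : ∀ n ∈ Finset.Icc 1 N, (1 + w) ^ ArithmeticFunction.cardDistinctFactors n
      = ∑ d ∈ Finset.Icc 1 N, if d ∣ n then sqfreePow w d else 0 := by
    intro n hn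
    rw [Finset.mem_Icc] at hn
    rw [← sum_divisors_sqfreePow w (by omega : n ≠ 0), ← Finset.sum_filter]
    refine Finset.sum_congr ?_ fun _ _ => rfl
    ext d
    rw [Nat.mem_divisors, Finset.mem_filter, Finset.mem_Icc]
    constructor
    · rintro ⟨hd, h0⟩
      exact ⟨⟨Nat.pos_of_dvd_of_pos hd (by omega), (Nat.le_of_dvd (by omega) hd).trans hn.2⟩, hd⟩
    · rintro ⟨_, hd⟩
      exact ⟨hd, by omega⟩
  rw [Finset.sum_congr rfl h1, Finset.sum_comm]
  refine Finset.sum_congr rfl fun d _ => ?_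
  rw [← Finset.sum_filter, Finset.sum_const, nsmul_eq_mul, mul_comm]
  congr 2
  exact Nat.Ioc_filter_dvd_card_eq_div N d

/-- Each `⌊N/d⌋` is replaced by `N/d` at a cost of at most `1`; `exists_sum_sqfreePow_le` makes the
total negligible. -/
theorem norm_mean_sub_logMean_le (w : ℂ) {v : ℝ} (hv : 1 ≤ v) :
    ‖(∑ n ∈ Finset.Icc 1 ⌊Real.exp v⌋₊, (1 + w) ^ ArithmeticFunction.cardDistinctFactors n)
        / (⌊Real.exp v⌋₊ : ℂ) - logMean w v‖
      ≤ (∑ d ∈ Finset.Icc 1 ⌊Real.exp v⌋₊, sqfreePow ‖w‖ d) / (⌊Real.exp v⌋₊ : ℝ) := by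
  set N := ⌊Real.exp v⌋₊ with hN
  have hN0 : (0 : ℝ) < N := by
    have := two_le_floor_exp hv
    exact_mod_cast (by omega : 0 < N)
  have hNc : (N : ℂ) ≠ 0 := by exact_mod_cast hN0.ne'
  rw [sum_one_add_pow_cardDistinctFactors, logMean, Finset.sum_div, ← Finset.sum_sub_distrib,
    Finset.sum_div]
  refine (norm_sum_le _ _).trans (Finset.sum_le_sum fun d hd => ?_)
  rw [Finset.mem_Icc] at hd
  have hd0 : (0 : ℝ) < d := by exact_mod_cast hd.1
  have hdc : (d : ℂ) ≠ 0 := by exact_mod_cast hd0.ne'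
  have e : sqfreePow w d * ((N / d : ℕ) : ℂ) / N - sqfreePow w d / d
      = sqfreePow w d * (((((N / d : ℕ) : ℝ) - N / d) / N : ℝ) : ℂ) := by
    push_cast
    field_simp
  have hfl : |((N / d : ℕ) : ℝ) - N / d| ≤ 1 := by
    have h1 : ((N / d : ℕ) : ℝ) ≤ N / d := Nat.cast_div_le
    have h2 : (N : ℝ) / d < (N / d : ℕ) + 1 := by
      rw [div_lt_iff₀ hd0]
      have := Nat.lt_div_mul_add (a := N) hd.1
      have h3 : N < (N / d + 1) * d := by linarith
      exact_mod_cast h3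
    rw [abs_le]
    constructor <;> linarith
  rw [e, norm_mul, norm_sqfreePow, Complex.norm_real, Real.norm_eq_abs, abs_div, abs_of_pos hN0,
    div_eq_mul_one_div (sqfreePow ‖w‖ d)]
  exact mul_le_mul_of_nonneg_left (by gcongr) (sqfreePow_nonneg (norm_nonneg w) d)

/-- The mean value of `(1 + w)^{ω(n)}` over `n ≤ e^v` is `H(w) v^w + O(v^{-1/4})`. -/
theorem exists_mean_one_add_pow_asymptotic :
    ∃ (H : ℂ → ℂ) (C : ℝ), 0 < C ∧
      (∀ w : ℂ, ‖w‖ ≤ 1 / 4 → ∀ v : ℝ, 2 ≤ v →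
        ‖(∑ n ∈ Finset.Icc 1 ⌊Real.exp v⌋₊, (1 + w) ^ ArithmeticFunction.cardDistinctFactors n)
            / (⌊Real.exp v⌋₊ : ℂ) - H w * Complex.exp (w * (Real.log v : ℂ))‖
          ≤ C * v ^ (-(1 / 4) : ℝ)) ∧
      DifferentiableOn ℂ H (Metric.ball 0 (1 / 4)) ∧ H 0 = 1 ∧
      deriv H 0 = (meisselMertens : ℂ) := by
  obtain ⟨H, C₁, hC₁0, hC₁, hdiff, hH0, hlim⟩ := exists_logMean_asymptotic
  obtain ⟨C₂, hC₂0, hC₂⟩ := exists_sum_sqfreePow_le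
  refine ⟨H, 2 * C₂ + C₁, by positivity, fun w hw v hv => ?_, hdiff, hH0, ?_⟩
  · have hv1 : 1 ≤ v := by linarith
    have hv0 : 0 < v := by linarith
    set N := ⌊Real.exp v⌋₊ with hN
    have hN2 : 2 ≤ N := two_le_floor_exp hv1
    have hN0 : (0 : ℝ) < N := by exact_mod_cast (by omega : 0 < N)
    -- `e^v ≤ 2N` gives `log N ≥ v - log 2 ≥ v - 1`, which is at least `v/2` because `v ≥ 2`.
    have hlogN : v / 2 ≤ Real.log N := by
      have h1 : Real.exp v ≤ 2 * N := by
        have := Nat.lt_floor_add_one (Real.exp v)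
        have h2 : (2 : ℝ) ≤ N := by exact_mod_cast hN2
        rw [← hN] at this
        linarith
      have h2 := Real.log_le_log (Real.exp_pos v) h1
      rw [Real.log_exp, Real.log_mul (by norm_num) hN0.ne'] at h2
      have hl2 : Real.log 2 ≤ 1 := Real.log_two_lt_d9.le.trans (by norm_num)
      linarith
    have hlogN1 : 1 ≤ Real.log N := by linarith
    have hA : (∑ d ∈ Finset.Icc 1 N, sqfreePow ‖w‖ d) / (N : ℝ)
        ≤ 2 * C₂ * v ^ (-(1 / 4) : ℝ) := by
      have h1 := hC₂ ‖w‖ (norm_nonneg w) (by linarith) N hN2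
      have h2 : Real.log N ^ ‖w‖ ≤ v ^ (1 / 4 : ℝ) :=
        calc Real.log N ^ ‖w‖ ≤ Real.log N ^ (1 / 4 : ℝ) :=
              Real.rpow_le_rpow_of_exponent_le hlogN1 hw
          _ ≤ v ^ (1 / 4 : ℝ) :=
              Real.rpow_le_rpow (by linarith) (log_floor_exp_le hv1) (by norm_num)
      have h3 : v ^ (1 / 4 : ℝ) = v ^ (1 / 2 : ℝ) * v ^ (-(1 / 4) : ℝ) := by
        rw [← Real.rpow_add hv0]
        norm_num
      have h4 : v ^ (1 / 2 : ℝ) ≤ v := by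
        simpa using Real.rpow_le_rpow_of_exponent_le hv1 (by norm_num : (1 / 2 : ℝ) ≤ 1)
      have hq : 0 < v ^ (-(1 / 4) : ℝ) := Real.rpow_pos_of_pos hv0 _
      rw [div_le_iff₀ hN0]
      refine le_of_mul_le_mul_right (h1.trans ?_) (by linarith : 0 < Real.log N)
      calc C₂ * (N * Real.log N ^ ‖w‖) ≤ C₂ * (N * (v * v ^ (-(1 / 4) : ℝ))) := by
            gcongr
            rw [h3] at h2
            exact h2.trans (by gcongr)
        _ = C₂ * N * v ^ (-(1 / 4) : ℝ) * v := by ring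
        _ ≤ C₂ * N * v ^ (-(1 / 4) : ℝ) * (2 * Real.log N) := by
            gcongr
            linarith
        _ = _ := by ring
    have hB : ‖logMean w v - H w * Complex.exp (w * (Real.log v : ℂ))‖
        ≤ C₁ * v ^ (-(1 / 4) : ℝ) := by
      have e : logMean w v - H w * Complex.exp (w * (Real.log v : ℂ))
          = (logMean w v * Complex.exp (-w * (Real.log v : ℂ)) - H w)
            * Complex.exp (w * (Real.log v : ℂ)) := by
        rw [sub_mul, mul_assoc, ← Complex.exp_add]
        simp
      have h1 : ‖Complex.exp (w * (Real.log v : ℂ))‖ ≤ v ^ (1 / 4 : ℝ) :=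
        norm_exp_mul_log_le hv1 ((Complex.re_le_norm w).trans hw)
      rw [e, norm_mul]
      calc _ ≤ C₁ * v ^ (-(1 / 2) : ℝ) * v ^ (1 / 4 : ℝ) := by
            gcongr
            exact hC₁ w hw v hv1
        _ = _ := by
            rw [mul_assoc, ← Real.rpow_add hv0]
            norm_num
    calc _ ≤ ‖_ - logMean w v‖ + ‖logMean w v - H w * Complex.exp (w * (Real.log v : ℂ))‖ :=
          norm_sub_le_norm_sub_add_norm_sub _ _ _
      _ ≤ 2 * C₂ * v ^ (-(1 / 4) : ℝ) + C₁ * v ^ (-(1 / 4) : ℝ) :=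
          add_le_add ((norm_mean_sub_logMean_le w hv1).trans hA) hB
      _ = _ := by ring
  · have hre : Tendsto (fun v : ℝ =>
        ∑ p ∈ (⌊Real.exp v⌋₊).primesLE, 1 / (p : ℝ) - Real.log v) atTop
        (nhds (deriv H 0).re) := by
      have := (Complex.continuous_re.tendsto _).comp hlim
      exact this
    have him : (deriv H 0).im = 0 := by
      have h1 := (Complex.continuous_im.tendsto _).comp hlim
      refine tendsto_nhds_unique h1 (tendsto_const_nhds.congr fun v => ?_)
      exact (Complex.ofReal_im _).symm
    apply Complex.ext
    · rw [Complex.ofReal_re]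
      exact eq_meisselMertens_of_tendsto hre
    · rw [him, Complex.ofReal_im]

/-- `E exp(s (ω(n) - log log x)) exp(-s² log log x / 2)`. -/
noncomputable def normalizedMgf (x : ℝ) (s : ℂ) : ℂ :=
  (∑ n ∈ Finset.Icc 1 ⌊x⌋₊,
      Complex.exp (s * (((ArithmeticFunction.cardDistinctFactors n : ℝ) - logLog x : ℝ) : ℂ)))
    / (⌊x⌋₊ : ℂ) * Complex.exp (-((logLog x : ℂ) * s ^ 2 / 2))

/-- Take `w = e^s - 1` and `v = log x`, so `v^w = exp(L(e^s - 1))`, `v^{-1/4} = e^{-L/4}` and `Φ(s)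
= H(e^s - 1)`. The radius `1/8` keeps `|w| < 1/4`, since `|e^s - 1| ≤ 2|s|`. -/
theorem exists_normalizedMgf_asymptotic :
    ∃ (Φ : ℂ → ℂ) (K : ℝ), 0 < K ∧ DifferentiableOn ℂ Φ (Metric.ball 0 (1 / 8)) ∧ Φ 0 = 1 ∧
      deriv Φ 0 = (meisselMertens : ℂ) ∧
      ∀ x : ℝ, 0 < x → 2 ≤ Real.log x → ∀ s : ℂ, ‖s‖ < 1 / 8 →
        ‖normalizedMgf x s
            - Φ s * Complex.exp (logLog x * (Complex.exp s - 1 - s - s ^ 2 / 2))‖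
          ≤ K * Real.exp (-(logLog x / 4) + logLog x * ‖s‖ + logLog x * ‖s‖ ^ 2) := by
  obtain ⟨H, C, hC0, hC, hdiff, hH0, hH1⟩ := exists_mean_one_add_pow_asymptotic
  have hsmall : ∀ s : ℂ, ‖s‖ < 1 / 8 → ‖Complex.exp s - 1‖ < 1 / 4 := by
    intro s hs
    have := Complex.norm_exp_sub_one_le (x := s) (by linarith)
    linarith
  refine ⟨fun s => H (Complex.exp s - 1), C, hC0, ?_, by simpa using hH0, ?_, ?_⟩
  · refine hdiff.comp (by fun_prop) fun s hs => ?_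
    rw [mem_ball_zero_iff] at hs ⊢
    exact hsmall s hs
  · have h1 : HasDerivAt H (meisselMertens : ℂ) (Complex.exp 0 - 1) := by
      rw [Complex.exp_zero, sub_self, ← hH1]
      exact ((hdiff 0 (by simp)).differentiableAt
        (Metric.isOpen_ball.mem_nhds (by simp))).hasDerivAt
    have h2 : HasDerivAt (fun s : ℂ => Complex.exp s - 1) 1 0 := by
      simpa using (Complex.hasDerivAt_exp 0).sub_const 1
    have h3 := (h1.comp (0 : ℂ) h2).deriv
    rwa [mul_one] at h3
  · intro x hx hv s hs
    set L := logLog x with hL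
    set v := Real.log x with hvdef
    have hv0 : 0 < v := by linarith
    have hLv : L = Real.log v := rfl
    have hL0 : 0 ≤ L := by
      rw [hLv]
      exact Real.log_nonneg (by linarith)
    have hxe : x = Real.exp v := (Real.exp_log hx).symm
    have h := hC (Complex.exp s - 1) (hsmall s hs).le v hv
    rw [← hxe, ← hLv] at h
    have e1 : ∑ n ∈ Finset.Icc 1 ⌊x⌋₊, Complex.exp
          (s * (((ArithmeticFunction.cardDistinctFactors n : ℝ) - L : ℝ) : ℂ))
        = (∑ n ∈ Finset.Icc 1 ⌊x⌋₊,
            (1 + (Complex.exp s - 1)) ^ ArithmeticFunction.cardDistinctFactors n)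
          * Complex.exp (-(s * L)) := by
      rw [Finset.sum_mul]
      refine Finset.sum_congr rfl fun n _ => ?_
      rw [add_sub_cancel, ← Complex.exp_nat_mul, ← Complex.exp_add]
      congr 1
      push_cast
      ring
    have e2 : normalizedMgf x s - H (Complex.exp s - 1)
          * Complex.exp (L * (Complex.exp s - 1 - s - s ^ 2 / 2))
        = ((∑ n ∈ Finset.Icc 1 ⌊x⌋₊,
            (1 + (Complex.exp s - 1)) ^ ArithmeticFunction.cardDistinctFactors n)
              / (⌊x⌋₊ : ℂ) - H (Complex.exp s - 1)
                * Complex.exp ((Complex.exp s - 1) * (L : ℂ)))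
          * Complex.exp (-(s * L) - L * s ^ 2 / 2) := by
      have e3 : Complex.exp (L * (Complex.exp s - 1 - s - s ^ 2 / 2))
          = Complex.exp ((Complex.exp s - 1) * (L : ℂ))
            * Complex.exp (-(s * L) - L * s ^ 2 / 2) := by
        rw [← Complex.exp_add]
        congr 1
        ring
      have e4 : Complex.exp (-(s * L) - L * s ^ 2 / 2)
          = Complex.exp (-(s * L)) * Complex.exp (-(L * s ^ 2 / 2)) := by
        rw [← Complex.exp_add, sub_eq_add_neg]
      rw [normalizedMgf, ← hL, e1, e3, e4]
      ring
    have h5 : ‖Complex.exp (-(s * L) - L * s ^ 2 / 2)‖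
        ≤ Real.exp (L * ‖s‖ + L * ‖s‖ ^ 2) := by
      rw [Complex.norm_exp]
      refine Real.exp_le_exp.mpr ((Complex.re_le_norm _).trans ?_)
      refine (norm_sub_le _ _).trans ?_
      rw [norm_neg, norm_mul, norm_div, norm_mul, norm_pow, Complex.norm_real,
        Real.norm_of_nonneg hL0, Complex.norm_ofNat]
      nlinarith [mul_nonneg hL0 (sq_nonneg ‖s‖)]
    have h6 : v ^ (-(1 / 4) : ℝ) = Real.exp (-(L / 4)) := by
      rw [Real.rpow_def_of_pos hv0, hLv]
      congr 1
      ring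
    rw [e2, norm_mul, add_assoc, Real.exp_add, ← mul_assoc, ← h6]
    gcongr


/-! ### Taylor coefficients and Gaussian moments. -/

/-- The `n`-th Taylor coefficient at `0`. -/
noncomputable def taylorCoeff (n : ℕ) (f : ℂ → ℂ) : ℂ := iteratedDeriv n f 0 / (n ! : ℂ)

theorem taylorCoeff_congr {f g : ℂ → ℂ} (h : ∀ s, f s = g s) (n : ℕ) :
    taylorCoeff n f = taylorCoeff n g := by
  rw [funext h]

theorem taylorCoeff_zero (f : ℂ → ℂ) : taylorCoeff 0 f = f 0 := by
  simp [taylorCoeff]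

theorem taylorCoeff_add {f g : ℂ → ℂ} (hf : AnalyticAt ℂ f 0) (hg : AnalyticAt ℂ g 0) (n : ℕ) :
    taylorCoeff n (fun s => f s + g s) = taylorCoeff n f + taylorCoeff n g := by
  simp only [taylorCoeff]
  rw [iteratedDeriv_fun_add hf.contDiffAt hg.contDiffAt, add_div]

theorem taylorCoeff_const_mul (c : ℂ) (f : ℂ → ℂ) (n : ℕ) :
    taylorCoeff n (fun s => c * f s) = c * taylorCoeff n f := by
  simp only [taylorCoeff]
  rw [iteratedDeriv_const_mul_field, mul_div_assoc]

theorem taylorCoeff_comp_neg (f : ℂ → ℂ) (n : ℕ) :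
    taylorCoeff n (fun s => f (-s)) = (-1) ^ n * taylorCoeff n f := by
  simp only [taylorCoeff]
  rw [iteratedDeriv_comp_neg, neg_zero, smul_eq_mul, mul_div_assoc]

theorem taylorCoeff_mul {f g : ℂ → ℂ} (hf : AnalyticAt ℂ f 0) (hg : AnalyticAt ℂ g 0) (n : ℕ) :
    taylorCoeff n (fun s => f s * g s)
      = ∑ i ∈ Finset.range (n + 1), taylorCoeff i f * taylorCoeff (n - i) g := by
  simp only [taylorCoeff]
  rw [iteratedDeriv_fun_mul hf.contDiffAt hg.contDiffAt, Finset.sum_div]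
  refine Finset.sum_congr rfl fun i hi => ?_
  have hin : i ≤ n := Nat.lt_succ_iff.mp (Finset.mem_range.mp hi)
  have h0 : (n ! : ℂ) ≠ 0 := by exact_mod_cast n.factorial_ne_zero
  have h1 : (i ! : ℂ) ≠ 0 := by exact_mod_cast i.factorial_ne_zero
  have h2 : ((n - i)! : ℂ) ≠ 0 := by exact_mod_cast (n - i).factorial_ne_zero
  have h3 : (n.choose i : ℂ) * (i ! : ℂ) * ((n - i)! : ℂ) = (n ! : ℂ) := by
    exact_mod_cast Nat.choose_mul_factorial_mul_factorial hin
  rw [← h3]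
  have h4 : (n.choose i : ℂ) ≠ 0 := by exact_mod_cast (Nat.choose_pos hin).ne'
  field_simp

theorem taylorCoeff_pow (m n : ℕ) :
    taylorCoeff n (fun s => s ^ m) = if n = m then 1 else 0 := by
  simp only [taylorCoeff]
  rw [iteratedDeriv_fun_pow_zero]
  split_ifs with h
  · rw [h, div_self]
    exact_mod_cast m.factorial_ne_zero
  · simp

theorem taylorCoeff_one (n : ℕ) : taylorCoeff n (fun _ => 1) = if n = 0 then 1 else 0 := by
  simpa using taylorCoeff_pow 0 n

theorem taylorCoeff_pow_mul {g : ℂ → ℂ} (hg : AnalyticAt ℂ g 0) (j n : ℕ) :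
    taylorCoeff n (fun s => s ^ j * g s) = if j ≤ n then taylorCoeff (n - j) g else 0 := by
  rw [taylorCoeff_mul (by fun_prop) hg]
  simp_rw [taylorCoeff_pow, ite_mul, one_mul, zero_mul]
  rw [Finset.sum_ite_eq']
  simp only [Finset.mem_range, Nat.lt_succ_iff]

theorem taylorCoeff_exp_mul_const (c : ℂ) (n : ℕ) :
    taylorCoeff n (fun s => Complex.exp (s * c)) = c ^ n / (n ! : ℂ) := by
  simp only [taylorCoeff]
  have : (fun s : ℂ => Complex.exp (s * c)) = fun s => Complex.exp (c * s) := by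
    funext s
    rw [mul_comm]
  rw [this, iteratedDeriv_cexp_const_mul]
  simp

/-- Strong induction on the recurrence read off from `f' = m c s^{m-1} f`. -/
theorem taylorCoeff_exp_mul_pow (c : ℂ) {m : ℕ} (hm : 0 < m) (n : ℕ) :
    taylorCoeff n (fun s => Complex.exp (c * s ^ m))
      = if m ∣ n then c ^ (n / m) / ((n / m)! : ℂ) else 0 := by
  have han : AnalyticAt ℂ (fun s : ℂ => Complex.exp (c * s ^ m)) 0 := by fun_prop
  have hd : deriv (fun s : ℂ => Complex.exp (c * s ^ m))
      = fun s => s ^ (m - 1) * ((m * c) * Complex.exp (c * s ^ m)) := by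
    funext s
    have := (((hasDerivAt_pow m s).const_mul c).cexp).deriv
    rw [this]
    ring
  induction n using Nat.strong_induction_on with
  | _ n ih =>
    rcases n with _ | n
    · simp [taylorCoeff_zero, hm.ne']
    have hrec : taylorCoeff (n + 1) (fun s => Complex.exp (c * s ^ m))
        = (if m - 1 ≤ n then
            (m * c) * taylorCoeff (n - (m - 1)) (fun s => Complex.exp (c * s ^ m)) else 0)
          / ((n : ℂ) + 1) := by
      have h1 : taylorCoeff (n + 1) (fun s => Complex.exp (c * s ^ m))
          = taylorCoeff n (deriv fun s : ℂ => Complex.exp (c * s ^ m)) / ((n : ℂ) + 1) := by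
        simp only [taylorCoeff]
        rw [iteratedDeriv_succ', Nat.factorial_succ, div_div]
        push_cast
        ring
      rw [h1, hd, taylorCoeff_pow_mul (by fun_prop)]
      simp_rw [taylorCoeff_const_mul]
    rw [hrec]
    by_cases hmn : m - 1 ≤ n
    · obtain ⟨l, rfl⟩ := Nat.exists_eq_add_of_le hmn
      rw [if_pos hmn, Nat.add_sub_cancel_left, ih l (by omega)]
      have e : m - 1 + l + 1 = l + m := by omega
      have hcast : ((m - 1 + l : ℕ) : ℂ) + 1 = ((l + m : ℕ) : ℂ) := by
        rw [← e]
        push_cast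
        rfl
      rw [e, hcast]
      simp only [Nat.dvd_add_self_right, Nat.add_div_right l hm]
      split_ifs with hd
      · obtain ⟨q, rfl⟩ := hd
        rw [Nat.mul_div_cancel_left q hm, Nat.factorial_succ, pow_succ]
        have h0 : (q ! : ℂ) ≠ 0 := by exact_mod_cast q.factorial_ne_zero
        have h1 : (m : ℂ) ≠ 0 := by exact_mod_cast hm.ne'
        have h2 : (q : ℂ) + 1 ≠ 0 := by exact_mod_cast q.succ_ne_zero
        have h3 : (m : ℂ) * q + m ≠ 0 := by
          rw [show (m : ℂ) * q + m = m * (q + 1) by ring]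
          exact mul_ne_zero h1 h2
        push_cast
        field_simp
      · simp
    · rw [if_neg hmn, zero_div, if_neg]
      intro hd
      have := Nat.le_of_dvd (by omega) hd
      omega

theorem norm_taylorCoeff_le {f : ℂ → ℂ} {ρ B : ℝ} (hρ : 0 < ρ)
    (hf : DiffContOnCl ℂ f (Metric.ball 0 ρ)) (hB : ∀ s : ℂ, ‖s‖ = ρ → ‖f s‖ ≤ B) (n : ℕ) :
    ‖taylorCoeff n f‖ ≤ B / ρ ^ n := by
  have h := Complex.norm_iteratedDeriv_le_of_forall_mem_sphere_norm_le n hρ hf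
    fun z hz => hB z (by simpa using hz)
  have h0 : (0 : ℝ) < (n ! : ℝ) := by exact_mod_cast n.factorial_pos
  rw [taylorCoeff, norm_div, Complex.norm_natCast, div_le_iff₀ h0]
  exact h.trans_eq (by ring)

/-- The Taylor coefficients of `exp (t² / 2)`, that is `μ_n / n!`. -/
noncomputable def gaussCoeff (n : ℕ) : ℝ := if 2 ∣ n then (1 / 2) ^ (n / 2) / ((n / 2)! : ℝ) else 0

theorem gaussCoeff_nonneg (n : ℕ) : 0 ≤ gaussCoeff n := by
  unfold gaussCoeff
  split_ifs <;> positivity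

theorem gaussCoeff_of_odd {n : ℕ} (hn : ¬ Even n) : gaussCoeff n = 0 :=
  if_neg fun h => hn (even_iff_two_dvd.mpr h)

theorem gaussCoeff_two_mul (m : ℕ) : gaussCoeff (2 * m) = (1 / 2) ^ m / (m ! : ℝ) := by
  simp [gaussCoeff]

theorem gaussCoeff_add_two (n : ℕ) : ((n : ℝ) + 2) * gaussCoeff (n + 2) = gaussCoeff n := by
  unfold gaussCoeff
  simp only [Nat.dvd_add_self_right, Nat.add_div_right n (by norm_num : 0 < 2)]
  split_ifs with h
  · obtain ⟨q, rfl⟩ := h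
    rw [Nat.mul_div_cancel_left q (by norm_num), Nat.factorial_succ]
    have h0 : (q ! : ℝ) ≠ 0 := by exact_mod_cast q.factorial_ne_zero
    push_cast
    field_simp
    ring
  · simp

theorem taylorCoeff_exp_mul_sq_div_two {L : ℝ} (hL : 0 ≤ L) (n : ℕ) :
    taylorCoeff n (fun s => Complex.exp ((L : ℂ) * s ^ 2 / 2))
      = ((√L ^ n * gaussCoeff n : ℝ) : ℂ) := by
  rw [taylorCoeff_congr (g := fun s => Complex.exp ((L / 2 : ℂ) * s ^ 2))
    (fun s => by congr 1; ring), taylorCoeff_exp_mul_pow _ (by norm_num)]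
  unfold gaussCoeff
  split_ifs with h
  · obtain ⟨q, rfl⟩ := h
    rw [Nat.mul_div_cancel_left q (by norm_num), pow_mul, Real.sq_sqrt hL]
    push_cast
    ring
  · simp

/-- The moments are the derivatives at `0` of the complex moment generating function `exp(s²/2)`. -/
theorem gaussMoment_eq (n : ℕ) : gaussMoment n = (n ! : ℝ) * gaussCoeff n := by
  have hset : ProbabilityTheory.integrableExpSet id (ProbabilityTheory.gaussianReal 0 1)
      = Set.univ := by
    simp
  have h := ProbabilityTheory.iteratedDeriv_complexMGF (X := id)
    (μ := ProbabilityTheory.gaussianReal 0 1) (z := 0) (by rw [hset]; simp) n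
  have hmgf : ProbabilityTheory.complexMGF id (ProbabilityTheory.gaussianReal 0 1)
      = fun s : ℂ => Complex.exp (((1 : ℝ) : ℂ) * s ^ 2 / 2) := by
    funext s
    rw [ProbabilityTheory.complexMGF_id_gaussianReal]
    simp
  have h0 : (n ! : ℂ) ≠ 0 := by exact_mod_cast n.factorial_ne_zero
  have h2 := taylorCoeff_exp_mul_sq_div_two zero_le_one n
  rw [taylorCoeff, ← hmgf, h, div_eq_iff h0] at h2
  simp only [id, zero_mul, Complex.exp_zero, mul_one] at h2
  have h3 : ((gaussMoment n : ℝ) : ℂ)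
      = ∫ t : ℝ, (t : ℂ) ^ n ∂(ProbabilityTheory.gaussianReal 0 1) := by
    unfold gaussMoment
    rw [← integral_complex_ofReal]
    push_cast
    rfl
  rw [← h3, Real.sqrt_one, one_pow, one_mul] at h2
  have h4 : ((gaussMoment n : ℝ) : ℂ) = (((n ! : ℝ) * gaussCoeff n : ℝ) : ℂ) := by
    rw [h2]
    push_cast
    ring
  exact_mod_cast h4


/-! ### The weights `momentWeight`. -/

theorem bigM_pos (k : ℕ) : 0 < bigM k := by
  unfold bigM
  have : 0 < Real.Gamma ((k : ℝ) / 2 + 1) := Real.Gamma_pos_of_pos (by positivity)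
  positivity

/-- The ratio `k! (μ_{k-i} / (k-i)!) / (k^{i/2} M_k)`, which is close to `1` when `k - i` is even
and `i` is small compared to `√k`. -/
noncomputable def momentWeight (k i : ℕ) : ℝ :=
  (k ! : ℝ) * gaussCoeff (k - i) / (√(k : ℝ) ^ i * bigM k)

theorem momentWeight_nonneg (k i : ℕ) : 0 ≤ momentWeight k i := by
  have := gaussCoeff_nonneg (k - i)
  have := (bigM_pos k).le
  unfold momentWeight
  positivity

theorem momentWeight_of_odd {k i : ℕ} (h : ¬ Even (k - i)) : momentWeight k i = 0 := by
  rw [momentWeight, gaussCoeff_of_odd h]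
  simp

theorem bigM_eq_of_even (m : ℕ) : bigM (2 * m) = ((2 * m)! : ℝ) * gaussCoeff (2 * m) := by
  rw [gaussCoeff_two_mul, bigM]
  push_cast
  rw [mul_div_cancel_left₀ _ (by norm_num : (2 : ℝ) ≠ 0), Real.Gamma_nat_eq_factorial,
    Real.rpow_natCast, one_div, inv_pow]
  have h0 : (m ! : ℝ) ≠ 0 := by exact_mod_cast m.factorial_ne_zero
  field_simp

theorem momentWeight_zero {k : ℕ} (hk : Even k) : momentWeight k 0 = 1 := by
  obtain ⟨m, rfl⟩ := even_iff_two_dvd.mp hk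
  rw [momentWeight, pow_zero, one_mul, Nat.sub_zero, ← bigM_eq_of_even,
    div_self (bigM_pos _).ne']

/-- Log-convexity of `Γ` at the midpoint of `x` and `x + 1`. -/
theorem Gamma_add_half_sq_le {x : ℝ} (hx : 0 < x) :
    Real.Gamma (x + 1 / 2) ^ 2 ≤ Real.Gamma x * Real.Gamma (x + 1) := by
  have h1 := Real.Gamma_mul_add_mul_le_rpow_Gamma_mul_rpow_Gamma (s := x) (t := x + 1)
    (a := 1 / 2) (b := 1 / 2) hx (by linarith) (by norm_num) (by norm_num) (by norm_num)
  have e : 1 / 2 * x + 1 / 2 * (x + 1) = x + 1 / 2 := by ring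
  have g1 := Real.Gamma_pos_of_pos hx
  have g2 := Real.Gamma_pos_of_pos (by linarith : 0 < x + 1)
  have g3 := Real.Gamma_pos_of_pos (by linarith : 0 < x + 1 / 2)
  rw [e, ← Real.mul_rpow g1.le g2.le, ← Real.sqrt_eq_rpow] at h1
  calc Real.Gamma (x + 1 / 2) ^ 2 ≤ √(Real.Gamma x * Real.Gamma (x + 1)) ^ 2 := by gcongr
    _ = _ := Real.sq_sqrt (by positivity)

/-- With `x = k/2` the weight equals `Γ(x+1)/(Γ(x+1/2) √x)`. Log-convexity at `x` gives the lower
bound, at `x + 1/2` the upper one. -/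
theorem momentWeight_one {k : ℕ} (hk : Odd k) :
    1 ≤ momentWeight k 1 ∧ momentWeight k 1 ≤ 1 + 1 / (k : ℝ) := by
  obtain ⟨m, rfl⟩ := hk
  set x : ℝ := (m : ℝ) + 1 / 2 with hx
  have hx0 : 0 < x := by positivity
  have hkx : ((2 * m + 1 : ℕ) : ℝ) = 2 * x := by
    rw [hx]
    push_cast
    ring
  have g1 := Real.Gamma_pos_of_pos hx0
  have g2 := Real.Gamma_pos_of_pos (by linarith : 0 < x + 1)
  have g3 := Real.Gamma_pos_of_pos (by linarith : 0 < x + 1 / 2)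
  have hW : momentWeight (2 * m + 1) 1
      = Real.Gamma (x + 1) / (Real.Gamma (x + 1 / 2) * √x) := by
    have hG : (m ! : ℝ) = Real.Gamma (x + 1 / 2) := by
      rw [← Real.Gamma_nat_eq_factorial, hx]
      congr 1
      ring
    have h2 : (2 : ℝ) ^ x = 2 ^ m * √2 := by
      rw [hx, Real.rpow_add (by norm_num), Real.rpow_natCast, ← Real.sqrt_eq_rpow]
    rw [momentWeight, Nat.add_sub_cancel, gaussCoeff_two_mul, bigM, hkx, pow_one,
      mul_div_cancel_left₀ _ (by norm_num : (2 : ℝ) ≠ 0), h2, hG, one_div, inv_pow,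
      Real.sqrt_mul (by norm_num)]
    have h0 : ((2 * m + 1)! : ℝ) ≠ 0 := by exact_mod_cast (2 * m + 1).factorial_ne_zero
    have hs : √x ≠ 0 := (Real.sqrt_pos.mpr hx0).ne'
    have hs2 : √(2 : ℝ) ≠ 0 := (Real.sqrt_pos.mpr (by norm_num)).ne'
    field_simp
  have hs : 0 < √x := Real.sqrt_pos.mpr hx0
  have hsq : √x ^ 2 = x := Real.sq_sqrt hx0.le
  have e1 := Gamma_add_half_sq_le hx0
  have e2 := Gamma_add_half_sq_le (by linarith : 0 < x + 1 / 2)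
  have r1 : Real.Gamma (x + 1) = x * Real.Gamma x := Real.Gamma_add_one hx0.ne'
  have r2 : Real.Gamma (x + 1 / 2 + 1) = (x + 1 / 2) * Real.Gamma (x + 1 / 2) :=
    Real.Gamma_add_one (by linarith)
  have r3 : x + 1 / 2 + 1 / 2 = x + 1 := by ring
  rw [r2, r3] at e2
  rw [hW, hkx]
  constructor
  · rw [le_div_iff₀ (by positivity), one_mul]
    refine le_of_sq_le_sq ?_ g2.le
    rw [mul_pow, hsq]
    calc Real.Gamma (x + 1 / 2) ^ 2 * x ≤ Real.Gamma x * Real.Gamma (x + 1) * x := by gcongr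
      _ = _ := by rw [r1]; ring
  · rw [div_le_iff₀ (by positivity)]
    refine le_of_sq_le_sq ?_ (by positivity)
    rw [mul_pow, mul_pow, hsq]
    have h3 : (1 + 1 / (2 * x)) ^ 2 * x ≥ x + 1 / 2 := by
      have : (1 + 1 / (2 * x)) ^ 2 * x = x + 1 + 1 / (4 * x) := by
        field_simp
        ring
      rw [this]
      have : 0 < 1 / (4 * x) := by positivity
      linarith
    nlinarith [mul_le_mul_of_nonneg_right h3 (sq_nonneg (Real.Gamma (x + 1 / 2)))]

theorem momentWeight_add_two {k i : ℕ} (hik : i + 2 ≤ k) :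
    momentWeight k (i + 2) = momentWeight k i * (1 - i / k) := by
  have hk : (0 : ℝ) < k := by exact_mod_cast (by omega : 0 < k)
  have h := gaussCoeff_add_two (k - (i + 2))
  have e : k - (i + 2) + 2 = k - i := by omega
  have ec : ((k - (i + 2) : ℕ) : ℝ) + 2 = k - i := by
    rw [Nat.cast_sub hik]
    push_cast
    ring
  rw [e, ec] at h
  have hsk : √(k : ℝ) ^ (i + 2) = √(k : ℝ) ^ i * k := by rw [pow_add, Real.sq_sqrt hk.le]
  have h0 := (bigM_pos k).ne'
  have h1 : √(k : ℝ) ^ i ≠ 0 := pow_ne_zero _ (Real.sqrt_pos.mpr hk).ne'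
  rw [momentWeight, momentWeight, ← h, hsk]
  field_simp

/-- Induction in steps of two from `i = 0` (even `k`) or `i = 1` (odd `k`). The factor `1 - i/k`
costs at most `2i/k`, as weights are at most `2`, and `(i+2)²/k` exceeds `i²/k` by more than that.
-/
theorem momentWeight_bounds {k : ℕ} (hk : 1 ≤ k) (i : ℕ) (hik : i ≤ k) (hp : Even (k - i)) :
    1 - (i : ℝ) ^ 2 / k ≤ momentWeight k i ∧ momentWeight k i ≤ 1 + 1 / k ∧
      momentWeight k i ≤ 1 + (i : ℝ) ^ 2 / k := by
  have hk0 : (0 : ℝ) < k := by exact_mod_cast hk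
  induction i using Nat.strong_induction_on with
  | _ i ih =>
    match i with
    | 0 =>
      rw [momentWeight_zero (by simpa using hp)]
      have : (0 : ℝ) < 1 / k := by positivity
      simp
    | 1 =>
      have := momentWeight_one (k := k) (by
        rcases Nat.even_or_odd k with h | h
        · exact absurd hp (Nat.not_even_iff_odd.mpr (Nat.Even.sub_odd hk h odd_one))
        · exact h)
      have h1 : (0 : ℝ) < 1 / k := by positivity
      simp only [Nat.cast_one, one_pow]
      exact ⟨by linarith, this.2, this.2⟩
    | i + 2 =>
      have hp' : Even (k - i) := by
        have e : k - i = k - (i + 2) + 2 := by omega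
        rw [e]
        exact hp.add even_two
      obtain ⟨h1, h2, h3⟩ := ih i (by omega) (by omega) hp'
      have hW0 := momentWeight_nonneg k i
      have hi0 : (0 : ℝ) ≤ i / k := by positivity
      have hi1 : (i : ℝ) / k ≤ 1 := by
        rw [div_le_one hk0]
        exact_mod_cast (by omega : i ≤ k)
      have hk1 : 1 / (k : ℝ) ≤ 1 := by
        rw [div_le_one hk0]
        exact_mod_cast hk
      have hdec : momentWeight k i * (1 - i / k) ≤ momentWeight k i :=
        mul_le_of_le_one_right hW0 (by linarith)
      have hsq : ((i + 2 : ℕ) : ℝ) ^ 2 / k = (i : ℝ) ^ 2 / k + 4 * (i / k) + 4 / k := by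
        push_cast
        field_simp
        ring
      have h4 : (0 : ℝ) ≤ 4 / k := by positivity
      rw [momentWeight_add_two hik, hsq]
      refine ⟨?_, by linarith, by linarith⟩
      have : momentWeight k i * (i / k) ≤ 2 * (i / k) :=
        mul_le_mul_of_nonneg_right (by linarith) hi0
      linarith

theorem momentWeight_le_two {k : ℕ} (hk : 1 ≤ k) {i : ℕ} (hik : i ≤ k) :
    momentWeight k i ≤ 2 := by
  by_cases hp : Even (k - i)
  · have h := (momentWeight_bounds hk i hik hp).2.1
    have : 1 / (k : ℝ) ≤ 1 := by
      rw [div_le_one (by exact_mod_cast hk)]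
      exact_mod_cast hk
    linarith
  · rw [momentWeight_of_odd hp]
    norm_num

/-! ### The Gaussian functional and its bounds. -/

/-- `k! L^{-k/2}` times the `k`-th Taylor coefficient of `exp (L s² / 2) R(s)`. -/
noncomputable def gaussFunctional (k : ℕ) (L : ℝ) (R : ℂ → ℂ) : ℂ :=
  ∑ i ∈ Finset.range (k + 1),
    taylorCoeff i R * (((k ! : ℝ) * gaussCoeff (k - i) / √L ^ i : ℝ) : ℂ)

theorem gaussFunctional_eq_momentWeight {k : ℕ} (hk : 1 ≤ k) (L : ℝ) (R : ℂ → ℂ) :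
    gaussFunctional k L R = bigM k * ∑ i ∈ Finset.range (k + 1),
      taylorCoeff i R * (((√(k : ℝ) / √L) ^ i * momentWeight k i : ℝ) : ℂ) := by
  rw [gaussFunctional, Finset.mul_sum]
  refine Finset.sum_congr rfl fun i _ => ?_
  have hk0 : (0 : ℝ) < k := by exact_mod_cast hk
  have h1 : √(k : ℝ) ^ i ≠ 0 := pow_ne_zero _ (Real.sqrt_pos.mpr hk0).ne'
  have h0 := (bigM_pos k).ne'
  have e : (k ! : ℝ) * gaussCoeff (k - i) / √L ^ i
      = bigM k * ((√(k : ℝ) / √L) ^ i * momentWeight k i) := by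
    rw [momentWeight, div_pow]
    field_simp
  rw [e]
  push_cast
  ring

theorem gaussFunctional_add {R S : ℂ → ℂ} (hR : AnalyticAt ℂ R 0) (hS : AnalyticAt ℂ S 0)
    (k : ℕ) (L : ℝ) :
    gaussFunctional k L (fun s => R s + S s) = gaussFunctional k L R + gaussFunctional k L S := by
  simp_rw [gaussFunctional, taylorCoeff_add hR hS, add_mul, Finset.sum_add_distrib]

theorem gaussFunctional_const_mul (c : ℂ) (R : ℂ → ℂ) (k : ℕ) (L : ℝ) :
    gaussFunctional k L (fun s => c * R s) = c * gaussFunctional k L R := by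
  simp_rw [gaussFunctional, taylorCoeff_const_mul, Finset.mul_sum, mul_assoc]

/-- Only the coefficients with `i ≡ k` modulo `2` enter the functional. -/
theorem gaussFunctional_comp_neg (R : ℂ → ℂ) (k : ℕ) (L : ℝ) :
    gaussFunctional k L (fun s => R (-s)) = (-1) ^ k * gaussFunctional k L R := by
  rw [gaussFunctional, gaussFunctional, Finset.mul_sum]
  refine Finset.sum_congr rfl fun i hi => ?_
  have hik : i ≤ k := Nat.lt_succ_iff.mp (Finset.mem_range.mp hi)
  rw [taylorCoeff_comp_neg]
  by_cases hp : Even (k - i)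
  · have : (-1 : ℂ) ^ i = (-1) ^ k := by
      conv_rhs => rw [← Nat.sub_add_cancel hik, pow_add, hp.neg_one_pow, one_mul]
    rw [this, mul_assoc]
  · rw [gaussCoeff_of_odd hp]
    simp

theorem gaussFunctional_pow {j k : ℕ} (hjk : j ≤ k) (L : ℝ) :
    gaussFunctional k L (fun s => s ^ j)
      = (((k ! : ℝ) * gaussCoeff (k - j) / √L ^ j : ℝ) : ℂ) := by
  rw [gaussFunctional, Finset.sum_eq_single j]
  · rw [taylorCoeff_pow, if_pos rfl, one_mul]
  · intro i _ hi
    rw [taylorCoeff_pow, if_neg hi, zero_mul]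
  · intro h
    exact absurd (Finset.mem_range.mpr (Nat.lt_succ_of_le hjk)) h

theorem gaussFunctional_pow_of_lt {j k : ℕ} (hjk : k < j) (L : ℝ) :
    gaussFunctional k L (fun s => s ^ j) = 0 := by
  rw [gaussFunctional]
  refine Finset.sum_eq_zero fun i hi => ?_
  rw [Finset.mem_range] at hi
  rw [taylorCoeff_pow, if_neg (by omega), zero_mul]

/-- Cauchy's estimate on `|s| = 2r` bounds the coefficients of `R`, weighted by `r^b`, by a
geometric series of sum `2B`; the weights contribute another `2`. The factor `P` is measured by its
absolute coefficient sum at radius `r`: for `P = exp(L s³/6)` this is at most `e^y`, while a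
supremum on `|s| = 2r` would give `e^{8y}` and swamp the main term. -/
theorem norm_gaussFunctional_mul_le {k : ℕ} (hk : 1 ≤ k) {L : ℝ} (hL : 0 < L) {P R : ℂ → ℂ}
    (hP : AnalyticAt ℂ P 0)
    (hR : DiffContOnCl ℂ R (Metric.ball 0 (2 * (√(k : ℝ) / √L)))) {B E : ℝ}
    (hB : ∀ s : ℂ, ‖s‖ = 2 * (√(k : ℝ) / √L) → ‖R s‖ ≤ B)
    (hE : ∑ a ∈ Finset.range (k + 1), ‖taylorCoeff a P‖ * (√(k : ℝ) / √L) ^ a ≤ E) :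
    ‖gaussFunctional k L (fun s => P s * R s)‖ ≤ 4 * bigM k * (E * B) := by
  set r : ℝ := √(k : ℝ) / √L with hr
  have hr0 : 0 < r := div_pos (Real.sqrt_pos.mpr (by exact_mod_cast hk)) (Real.sqrt_pos.mpr hL)
  have hB0 : 0 ≤ B := by
    refine (norm_nonneg _).trans (hB ((2 * r : ℝ) : ℂ) ?_)
    rw [Complex.norm_real, Real.norm_of_nonneg (by positivity)]
  have hRan : AnalyticAt ℂ R 0 :=
    hR.differentiableOn.analyticAt (Metric.isOpen_ball.mem_nhds (by simpa using hr0))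
  have hcoef : ∀ b, ‖taylorCoeff b R‖ * r ^ b ≤ B * (1 / 2) ^ b := by
    intro b
    have h := norm_taylorCoeff_le (by positivity : 0 < 2 * r) hR hB b
    calc ‖taylorCoeff b R‖ * r ^ b ≤ B / (2 * r) ^ b * r ^ b := by gcongr
      _ = B * (1 / 2) ^ b := by
        rw [mul_pow, one_div, inv_pow]
        field_simp
  have hgeom : ∑ b ∈ Finset.range (k + 1), ‖taylorCoeff b R‖ * r ^ b ≤ 2 * B := by
    refine (Finset.sum_le_sum fun b _ => hcoef b).trans ?_
    rw [← Finset.mul_sum, mul_comm]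
    gcongr
    have := sum_geometric_two_le (k + 1)
    simpa using this
  have hE0 : 0 ≤ E := le_trans (Finset.sum_nonneg fun a _ => by positivity) hE
  rw [gaussFunctional_eq_momentWeight hk, norm_mul, Complex.norm_real,
    Real.norm_of_nonneg (bigM_pos k).le, ← hr]
  have hsum : ‖∑ i ∈ Finset.range (k + 1), taylorCoeff i (fun s => P s * R s) *
      ((r ^ i * momentWeight k i : ℝ) : ℂ)‖ ≤ 2 * (E * (2 * B)) := by
    calc _ ≤ ∑ i ∈ Finset.range (k + 1), 2 * ∑ a ∈ Finset.range (i + 1),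
          (‖taylorCoeff a P‖ * r ^ a) * (‖taylorCoeff (i - a) R‖ * r ^ (i - a)) := by
          refine (norm_sum_le _ _).trans (Finset.sum_le_sum fun i hi => ?_)
          have hik : i ≤ k := Nat.lt_succ_iff.mp (Finset.mem_range.mp hi)
          rw [norm_mul, taylorCoeff_mul hP hRan, Complex.norm_real,
            Real.norm_of_nonneg (mul_nonneg (by positivity) (momentWeight_nonneg k i))]
          calc _ ≤ (∑ a ∈ Finset.range (i + 1), ‖taylorCoeff a P‖ * ‖taylorCoeff (i - a) R‖)
                * (r ^ i * 2) := by
                refine mul_le_mul ((norm_sum_le _ _).trans_eq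
                  (Finset.sum_congr rfl fun a _ => norm_mul _ _)) ?_ ?_ ?_
                · gcongr
                  exact momentWeight_le_two hk hik
                · exact mul_nonneg (by positivity) (momentWeight_nonneg k i)
                · exact Finset.sum_nonneg fun a _ => by positivity
            _ = _ := by
                rw [Finset.mul_sum, Finset.sum_mul]
                refine Finset.sum_congr rfl fun a ha => ?_
                have hai : a ≤ i := Nat.lt_succ_iff.mp (Finset.mem_range.mp ha)
                have : r ^ i = r ^ a * r ^ (i - a) := by
                  rw [← pow_add, Nat.add_sub_cancel' hai]
                rw [this]
                ring
      -- The triangle `a ≤ i ≤ k` is reindexed by `b = i - a`.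
      _ = 2 * ∑ a ∈ Finset.range (k + 1), ∑ b ∈ Finset.range (k + 1 - a),
          (‖taylorCoeff a P‖ * r ^ a) * (‖taylorCoeff b R‖ * r ^ b) := by
          rw [← Finset.mul_sum]
          congr 1
          exact (Finset.sum_sigma' _ _ _).trans ((Finset.sum_nbij'
            (fun x => ⟨x.2, x.1 - x.2⟩) (fun x => ⟨x.1 + x.2, x.1⟩)
            (by rintro ⟨i, a⟩ h; simp at h ⊢; omega) (by rintro ⟨i, a⟩ h; simp at h ⊢; omega)
            (by rintro ⟨i, a⟩ h; simp at h ⊢; omega) (by rintro ⟨i, a⟩ h; simp at h ⊢)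
            (by rintro ⟨i, a⟩ h; simp)).trans (Finset.sum_sigma' _ _ _).symm)
      _ ≤ 2 * ∑ a ∈ Finset.range (k + 1), (‖taylorCoeff a P‖ * r ^ a) * (2 * B) := by
          gcongr with a ha
          rw [← Finset.mul_sum]
          refine mul_le_mul_of_nonneg_left (le_trans ?_ hgeom) (by positivity)
          exact Finset.sum_le_sum_of_subset_of_nonneg
            (Finset.range_mono (Nat.sub_le _ _)) fun b _ _ => by positivity
      _ ≤ 2 * (E * (2 * B)) := by
          rw [← Finset.sum_mul]
          gcongr
  calc bigM k * _ ≤ bigM k * (2 * (E * (2 * B))) :=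
        mul_le_mul_of_nonneg_left hsum (bigM_pos k).le
    _ = _ := by ring

theorem norm_gaussFunctional_le {k : ℕ} (hk : 1 ≤ k) {L : ℝ} (hL : 0 < L) {R : ℂ → ℂ}
    (hR : DiffContOnCl ℂ R (Metric.ball 0 (2 * (√(k : ℝ) / √L)))) {B : ℝ}
    (hB : ∀ s : ℂ, ‖s‖ = 2 * (√(k : ℝ) / √L) → ‖R s‖ ≤ B) :
    ‖gaussFunctional k L R‖ ≤ 4 * bigM k * B := by
  have h := norm_gaussFunctional_mul_le hk hL (P := fun _ => 1) (E := 1) analyticAt_const hR hB ?_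
  · simpa using h
  · rw [Finset.sum_eq_single 0]
    · simp [taylorCoeff_one]
    · intro a _ ha
      simp [taylorCoeff_one, ha]
    · simp

theorem differentiable_normalizedMgf (x : ℝ) : Differentiable ℂ (normalizedMgf x) := by
  unfold normalizedMgf
  fun_prop

/-- The moments of `ω` as a functional of the normalized moment generating function. -/
theorem omegaMoment_eq_gaussFunctional {x : ℝ} (hL : 0 < logLog x) (k : ℕ) :
    (omegaMoment x k : ℂ) = gaussFunctional k (logLog x) (normalizedMgf x) := by
  set L := logLog x with hLdef
  set c : ℕ → ℝ := fun n => (ArithmeticFunction.cardDistinctFactors n : ℝ) - L with hc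
  set N := ⌊x⌋₊ with hN
  have hsL : √L ≠ 0 := (Real.sqrt_pos.mpr hL).ne'
  have hk0 : (k ! : ℂ) ≠ 0 := by exact_mod_cast k.factorial_ne_zero
  have hterm : ∀ n, AnalyticAt ℂ (fun s : ℂ => Complex.exp (s * (c n : ℂ))) 0 := fun n => by
    fun_prop
  have h1 : taylorCoeff k (fun s => (N : ℂ)⁻¹ * ∑ n ∈ Finset.Icc 1 N, Complex.exp (s * (c n : ℂ)))
      = (N : ℂ)⁻¹ * ∑ n ∈ Finset.Icc 1 N, (c n : ℂ) ^ k / (k ! : ℂ) := by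
    rw [taylorCoeff_const_mul]
    congr 1
    simp_rw [← taylorCoeff_exp_mul_const]
    simp only [taylorCoeff]
    rw [iteratedDeriv_fun_sum fun n _ => (hterm n).contDiffAt, Finset.sum_div]
  -- Multiplying by `exp(L s²/2)` undoes the normalization, so the moments are the Taylor
  -- coefficients of this product.
  have h2 : ∀ s, (N : ℂ)⁻¹ * ∑ n ∈ Finset.Icc 1 N, Complex.exp (s * (c n : ℂ))
      = normalizedMgf x s * Complex.exp ((L : ℂ) * s ^ 2 / 2) := by
    intro s
    rw [normalizedMgf, mul_assoc, ← Complex.exp_add, neg_add_cancel, Complex.exp_zero, mul_one,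
      div_eq_inv_mul]
  rw [taylorCoeff_congr h2, taylorCoeff_mul ((differentiable_normalizedMgf x).analyticAt 0)
    (by fun_prop)] at h1
  simp_rw [taylorCoeff_exp_mul_sq_div_two hL.le] at h1
  have h3 : (omegaMoment x k : ℂ) = (k ! : ℂ) / (√L : ℂ) ^ k *
      ((N : ℂ)⁻¹ * ∑ n ∈ Finset.Icc 1 N, (c n : ℂ) ^ k / (k ! : ℂ)) := by
    unfold omegaMoment uniformMean
    rw [← Finset.sum_div]
    push_cast
    simp_rw [div_pow]
    rw [← Finset.sum_div]
    simp only [hc]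
    push_cast
    rw [← hLdef, ← hN]
    have : (√L : ℂ) ≠ 0 := by exact_mod_cast hsL
    field_simp
  rw [h3, ← h1, gaussFunctional, Finset.mul_sum]
  refine Finset.sum_congr rfl fun i hi => ?_
  have hik : i ≤ k := Nat.lt_succ_iff.mp (Finset.mem_range.mp hi)
  have hsLc : (√L : ℂ) ≠ 0 := by exact_mod_cast hsL
  have hpow : (√L : ℂ) ^ k = (√L : ℂ) ^ i * (√L : ℂ) ^ (k - i) := by
    rw [← pow_add, Nat.add_sub_cancel' hik]
  rw [hpow]
  push_cast
  field_simp


/-! ### The contribution of `exp(L s³/6)`. -/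

theorem sum_range_ite_three_dvd {M : Type*} [AddCommMonoid M] (g : ℕ → M) (k : ℕ) :
    ∑ a ∈ Finset.range (k + 1), (if 3 ∣ a then g a else 0)
      = ∑ n ∈ Finset.range (k / 3 + 1), g (3 * n) := by
  rw [← Finset.sum_filter]
  refine Finset.sum_nbij' (fun a => a / 3) (fun n => 3 * n) ?_ ?_ ?_ ?_ ?_
  · intro a ha
    simp only [Finset.mem_filter, Finset.mem_range] at ha ⊢
    omega
  · intro n hn
    simp only [Finset.mem_filter, Finset.mem_range] at hn ⊢
    omega
  · intro a ha
    simp only [Finset.mem_filter, Finset.mem_range] at ha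
    omega
  · intro n _
    simp
  · intro a ha
    simp only [Finset.mem_filter, Finset.mem_range] at ha
    rw [Nat.mul_div_cancel' ha.2]

theorem hasSum_pow_div_factorial (y : ℝ) : HasSum (fun n : ℕ => y ^ n / (n ! : ℝ)) (Real.exp y) := by
  rw [Real.exp_eq_exp_ℝ]
  exact NormedSpace.expSeries_div_hasSum_exp y

theorem hasSum_mul_pow_div_factorial (y : ℝ) :
    HasSum (fun n : ℕ => (n : ℝ) * (y ^ n / (n ! : ℝ))) (y * Real.exp y) := by
  rw [← hasSum_nat_add_iff' 1]
  convert! (hasSum_pow_div_factorial y).mul_left y using 1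
  · funext n
    have h0 : (n ! : ℝ) ≠ 0 := by exact_mod_cast n.factorial_ne_zero
    rw [Nat.factorial_succ, pow_succ]
    push_cast
    field_simp
  · simp

theorem hasSum_sq_mul_pow_div_factorial (y : ℝ) :
    HasSum (fun n : ℕ => (n : ℝ) ^ 2 * (y ^ n / (n ! : ℝ))) ((y ^ 2 + y) * Real.exp y) := by
  rw [← hasSum_nat_add_iff' 1]
  convert! ((hasSum_mul_pow_div_factorial y).add (hasSum_pow_div_factorial y)).mul_left y using 1
  · funext n
    have h0 : (n ! : ℝ) ≠ 0 := by exact_mod_cast n.factorial_ne_zero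
    rw [Nat.factorial_succ, pow_succ]
    push_cast
    field_simp
    ring
  · simp
    ring

theorem hasSum_parity_pow_div_factorial (y : ℝ) (k : ℕ) :
    HasSum (fun n : ℕ => y ^ n / (n ! : ℝ) * ((1 + (-1) ^ (k + n)) / 2))
      ((Real.exp y + (-1) ^ k * Real.exp (-y)) / 2) := by
  convert! ((hasSum_pow_div_factorial y).add
    ((hasSum_pow_div_factorial (-y)).mul_left ((-1) ^ k))).div_const 2 using 1
  funext n
  rw [neg_pow y, pow_add]
  ring

/-- The weighted exponential series is close to `(e^y + (-1)^k e^{-y}) / 2`. -/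
theorem abs_sum_momentWeight_sub_le {k : ℕ} (hk : 1 ≤ k) {y : ℝ} (hy : 0 ≤ y) :
    |∑ n ∈ Finset.range (k / 3 + 1), y ^ n / (n ! : ℝ) * momentWeight k (3 * n)
        - (Real.exp y + (-1) ^ k * Real.exp (-y)) / 2|
      ≤ 9 / k * ((y ^ 2 + y) * Real.exp y) := by
  have hk0 : (0 : ℝ) < k := by exact_mod_cast hk
  have hk1 : (1 : ℝ) ≤ k := by exact_mod_cast hk
  set W : ℕ → ℝ := fun n => if n ∈ Finset.range (k / 3 + 1) then momentWeight k (3 * n) else 0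
    with hW
  have h1 : HasSum (fun n => y ^ n / (n ! : ℝ) * W n)
      (∑ n ∈ Finset.range (k / 3 + 1), y ^ n / (n ! : ℝ) * momentWeight k (3 * n)) := by
    have e : ∑ n ∈ Finset.range (k / 3 + 1), y ^ n / (n ! : ℝ) * momentWeight k (3 * n)
        = ∑ n ∈ Finset.range (k / 3 + 1), y ^ n / (n ! : ℝ) * W n :=
      Finset.sum_congr rfl fun n hn => by rw [hW]; simp only [if_pos hn]
    rw [e]
    refine hasSum_sum_of_ne_finset_zero fun n hn => ?_
    rw [hW]
    simp only [if_neg hn, mul_zero]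
  -- The truncated weight is compared with the indicator of `k + n` even, equivalently of `k - 3n`
  -- even. Past the truncation `3n ≥ k`, so the right side is at least `1` and the bound is trivial.
  have hdiff : ∀ n, |W n - (1 + (-1) ^ (k + n)) / 2| ≤ 9 / k * (n : ℝ) ^ 2 := by
    intro n
    have e9 : 9 / (k : ℝ) * (n : ℝ) ^ 2 = ((3 * n : ℕ) : ℝ) ^ 2 / k := by
      push_cast
      ring
    have hnn : 0 ≤ ((3 * n : ℕ) : ℝ) ^ 2 / k := by positivity
    rw [e9, hW]
    simp only [Finset.mem_range]
    split_ifs with h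
    · have hle : 3 * n ≤ k := by omega
      by_cases hp : Even (k - 3 * n)
      · have hpn : Even (k + n) := by
          have : k + n = (k - 3 * n) + 2 * (2 * n) := by omega
          rw [this]
          exact hp.add (even_two_mul _)
        obtain ⟨b1, _, b3⟩ := momentWeight_bounds hk (3 * n) hle hp
        rw [hpn.neg_one_pow, abs_le]
        constructor <;> linarith
      · have hpn : Odd (k + n) := by
          rw [← Nat.not_even_iff_odd]
          intro hev
          apply hp
          have : k + n = (k - 3 * n) + 2 * (2 * n) := by omega
          rw [this] at hev
          exact (Nat.even_add.mp hev).mpr (even_two_mul _)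
        rw [momentWeight_of_odd hp, hpn.neg_one_pow]
        simpa using hnn
    · have hlt : (k : ℝ) ≤ ((3 * n : ℕ) : ℝ) := by exact_mod_cast (by omega : k ≤ 3 * n)
      have h2 : 1 ≤ ((3 * n : ℕ) : ℝ) ^ 2 / k := by
        rw [le_div_iff₀ hk0]
        nlinarith
      refine le_trans ?_ h2
      rcases neg_one_pow_eq_or ℝ (k + n) with h | h <;> rw [h] <;> norm_num
  have h2 := (h1.sub (hasSum_parity_pow_div_factorial y k))
  have h3 := (hasSum_sq_mul_pow_div_factorial y).mul_left (9 / (k : ℝ))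
  have hb : ∀ n, ‖y ^ n / (n ! : ℝ) * W n - y ^ n / (n ! : ℝ) * ((1 + (-1) ^ (k + n)) / 2)‖
      ≤ 9 / (k : ℝ) * ((n : ℝ) ^ 2 * (y ^ n / (n ! : ℝ))) := by
    intro n
    have h0 : 0 ≤ y ^ n / (n ! : ℝ) := by positivity
    rw [← mul_sub, norm_mul, Real.norm_of_nonneg h0, Real.norm_eq_abs]
    calc _ ≤ y ^ n / (n ! : ℝ) * (9 / k * (n : ℝ) ^ 2) := mul_le_mul_of_nonneg_left (hdiff n) h0
      _ = _ := by ring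
  rw [← Real.norm_eq_abs, ← h2.tsum_eq, ← h3.tsum_eq]
  exact tsum_of_norm_bounded h3.summable.hasSum hb

theorem taylorCoeff_exp_cubic (L : ℝ) (a : ℕ) :
    taylorCoeff a (fun s => Complex.exp ((L : ℂ) * s ^ 3 / 6))
      = if 3 ∣ a then (((L / 6) ^ (a / 3) / ((a / 3)! : ℝ) : ℝ) : ℂ) else 0 := by
  rw [taylorCoeff_congr (g := fun s => Complex.exp ((L / 6 : ℂ) * s ^ 3))
    (fun s => by congr 1; ring), taylorCoeff_exp_mul_pow _ (by norm_num)]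
  split_ifs <;> simp

theorem cubic_term_eq (L r : ℝ) (n : ℕ) :
    (L / 6) ^ (3 * n / 3) / ((3 * n / 3)! : ℝ) * r ^ (3 * n)
      = (L * r ^ 3 / 6) ^ n / (n ! : ℝ) := by
  rw [Nat.mul_div_cancel_left n (by norm_num), pow_mul, mul_div_right_comm L (r ^ 3) 6, mul_pow]
  ring

/-- The coefficients are nonnegative, so the absolute sum is a partial sum of the value at `s = r`.
-/
theorem sum_norm_taylorCoeff_exp_cubic_le {L r : ℝ} (hL : 0 ≤ L) (hr : 0 ≤ r) (k : ℕ) :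
    ∑ a ∈ Finset.range (k + 1),
        ‖taylorCoeff a (fun s => Complex.exp ((L : ℂ) * s ^ 3 / 6))‖ * r ^ a
      ≤ Real.exp (L * r ^ 3 / 6) := by
  have e : ∀ a, ‖taylorCoeff a (fun s => Complex.exp ((L : ℂ) * s ^ 3 / 6))‖ * r ^ a
      = if 3 ∣ a then (L / 6) ^ (a / 3) / ((a / 3)! : ℝ) * r ^ a else 0 := by
    intro a
    rw [taylorCoeff_exp_cubic]
    split_ifs
    · rw [Complex.norm_real, Real.norm_of_nonneg (by positivity)]
    · simp
  simp_rw [e]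
  rw [sum_range_ite_three_dvd (fun a => (L / 6) ^ (a / 3) / ((a / 3)! : ℝ) * r ^ a)]
  simp_rw [cubic_term_eq]
  exact Real.sum_le_exp_of_nonneg (by positivity) _

theorem gaussFunctional_exp_cubic {k : ℕ} (hk : 1 ≤ k) (L : ℝ) :
    gaussFunctional k L (fun s => Complex.exp ((L : ℂ) * s ^ 3 / 6))
      = ((bigM k * ∑ n ∈ Finset.range (k / 3 + 1),
        (L * (√(k : ℝ) / √L) ^ 3 / 6) ^ n / (n ! : ℝ) * momentWeight k (3 * n) : ℝ) : ℂ) := by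
  rw [gaussFunctional_eq_momentWeight hk, Complex.ofReal_mul]
  congr 1
  simp_rw [← cubic_term_eq]
  rw [← sum_range_ite_three_dvd (fun a => (L / 6) ^ (a / 3) / ((a / 3)! : ℝ)
    * (√(k : ℝ) / √L) ^ a * momentWeight k a), Complex.ofReal_sum]
  refine Finset.sum_congr rfl fun a _ => ?_
  rw [taylorCoeff_exp_cubic]
  split_ifs
  · push_cast
    ring
  · simp

/-- Third order Taylor expansion of an analytic function. -/
theorem AnalyticAt.exists_norm_sub_quadratic_le {Φ : ℂ → ℂ} (h : AnalyticAt ℂ Φ 0) :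
    ∃ (q : ℂ) (C δ : ℝ), 0 < C ∧ 0 < δ ∧ ∀ s : ℂ, ‖s‖ ≤ δ →
      ‖Φ s - (Φ 0 + deriv Φ 0 * s + q * s ^ 2)‖ ≤ C * ‖s‖ ^ 3 := by
  obtain ⟨p, hp⟩ := h
  have hO := hp.isBigO_sub_partialSum_pow 3
  obtain ⟨C, hC0, hC⟩ := hO.exists_pos
  rw [IsBigOWith, Metric.eventually_nhds_iff] at hC
  obtain ⟨ε, hε, hball⟩ := hC
  refine ⟨p.coeff 2, C, ε / 2, hC0, by positivity, fun s hs => ?_⟩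
  have h1 := hball (y := s) (by rw [dist_zero_right]; linarith)
  have e0 : p.coeff 0 = Φ 0 := by
    have := hp.coeff_zero (fun _ => 1)
    exact this
  have e1 : p.coeff 1 = deriv Φ 0 := by
    rw [hp.deriv]
    rfl
  rw [norm_pow, norm_norm] at h1
  convert! h1 using 3
  · simp
  · simp [FormalMultilinearSeries.partialSum, Finset.sum_range_succ, e0, e1]
    ring


/-! ### Local expansion of the generating function, and moments for `k² ≤ log log x`. -/

theorem norm_exp_sub_cubic_le {s : ℂ} (hs : ‖s‖ ≤ 1 / 2) :
    ‖Complex.exp s - 1 - s - s ^ 2 / 2 - s ^ 3 / 6‖ ≤ 2 * ‖s‖ ^ 4 := by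
  have h := Complex.norm_exp_sub_sum_le_norm_mul_exp s 4
  have e : Complex.exp s - ∑ m ∈ Finset.range 4, s ^ m / (m ! : ℂ)
      = Complex.exp s - 1 - s - s ^ 2 / 2 - s ^ 3 / 6 := by
    simp [Finset.sum_range_succ, Nat.factorial]
    ring
  have he : Real.exp ‖s‖ ≤ 2 := by
    have := Real.exp_bound_div_one_sub_of_interval (norm_nonneg s) (by linarith)
    refine this.trans ?_
    rw [div_le_iff₀ (by linarith)]
    linarith
  rw [e] at h
  calc _ ≤ ‖s‖ ^ 4 * Real.exp ‖s‖ := h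
    _ ≤ ‖s‖ ^ 4 * 2 := by gcongr
    _ = _ := by ring

theorem norm_exp_sub_quartic_le {s : ℂ} (hs : ‖s‖ ≤ 1 / 2) :
    ‖Complex.exp s - 1 - s - s ^ 2 / 2 - s ^ 3 / 6 - s ^ 4 / 24‖ ≤ 2 * ‖s‖ ^ 5 := by
  have h := Complex.norm_exp_sub_sum_le_norm_mul_exp s 5
  have e : Complex.exp s - ∑ m ∈ Finset.range 5, s ^ m / (m ! : ℂ)
      = Complex.exp s - 1 - s - s ^ 2 / 2 - s ^ 3 / 6 - s ^ 4 / 24 := by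
    simp [Finset.sum_range_succ, Nat.factorial]
    ring
  have he : Real.exp ‖s‖ ≤ 2 := by
    have := Real.exp_bound_div_one_sub_of_interval (norm_nonneg s) (by linarith)
    refine this.trans ?_
    rw [div_le_iff₀ (by linarith)]
    linarith
  rw [e] at h
  calc _ ≤ ‖s‖ ^ 5 * Real.exp ‖s‖ := h
    _ ≤ ‖s‖ ^ 5 * 2 := by gcongr
    _ = _ := by ring

theorem norm_exp_sub_one_le_mul_exp (z : ℂ) : ‖Complex.exp z - 1‖ ≤ ‖z‖ * Real.exp ‖z‖ := by
  have h := Complex.norm_exp_sub_sum_le_norm_mul_exp z 1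
  simpa using h

theorem two_le_log_of_one_le_logLog {x : ℝ} (hx : 3 ≤ x) (hL : 1 ≤ logLog x) :
    2 ≤ Real.log x := by
  have h0 : 0 < Real.log x := Real.log_pos (by linarith)
  have h1 : Real.exp 1 ≤ Real.log x := (Real.le_log_iff_exp_le h0).mp hL
  have := Real.exp_one_gt_d9
  linarith

/-- The value `v` is `Φ(s)`, known to third order. The bound `|s| ≤ 1/16` makes the error exponent
at most `-L/4 + L/16 + L/16 = -L/8`. -/
theorem exists_normalizedMgf_expansion :
    ∃ (q : ℂ) (K δ : ℝ), 0 < K ∧ 0 < δ ∧ δ ≤ 1 / 16 ∧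
      ∀ x : ℝ, 3 ≤ x → 1 ≤ logLog x → ∀ s : ℂ, ‖s‖ ≤ δ →
        ∃ v : ℂ, ‖v - (1 + meisselMertens * s + q * s ^ 2)‖ ≤ K * ‖s‖ ^ 3 ∧
          ‖normalizedMgf x s - v * Complex.exp (logLog x * (Complex.exp s - 1 - s - s ^ 2 / 2))‖
            ≤ K * Real.exp (-(logLog x / 8)) := by
  obtain ⟨Φ, K, hK0, hdiff, hΦ0, hΦ1, hΦ⟩ := exists_normalizedMgf_asymptotic
  have han : AnalyticAt ℂ Φ 0 := hdiff.analyticAt (Metric.isOpen_ball.mem_nhds (by simp))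
  obtain ⟨q, C, δ, hC0, hδ0, hq⟩ := han.exists_norm_sub_quadratic_le
  refine ⟨q, C + K, min δ (1 / 16), by positivity, by positivity, min_le_right _ _,
    fun x hx hL s hs => ⟨Φ s, ?_, ?_⟩⟩
  · have h := hq s (hs.trans (min_le_left _ _))
    rw [hΦ0, hΦ1] at h
    refine h.trans ?_
    gcongr
    linarith
  · have hs16 : ‖s‖ ≤ 1 / 16 := hs.trans (min_le_right _ _)
    refine (hΦ x (by linarith) (two_le_log_of_one_le_logLog hx hL) s (by linarith)).trans ?_
    have h1 : -(logLog x / 4) + logLog x * ‖s‖ + logLog x * ‖s‖ ^ 2 ≤ -(logLog x / 8) := by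
      have h2 : ‖s‖ ^ 2 ≤ 1 / 16 := by nlinarith [norm_nonneg s]
      nlinarith
    have h3 := Real.exp_le_exp.mpr h1
    have h4 := Real.exp_pos (-(logLog x / 8))
    nlinarith

theorem mul_sqrt_div_sqrt_sq {k : ℕ} {L : ℝ} (hL : 0 < L) :
    L * (√(k : ℝ) / √L) ^ 2 = k := by
  rw [div_pow, Real.sq_sqrt hL.le, Real.sq_sqrt (Nat.cast_nonneg k)]
  field_simp

theorem exp_neg_div_sixteen_le {L : ℝ} (hL : 1 ≤ L) : Real.exp (-(L / 16)) ≤ 16 / √L := by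
  have hs : 0 < √L := Real.sqrt_pos.mpr (by linarith)
  have h1 : √L ≤ L := by
    rw [Real.sqrt_le_left (by linarith)]
    nlinarith
  rw [Real.exp_neg, ← one_div, div_le_div_iff₀ (Real.exp_pos _) hs]
  have := Real.add_one_le_exp (L / 16)
  linarith

set_option maxHeartbeats 1000000 in
/-- Two-sided asymptotics for the moments as soon as `k² ≤ log log x`. -/
theorem exists_abs_omegaMoment_div_bigM_sub_le :
    ∃ (C δ : ℝ), 0 < C ∧ 0 < δ ∧ ∀ x : ℝ, 3 ≤ x → 1 ≤ logLog x → ∀ k : ℕ, 1 ≤ k →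
      √(k : ℝ) / √(logLog x) ≤ δ → (k : ℝ) ^ 2 ≤ logLog x → ∀ y : ℝ,
      y = logLog x * (√(k : ℝ) / √(logLog x)) ^ 3 / 6 →
      |(bigM k)⁻¹ * omegaMoment x k - (Real.exp y + (-1) ^ k * Real.exp (-y)) / 2|
        ≤ C * (Real.exp y * (√(k : ℝ) / √(logLog x) + (k : ℝ) ^ 2 / logLog x)) := by
  obtain ⟨q, K, δ, hK0, hδ0, hδ16, hexp⟩ := exists_normalizedMgf_expansion
  set a : ℂ := (meisselMertens : ℂ) with ha
  set A : ℝ := ‖a‖ + ‖q‖ + K with hA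
  have hA0 : 0 < A := by positivity
  refine ⟨4 * (16 * K + (1 + A) * (32 * Real.exp 32) + 2 * A) + 9, δ / 2, by positivity,
    by positivity, fun x hx hL k hk hr hkL y hy => ?_⟩
  set L := logLog x with hLdef
  set r : ℝ := √(k : ℝ) / √L with hrdef
  have hL0 : 0 < L := by linarith
  have hk0 : (0 : ℝ) < k := by exact_mod_cast hk
  have hk1 : (1 : ℝ) ≤ k := by exact_mod_cast hk
  have hr0 : 0 < r := div_pos (Real.sqrt_pos.mpr hk0) (Real.sqrt_pos.mpr hL0)
  have hLr2 : L * r ^ 2 = k := mul_sqrt_div_sqrt_sq hL0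
  have hLr4 : L * r ^ 4 = (k : ℝ) ^ 2 / L := by
    rw [eq_div_iff hL0.ne', ← hLr2]
    ring
  have hk2L : (k : ℝ) ^ 2 / L ≤ 1 := by rwa [div_le_one hL0]
  have hk2L0 : 0 ≤ (k : ℝ) ^ 2 / L := by positivity
  have hykr : y = k * r / 6 := by
    rw [hy, ← hLr2]
    ring
  have hy0 : 0 ≤ y := by
    rw [hykr]
    positivity
  have hrinv : 1 / √L ≤ r := by
    rw [hrdef]
    gcongr
    exact Real.one_le_sqrt.mpr hk1
  set P : ℂ → ℂ := fun s => Complex.exp ((L : ℂ) * s ^ 3 / 6) with hP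
  -- `F = P + P R` isolates the cubic exponential. On `|s| = 2r` the factor `R` is small for three
  -- reasons: `Φ(s) - 1 = O(r)`, the exponent beyond the cubic term is `O(L r⁴) = O(k²/L)`, and the
  -- remainder is at most `K e^{-L/8} e^{L/16}`, which is `O(1/√L) = O(r)`.
  set R : ℂ → ℂ := fun s => normalizedMgf x s * Complex.exp (-((L : ℂ) * s ^ 3 / 6)) - 1 with hR
  have hRdiff : Differentiable ℂ R :=
    ((differentiable_normalizedMgf x).mul (by fun_prop)).sub_const 1
  have hPan : AnalyticAt ℂ P 0 := by fun_prop
  have hFsplit : ∀ s, normalizedMgf x s = P s + P s * R s := by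
    intro s
    have : P s * Complex.exp (-((L : ℂ) * s ^ 3 / 6)) = 1 := by
      rw [hP, ← Complex.exp_add, add_neg_cancel, Complex.exp_zero]
    calc normalizedMgf x s
        = normalizedMgf x s * (P s * Complex.exp (-((L : ℂ) * s ^ 3 / 6))) := by
          rw [this, mul_one]
      _ = _ := by rw [hR]; ring
  have hRbound : ∀ s : ℂ, ‖s‖ = 2 * r →
      ‖R s‖ ≤ (16 * K + (1 + A) * (32 * Real.exp 32) + 2 * A) * (r + (k : ℝ) ^ 2 / L) := by
    intro s hs
    have hsδ : ‖s‖ ≤ δ := by linarith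
    have hs16 : ‖s‖ ≤ 1 / 16 := hsδ.trans hδ16
    obtain ⟨v, hv, hF⟩ := hexp x hx hL s hsδ
    rw [← hLdef] at hF
    set X : ℂ := L * (Complex.exp s - 1 - s - s ^ 2 / 2) with hX
    set Y : ℂ := L * (Complex.exp s - 1 - s - s ^ 2 / 2 - s ^ 3 / 6) with hY
    have hs0 := norm_nonneg s
    have hv1 : ‖v - 1‖ ≤ A * ‖s‖ := by
      have e : v - 1 = (v - (1 + a * s + q * s ^ 2)) + a * s + q * s ^ 2 := by ring
      rw [e]
      refine (norm_add₃_le).trans ?_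
      rw [norm_mul, norm_mul, norm_pow]
      have h2 : ‖s‖ ^ 2 ≤ ‖s‖ := by nlinarith
      have h3 : ‖s‖ ^ 3 ≤ ‖s‖ := by nlinarith
      have h4 := mul_le_mul_of_nonneg_left h2 (norm_nonneg q)
      have h5 := mul_le_mul_of_nonneg_left h3 hK0.le
      rw [hA]
      linarith
    have hvn : ‖v‖ ≤ 1 + A := by
      have : ‖v‖ ≤ ‖v - 1‖ + ‖(1 : ℂ)‖ := by
        simpa using norm_add_le (v - 1) 1
      rw [norm_one] at this
      nlinarith
    have hYn : ‖Y‖ ≤ 32 * ((k : ℝ) ^ 2 / L) := by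
      rw [hY, norm_mul, Complex.norm_real, Real.norm_of_nonneg hL0.le]
      calc L * _ ≤ L * (2 * ‖s‖ ^ 4) := by
            gcongr
            exact norm_exp_sub_cubic_le (by linarith)
        _ = 32 * (L * r ^ 4) := by rw [hs]; ring
        _ = _ := by rw [hLr4]
    have hYe : ‖Complex.exp Y - 1‖ ≤ 32 * Real.exp 32 * ((k : ℝ) ^ 2 / L) := by
      calc ‖Complex.exp Y - 1‖ ≤ ‖Y‖ * Real.exp ‖Y‖ := norm_exp_sub_one_le_mul_exp Y
        _ ≤ 32 * ((k : ℝ) ^ 2 / L) * Real.exp 32 := by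
            gcongr
            linarith
        _ = _ := by ring
    have hcub : ‖Complex.exp (-((L : ℂ) * s ^ 3 / 6))‖ ≤ Real.exp (L / 16) := by
      rw [Complex.norm_exp]
      refine Real.exp_le_exp.mpr ((Complex.re_le_norm _).trans ?_)
      rw [norm_neg, norm_div, norm_mul, norm_pow, Complex.norm_real, Real.norm_of_nonneg hL0.le,
        Complex.norm_ofNat]
      have : ‖s‖ ^ 3 ≤ 1 / 16 := by
        have : ‖s‖ ^ 3 ≤ (1 / 16) ^ 3 := by gcongr
        linarith
      nlinarith
    have hXY : Complex.exp X * Complex.exp (-((L : ℂ) * s ^ 3 / 6)) = Complex.exp Y := by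
      rw [← Complex.exp_add]
      congr 1
      rw [hX, hY]
      ring
    have e : R s = (normalizedMgf x s - v * Complex.exp X) * Complex.exp (-((L : ℂ) * s ^ 3 / 6))
        + v * (Complex.exp Y - 1) + (v - 1) := by
      rw [hR, ← hXY]
      ring
    rw [e]
    refine (norm_add₃_le).trans ?_
    rw [norm_mul, norm_mul]
    have t1 : ‖normalizedMgf x s - v * Complex.exp X‖ *
        ‖Complex.exp (-((L : ℂ) * s ^ 3 / 6))‖ ≤ 16 * K * r := by
      calc _ ≤ K * Real.exp (-(L / 8)) * Real.exp (L / 16) := by gcongr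
        _ = K * Real.exp (-(L / 16)) := by
            rw [mul_assoc, ← Real.exp_add]
            congr 2
            ring
        _ ≤ K * (16 / √L) := by
            gcongr
            exact exp_neg_div_sixteen_le hL
        _ = 16 * K * (1 / √L) := by ring
        _ ≤ 16 * K * r := by gcongr
    have t2 : ‖v‖ * ‖Complex.exp Y - 1‖
        ≤ (1 + A) * (32 * Real.exp 32) * ((k : ℝ) ^ 2 / L) := by
      rw [mul_assoc]
      gcongr
    have t3 : ‖v - 1‖ ≤ 2 * A * r := by
      rw [hs] at hv1
      linarith
    have u1 : 0 ≤ (16 * K + 2 * A) * ((k : ℝ) ^ 2 / L) := by positivity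
    have u2 : 0 ≤ (1 + A) * (32 * Real.exp 32) * r := by positivity
    linarith
  have hT := norm_gaussFunctional_mul_le hk hL0 hPan hRdiff.diffContOnCl hRbound
    (sum_norm_taylorCoeff_exp_cubic_le hL0.le hr0.le k)
  have hsum : gaussFunctional k L (normalizedMgf x)
      = gaussFunctional k L P + gaussFunctional k L (fun s => P s * R s) := by
    rw [funext hFsplit]
    exact gaussFunctional_add hPan (hPan.mul (hRdiff.analyticAt 0)) k L
  set S : ℝ := ∑ n ∈ Finset.range (k / 3 + 1), y ^ n / (n ! : ℝ) * momentWeight k (3 * n) with hS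
  have hPval : gaussFunctional k L P = ((bigM k * S : ℝ) : ℂ) := by
    rw [hP, gaussFunctional_exp_cubic hk, ← hrdef, ← hy]
  have hM := bigM_pos k
  have hclose : |(bigM k)⁻¹ * omegaMoment x k - S|
      ≤ 4 * (16 * K + (1 + A) * (32 * Real.exp 32) + 2 * A)
        * (Real.exp y * (r + (k : ℝ) ^ 2 / L)) := by
    have e1 : ((omegaMoment x k - bigM k * S : ℝ) : ℂ)
        = gaussFunctional k L (fun s => P s * R s) := by
      rw [Complex.ofReal_sub, omegaMoment_eq_gaussFunctional hL0 k, hsum, hPval,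
        add_sub_cancel_left]
    rw [← e1, Complex.norm_real, Real.norm_eq_abs, ← hy] at hT
    have e2 : (bigM k)⁻¹ * omegaMoment x k - S
        = (bigM k)⁻¹ * (omegaMoment x k - bigM k * S) := by
      field_simp
    rw [e2, abs_mul, abs_of_pos (inv_pos.mpr hM), inv_mul_le_iff₀ hM]
    refine hT.trans_eq ?_
    ring
  have hser := abs_sum_momentWeight_sub_le hk hy0
  -- As `y = kr/6` and `k r² = k²/L`, the error of the weighted series has the same shape as the
  -- analytic one.
  have hser' : 9 / (k : ℝ) * ((y ^ 2 + y) * Real.exp y)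
      ≤ 9 * (Real.exp y * (r + (k : ℝ) ^ 2 / L)) := by
    have e1 : 9 / (k : ℝ) * ((y ^ 2 + y) * Real.exp y)
        = 9 * (Real.exp y * (r / 6 + (k : ℝ) ^ 2 / L / 36)) := by
      have : (k : ℝ) ^ 2 / L = k * r ^ 2 := by
        rw [← hLr4]
        nth_rewrite 1 [← hLr2]
        ring
      rw [this, hykr]
      field_simp
      ring
    rw [e1]
    have h36 : r / 6 + (k : ℝ) ^ 2 / L / 36 ≤ r + (k : ℝ) ^ 2 / L := by linarith
    gcongr
  calc _ ≤ |(bigM k)⁻¹ * omegaMoment x k - S|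
        + |S - (Real.exp y + (-1) ^ k * Real.exp (-y)) / 2| := abs_sub_le _ _ _
    _ ≤ _ := by linarith


/-! ### Second order expansion when `k³ / log log x` is bounded. -/

theorem norm_exp_sub_quadratic_le (z : ℂ) :
    ‖Complex.exp z - (1 + z + z ^ 2 / 2)‖ ≤ ‖z‖ ^ 3 * Real.exp ‖z‖ := by
  have h := Complex.norm_exp_sub_sum_le_norm_mul_exp z 3
  simpa [Finset.sum_range_succ, Nat.factorial] using h

/-- Second order expansion of an exponential whose exponent has leading terms of orders one
and two. -/
theorem exists_norm_exp_sub_expansion_le {B : ℝ} (hB : 0 ≤ B) :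
    ∃ C : ℝ, 0 ≤ C ∧ ∀ (κ : ℝ) (u w X : ℂ), 0 ≤ κ → κ ≤ B → ‖u‖ ≤ 2 * κ → ‖w‖ ≤ κ ^ 2 →
      ‖X - u - w‖ ≤ 64 * κ ^ 3 →
        ‖Complex.exp X‖ ≤ C ∧ ‖Complex.exp X - (1 + u + (w + u ^ 2 / 2))‖ ≤ C * κ ^ 3 := by
  set D : ℝ := 2 + B + 64 * B ^ 2 with hD
  set E : ℝ := Real.exp (D * B) with hE
  have hD0 : 0 ≤ D := by positivity
  have hE0 : 0 < E := Real.exp_pos _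
  refine ⟨E + (64 + (1 + 64 * B) * (D + 2) / 2 + D ^ 3 * E), by positivity,
    fun κ u w X hκ hκB hu hw hX => ?_⟩
  have hκ2 : κ ^ 2 ≤ B * κ := by nlinarith
  have hκ3 : κ ^ 3 ≤ B * κ ^ 2 := by nlinarith [sq_nonneg κ]
  have hXu : ‖X - u‖ ≤ (1 + 64 * B) * κ ^ 2 := by
    have : ‖X - u‖ ≤ ‖X - u - w‖ + ‖w‖ := by simpa using norm_add_le (X - u - w) w
    linarith
  have hXn : ‖X‖ ≤ D * κ := by
    have h1 : ‖X‖ ≤ ‖X - u‖ + ‖u‖ := by simpa using norm_add_le (X - u) u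
    have h2 : (1 + 64 * B) * κ ^ 2 ≤ (1 + 64 * B) * (B * κ) := by gcongr
    rw [hD]
    linarith
  have hXp : ‖X + u‖ ≤ (D + 2) * κ := (norm_add_le _ _).trans (by linarith)
  have hexp : Real.exp ‖X‖ ≤ E := by
    rw [hE]
    gcongr
    exact hXn.trans (by gcongr)
  constructor
  · rw [Complex.norm_exp]
    have := Real.exp_le_exp.mpr (Complex.re_le_norm X)
    have h2 : 0 ≤ 64 + (1 + 64 * B) * (D + 2) / 2 + D ^ 3 * E := by positivity
    linarith
  · have e : Complex.exp X - (1 + u + (w + u ^ 2 / 2))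
        = (X - u - w) + (X - u) * (X + u) / 2 + (Complex.exp X - (1 + X + X ^ 2 / 2)) := by
      ring
    rw [e]
    refine (norm_add₃_le).trans ?_
    have t2 : ‖(X - u) * (X + u) / 2‖ ≤ (1 + 64 * B) * (D + 2) / 2 * κ ^ 3 := by
      rw [norm_div, norm_mul, Complex.norm_ofNat]
      calc _ ≤ (1 + 64 * B) * κ ^ 2 * ((D + 2) * κ) / 2 := by gcongr
        _ = _ := by ring
    have t3 : ‖Complex.exp X - (1 + X + X ^ 2 / 2)‖ ≤ D ^ 3 * E * κ ^ 3 := by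
      refine (norm_exp_sub_quadratic_le X).trans ?_
      calc _ ≤ (D * κ) ^ 3 * E := by gcongr
        _ = _ := by ring
    have t4 : 0 ≤ E * κ ^ 3 := by positivity
    linarith

/-- Applied with `u = L s³/6` and `σ = as` of order `κ`, `w = L s⁴/24` and `τ = q s²` of order `κ²`.
The collected second order part `τ + w + u²/2 + σu` is then even in `s`. -/
theorem exists_norm_mul_exp_sub_expansion_le {B b c K : ℝ} (hB : 0 ≤ B) (hb : 0 ≤ b) (hc : 0 ≤ c)
    (hK : 0 ≤ K) :
    ∃ C : ℝ, 0 ≤ C ∧ ∀ (κ : ℝ) (u w X v σ τ : ℂ), 0 ≤ κ → κ ≤ B → ‖u‖ ≤ 2 * κ → ‖w‖ ≤ κ ^ 2 →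
      ‖X - u - w‖ ≤ 64 * κ ^ 3 → ‖σ‖ ≤ b * κ → ‖τ‖ ≤ c * κ ^ 2 → ‖v - (1 + σ + τ)‖ ≤ K * κ ^ 3 →
        ‖v * Complex.exp X - (1 + σ + u + (τ + w + u ^ 2 / 2 + σ * u))‖ ≤ C * κ ^ 3 ∧
        ‖τ + w + u ^ 2 / 2 + σ * u‖ ≤ C * κ ^ 2 := by
  obtain ⟨C, hC0, hC⟩ := exists_norm_exp_sub_expansion_le hB
  refine ⟨(b * 3 + c * (2 + 3 * B) + K * C + (1 + b * B + c * B ^ 2) * C) + (c + 3 + 2 * b),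
    by positivity, fun κ u w X v σ τ hκ hκB hu hw hX hσ hτ hv => ?_⟩
  obtain ⟨hX1, hX2⟩ := hC κ u w X hκ hκB hu hw hX
  have hu2 : ‖u ^ 2 / 2‖ ≤ 2 * κ ^ 2 := by
    rw [norm_div, norm_pow, Complex.norm_ofNat]
    calc _ ≤ (2 * κ) ^ 2 / 2 := by gcongr
      _ = _ := by ring
  have hw' : ‖w + u ^ 2 / 2‖ ≤ 3 * κ ^ 2 := (norm_add_le _ _).trans (by linarith)
  have hp2 : 0 ≤ κ ^ 2 := by positivity
  have hp3 : 0 ≤ κ ^ 3 := by positivity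
  constructor
  · have e : v * Complex.exp X - (1 + σ + u + (τ + w + u ^ 2 / 2 + σ * u))
        = (σ * (w + u ^ 2 / 2) + τ * (u + (w + u ^ 2 / 2)))
          + (v - (1 + σ + τ)) * Complex.exp X
          + (1 + σ + τ) * (Complex.exp X - (1 + u + (w + u ^ 2 / 2))) := by
      ring
    rw [e]
    refine (norm_add₃_le).trans ?_
    have t0 : ‖σ * (w + u ^ 2 / 2)‖ ≤ b * 3 * κ ^ 3 := by
      rw [norm_mul]
      calc _ ≤ b * κ * (3 * κ ^ 2) := by gcongr
        _ = _ := by ring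
    have t1 : ‖τ * (u + (w + u ^ 2 / 2))‖ ≤ c * (2 + 3 * B) * κ ^ 3 := by
      rw [norm_mul]
      have : ‖u + (w + u ^ 2 / 2)‖ ≤ (2 + 3 * B) * κ := by
        refine (norm_add_le _ _).trans ?_
        nlinarith
      calc _ ≤ c * κ ^ 2 * ((2 + 3 * B) * κ) := by gcongr
        _ = _ := by ring
    have t2 : ‖(v - (1 + σ + τ)) * Complex.exp X‖ ≤ K * C * κ ^ 3 := by
      rw [norm_mul]
      calc _ ≤ K * κ ^ 3 * C := by gcongr
        _ = _ := by ring
    have t3 : ‖(1 + σ + τ) * (Complex.exp X - (1 + u + (w + u ^ 2 / 2)))‖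
        ≤ (1 + b * B + c * B ^ 2) * C * κ ^ 3 := by
      rw [norm_mul]
      have : ‖1 + σ + τ‖ ≤ 1 + b * B + c * B ^ 2 := by
        refine (norm_add₃_le).trans ?_
        rw [norm_one]
        have h1 : b * κ ≤ b * B := by gcongr
        have h2 : c * κ ^ 2 ≤ c * B ^ 2 := by gcongr
        linarith
      calc _ ≤ (1 + b * B + c * B ^ 2) * (C * κ ^ 3) := by gcongr
        _ = _ := by ring
    have t4 := norm_add_le (σ * (w + u ^ 2 / 2)) (τ * (u + (w + u ^ 2 / 2)))
    have t5 : 0 ≤ (c + 3 + 2 * b) * κ ^ 3 := by positivity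
    linarith
  · have hσu : ‖σ * u‖ ≤ 2 * b * κ ^ 2 := by
      rw [norm_mul]
      calc _ ≤ b * κ * (2 * κ) := by gcongr
        _ = _ := by ring
    have t1 : ‖τ + w + u ^ 2 / 2 + σ * u‖ ≤ ‖τ‖ + ‖w + u ^ 2 / 2‖ + ‖σ * u‖ := by
      rw [add_assoc τ w]
      exact norm_add₃_le
    have t5 : 0 ≤ (b * 3 + c * (2 + 3 * B) + K * C + (1 + b * B + c * B ^ 2) * C) * κ ^ 2 := by
      positivity
    linarith

theorem gaussMoment_of_odd {k : ℕ} (hk : Odd k) : gaussMoment k = 0 := by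
  rw [gaussMoment_eq, gaussCoeff_of_odd (Nat.not_even_iff_odd.mpr hk), mul_zero]

theorem gaussMoment_eq_bigM {k : ℕ} (hk : Even k) : gaussMoment k = bigM k := by
  obtain ⟨m, rfl⟩ := even_iff_two_dvd.mp hk
  rw [gaussMoment_eq, bigM_eq_of_even]

/-- The main term of the moments for small `k`. -/
noncomputable def momentMain (x : ℝ) (k : ℕ) : ℝ :=
  gaussMoment k + ((k : ℝ) * ((k : ℝ) - 1) / 6 + (k : ℝ) * meisselMertens) *
    (gaussMoment (k - 1) / √(logLog x))

theorem gaussFunctional_linear {k : ℕ} (hk : 1 ≤ k) (L : ℝ) :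
    gaussFunctional k L (fun s => s ^ 1) = ((k * (gaussMoment (k - 1) / √L) : ℝ) : ℂ) := by
  rw [gaussFunctional_pow hk, gaussMoment_eq]
  congr 1
  obtain ⟨m, rfl⟩ : ∃ m, k = m + 1 := ⟨k - 1, by omega⟩
  rw [Nat.add_sub_cancel, Nat.factorial_succ]
  push_cast
  ring

theorem gaussFunctional_cubic {k : ℕ} (hk : 1 ≤ k) {L : ℝ} (hL : 0 < L) :
    gaussFunctional k L (fun s => ((L / 6 : ℝ) : ℂ) * s ^ 3)
      = (((k : ℝ) * ((k : ℝ) - 1) / 6 * (gaussMoment (k - 1) / √L) : ℝ) : ℂ) := by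
  rw [gaussFunctional_const_mul]
  -- For `k < 3` the coefficient of `s³` is out of reach, and the right side vanishes too: at `k =
  -- 1` by the factor `k - 1`, at `k = 2` because `μ_1 = 0`.
  rcases le_or_gt 3 k with h3 | h3
  · rw [gaussFunctional_pow h3, ← Complex.ofReal_mul, gaussMoment_eq]
    congr 1
    obtain ⟨m, rfl⟩ : ∃ m, k = m + 3 := ⟨k - 3, by omega⟩
    have hs : √L ≠ 0 := (Real.sqrt_pos.mpr hL).ne'
    have hs2 : √L ^ 2 = L := Real.sq_sqrt hL.le
    have e : m + 3 - 1 = m + 2 := rfl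
    rw [Nat.add_sub_cancel, e, Nat.factorial_succ (m + 2), ← gaussCoeff_add_two m]
    push_cast
    field_simp
    rw [hs2]
    ring
  · rw [gaussFunctional_pow_of_lt h3]
    interval_cases k
    · simp
    · simp [gaussMoment_of_odd odd_one]

theorem momentMain_eq_gaussFunctional {x : ℝ} (hL : 0 < logLog x) {k : ℕ} (hk : 1 ≤ k) :
    (momentMain x k : ℂ) = gaussFunctional k (logLog x)
      (fun s => 1 + meisselMertens * s + logLog x * s ^ 3 / 6) := by
  set L := logLog x with hLdef
  have e : (fun s : ℂ => 1 + (meisselMertens : ℂ) * s + L * s ^ 3 / 6)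
      = fun s => (s ^ 0 + (meisselMertens : ℂ) * s ^ 1) + ((L / 6 : ℝ) : ℂ) * s ^ 3 := by
    funext s
    push_cast
    ring
  rw [e, gaussFunctional_add (R := fun s => s ^ 0 + (meisselMertens : ℂ) * s ^ 1)
      (S := fun s => ((L / 6 : ℝ) : ℂ) * s ^ 3) (by fun_prop) (by fun_prop),
    gaussFunctional_add (R := fun s => s ^ 0) (S := fun s => (meisselMertens : ℂ) * s ^ 1)
      (by fun_prop) (by fun_prop),
    gaussFunctional_const_mul _ (fun s => s ^ 1), gaussFunctional_linear hk,
    gaussFunctional_cubic hk hL, gaussFunctional_pow (Nat.zero_le k), momentMain, ← hLdef,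
    pow_zero, div_one, Nat.sub_zero, ← gaussMoment_eq]
  push_cast
  ring

theorem momentMain_of_even {x : ℝ} {k : ℕ} (hk1 : 1 ≤ k) (hk : Even k) :
    momentMain x k = bigM k := by
  have : Odd (k - 1) := Nat.Even.sub_odd hk1 hk odd_one
  rw [momentMain, gaussMoment_of_odd this, gaussMoment_eq_bigM hk]
  simp

/-- Here `μ_k = 0`, and `k μ_{k-1} ≥ √k M_k` by `momentWeight_one`. With `c = min(1/6, a)` one has
`(k-1)/6 + a ≥ ck`, and `c > 0` because `a > 0`. -/
theorem le_momentMain_of_odd {x : ℝ} (hL : 0 < logLog x) {k : ℕ} (hk : Odd k) :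
    min (1 / 6) meisselMertens * (k * (√(k : ℝ) / √(logLog x))) * bigM k ≤ momentMain x k := by
  have hk1 : 1 ≤ k := hk.pos
  have hk1' : (1 : ℝ) ≤ k := by exact_mod_cast hk1
  have hs : 0 < √(logLog x) := Real.sqrt_pos.mpr hL
  have hM := bigM_pos k
  have hw := (momentWeight_one hk).1
  have hsk : 0 < √(k : ℝ) := Real.sqrt_pos.mpr (by linarith)
  have h1 : √(k : ℝ) * bigM k ≤ k * gaussMoment (k - 1) := by
    rw [momentWeight, pow_one, one_le_div (by positivity)] at hw
    refine hw.trans_eq ?_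
    rw [gaussMoment_eq]
    obtain ⟨m, rfl⟩ : ∃ m, k = m + 1 := ⟨k - 1, by omega⟩
    rw [Nat.add_sub_cancel, Nat.factorial_succ]
    push_cast
    ring
  have hc0 : 0 < min (1 / 6) meisselMertens := lt_min (by norm_num) meisselMertens_pos
  have h2 : min (1 / 6) meisselMertens * k ≤ ((k : ℝ) - 1) / 6 + meisselMertens := by
    have a1 := min_le_left (1 / 6) meisselMertens
    have a2 := min_le_right (1 / 6) meisselMertens
    nlinarith
  rw [momentMain, gaussMoment_of_odd hk, zero_add]
  calc _ = (min (1 / 6) meisselMertens * k) * ((√(k : ℝ) * bigM k) / √(logLog x)) := by ring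
    _ ≤ (((k : ℝ) - 1) / 6 + meisselMertens) * ((k * gaussMoment (k - 1)) / √(logLog x)) := by
        have : 0 ≤ ((k : ℝ) - 1) / 6 + meisselMertens := le_trans (by positivity) h2
        gcongr
    _ = _ := by ring

theorem gaussFunctional_eq_zero_of_even {k : ℕ} (hk : Odd k) (L : ℝ) {R : ℂ → ℂ}
    (hR : ∀ s, R (-s) = R s) : gaussFunctional k L R = 0 := by
  have h := gaussFunctional_comp_neg R k L
  rw [funext hR, hk.neg_one_pow] at h
  linear_combination h / 2


theorem exp_neg_div_eight_le {L : ℝ} (hL : 0 < L) :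
    Real.exp (-(L / 8)) ≤ 128 * (1 / √L) ^ 4 := by
  have h1 : (1 / √L) ^ 4 = 1 / L ^ 2 := by
    have : √L ^ 4 = L ^ 2 := by
      rw [show √L ^ 4 = (√L ^ 2) ^ 2 by ring, Real.sq_sqrt hL.le]
    rw [div_pow, this, one_pow]
  have h2 := Real.quadratic_le_exp_of_nonneg (x := L / 8) (by positivity)
  rw [h1, Real.exp_neg, ← one_div, ← mul_div_assoc, mul_one,
    div_le_div_iff₀ (Real.exp_pos _) (by positivity)]
  nlinarith

/-- Comparison of the moments with their main term when `k³ / log log x` is bounded. -/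
theorem exists_abs_omegaMoment_sub_momentMain_le {B : ℝ} (hB : 0 ≤ B) :
    ∃ C L₀ : ℝ, 0 ≤ C ∧ 1 ≤ L₀ ∧ ∀ x : ℝ, 3 ≤ x → L₀ ≤ logLog x → ∀ k : ℕ, 1 ≤ k → ∀ κ : ℝ,
      κ = k * (√(k : ℝ) / √(logLog x)) → κ ≤ B →
        |omegaMoment x k - momentMain x k| ≤ C * κ ^ 2 * bigM k ∧
        (Odd k → |omegaMoment x k - momentMain x k| ≤ C * κ ^ 3 * bigM k) := by
  obtain ⟨q, K, δ, hK0, hδ0, hδ16, hexp⟩ := exists_normalizedMgf_expansion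
  set a : ℂ := (meisselMertens : ℂ) with ha
  obtain ⟨C, hC0, hC⟩ := exists_norm_mul_exp_sub_expansion_le (B := B) (b := 2 * ‖a‖)
    (c := 4 * ‖q‖) (K := 8 * K) hB (by positivity) (by positivity) (by positivity)
  have hEb : 0 ≤ C + 128 * K := by positivity
  -- The threshold ensures `2r ≤ δ`, since `L (2r)³ = 8κ ≤ 8B ≤ L δ³`.
  refine ⟨4 * C + (4 * (C + 128 * K) + 4 * (C + 128 * K) * B), 1 + 8 * B / δ ^ 3, by positivity,
    by have : 0 ≤ 8 * B / δ ^ 3 := by positivity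
       linarith, fun x hx hL₀ k hk κ hκ hκB => ?_⟩
  set L := logLog x with hLdef
  set r : ℝ := √(k : ℝ) / √L with hrdef
  have hL : 1 ≤ L := by
    have : 0 ≤ 8 * B / δ ^ 3 := by positivity
    linarith
  have hL0 : 0 < L := by linarith
  have hk0 : (0 : ℝ) < k := by exact_mod_cast hk
  have hk1 : (1 : ℝ) ≤ k := by exact_mod_cast hk
  have hr0 : 0 < r := div_pos (Real.sqrt_pos.mpr hk0) (Real.sqrt_pos.mpr hL0)
  have hLr2 : L * r ^ 2 = k := mul_sqrt_div_sqrt_sq hL0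
  have hκ0 : 0 < κ := by
    rw [hκ]
    positivity
  have hrκ : r ≤ κ := by
    rw [hκ]
    nlinarith
  have hLr3 : L * r ^ 3 = κ := by
    rw [hκ, ← hLr2]
    ring
  have hrinv : 1 / √L ≤ r := by
    rw [hrdef]
    gcongr
    exact Real.one_le_sqrt.mpr hk1
  have hrδ : 2 * r ≤ δ := by
    have h1 : 8 * B ≤ L * δ ^ 3 := by
      rw [← div_le_iff₀ (by positivity)]
      linarith
    have h2 : L * (2 * r) ^ 3 ≤ L * δ ^ 3 := by
      calc L * (2 * r) ^ 3 = 8 * (L * r ^ 3) := by ring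
        _ ≤ _ := by rw [hLr3]; linarith
    exact (pow_le_pow_iff_left₀ (by positivity) hδ0.le (by norm_num)).mp
      (le_of_mul_le_mul_left h2 hL0)
  -- `Q` gathers the terms of order `κ²`, all even in `s`; `R` is what remains, of order `κ³`.
  -- Powers of `r` alone are absorbed through `r ≤ κ`.
  set Q : ℂ → ℂ := fun s =>
    q * s ^ 2 + L * s ^ 4 / 24 + (L * s ^ 3 / 6) ^ 2 / 2 + (a * s) * (L * s ^ 3 / 6) with hQ
  set R : ℂ → ℂ := fun s => normalizedMgf x s - (1 + a * s + L * s ^ 3 / 6 + Q s) with hR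
  have hQdiff : Differentiable ℂ Q := by fun_prop
  have hRdiff : Differentiable ℂ R := (differentiable_normalizedMgf x).sub (by fun_prop)
  have hbound : ∀ s : ℂ, ‖s‖ = 2 * r → ‖R s‖ ≤ (C + 128 * K) * κ ^ 3 ∧ ‖Q s‖ ≤ C * κ ^ 2 := by
    intro s hs
    obtain ⟨v, hv, hF⟩ := hexp x hx hL s (hs.trans_le hrδ)
    rw [← hLdef] at hF
    have hs2 : ‖s‖ ≤ 1 / 2 := by linarith
    set X : ℂ := L * (Complex.exp s - 1 - s - s ^ 2 / 2) with hX
    have hLn : ‖(L : ℂ)‖ = L := by rw [Complex.norm_real, Real.norm_of_nonneg hL0.le]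
    have b1 : ‖(L : ℂ) * s ^ 3 / 6‖ ≤ 2 * κ := by
      rw [norm_div, norm_mul, norm_pow, hLn, hs, Complex.norm_ofNat]
      have : L * (2 * r) ^ 3 / 6 = 8 / 6 * (L * r ^ 3) := by ring
      rw [this, hLr3]
      linarith
    have b2 : ‖(L : ℂ) * s ^ 4 / 24‖ ≤ κ ^ 2 := by
      rw [norm_div, norm_mul, norm_pow, hLn, hs, Complex.norm_ofNat]
      have : L * (2 * r) ^ 4 / 24 = 16 / 24 * (L * r ^ 3 * r) := by ring
      rw [this, hLr3]
      nlinarith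
    have b3 : ‖X - (L : ℂ) * s ^ 3 / 6 - L * s ^ 4 / 24‖ ≤ 64 * κ ^ 3 := by
      have e : X - (L : ℂ) * s ^ 3 / 6 - L * s ^ 4 / 24
          = L * (Complex.exp s - 1 - s - s ^ 2 / 2 - s ^ 3 / 6 - s ^ 4 / 24) := by
        rw [hX]
        ring
      rw [e, norm_mul, hLn]
      calc _ ≤ L * (2 * ‖s‖ ^ 5) := by
            gcongr
            exact norm_exp_sub_quartic_le hs2
        _ = 64 * ((L * r ^ 3) * r ^ 2) := by rw [hs]; ring
        _ ≤ 64 * (κ * κ ^ 2) := by rw [hLr3]; gcongr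
        _ = _ := by ring
    have b4 : ‖a * s‖ ≤ 2 * ‖a‖ * κ := by
      rw [norm_mul, hs]
      calc _ ≤ ‖a‖ * (2 * κ) := by gcongr
        _ = _ := by ring
    have b5 : ‖q * s ^ 2‖ ≤ 4 * ‖q‖ * κ ^ 2 := by
      rw [norm_mul, norm_pow, hs]
      calc _ ≤ ‖q‖ * (2 * κ) ^ 2 := by gcongr
        _ = _ := by ring
    have b6 : ‖v - (1 + a * s + q * s ^ 2)‖ ≤ 8 * K * κ ^ 3 := by
      refine hv.trans ?_
      rw [hs]
      calc _ ≤ K * (2 * κ) ^ 3 := by gcongr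
        _ = _ := by ring
    obtain ⟨c1, c2⟩ := hC κ _ _ X v _ _ hκ0.le hκB b1 b2 b3 b4 b5 b6
    refine ⟨?_, c2⟩
    have e : R s = (normalizedMgf x s - v * Complex.exp X)
        + (v * Complex.exp X - (1 + a * s + L * s ^ 3 / 6 + Q s)) := by
      rw [hR]
      ring
    rw [e]
    refine (norm_add_le _ _).trans ?_
    have h1 : K * Real.exp (-(L / 8)) ≤ K * (128 * κ ^ 3) := by
      gcongr
      refine (exp_neg_div_eight_le hL0).trans ?_
      have h2 : 1 / √L ≤ 1 := by
        rw [div_le_one (Real.sqrt_pos.mpr hL0)]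
        exact Real.one_le_sqrt.mpr hL
      have h3 : 0 ≤ 1 / √L := by positivity
      calc 128 * (1 / √L) ^ 4 = 128 * ((1 / √L) ^ 3 * (1 / √L)) := by ring
        _ ≤ 128 * (κ ^ 3 * 1) := by
            gcongr
            exact hrinv.trans hrκ
        _ = _ := by ring
    linarith
  have hQT := norm_gaussFunctional_le hk hL0 hQdiff.diffContOnCl fun s hs => (hbound s hs).2
  have hRT := norm_gaussFunctional_le hk hL0 hRdiff.diffContOnCl fun s hs => (hbound s hs).1
  have hsplit : ((omegaMoment x k - momentMain x k : ℝ) : ℂ)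
      = gaussFunctional k L Q + gaussFunctional k L R := by
    have hF : normalizedMgf x = fun s => (1 + a * s + L * s ^ 3 / 6) + (Q s + R s) := by
      funext s
      rw [hR]
      ring
    rw [Complex.ofReal_sub, omegaMoment_eq_gaussFunctional hL0 k,
      momentMain_eq_gaussFunctional hL0 hk, ← hLdef, ← ha, hF,
      gaussFunctional_add (R := fun s => 1 + a * s + L * s ^ 3 / 6) (S := fun s => Q s + R s)
        (by fun_prop) ((hQdiff.analyticAt 0).add (hRdiff.analyticAt 0)), add_sub_cancel_left]
    exact gaussFunctional_add (hQdiff.analyticAt 0) (hRdiff.analyticAt 0) k L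
  have hnorm : |omegaMoment x k - momentMain x k|
      = ‖gaussFunctional k L Q + gaussFunctional k L R‖ := by
    rw [← hsplit, Complex.norm_real, Real.norm_eq_abs]
  have hM := bigM_pos k
  constructor
  · rw [hnorm]
    refine (norm_add_le _ _).trans ((add_le_add hQT hRT).trans ?_)
    have h3 : κ ^ 3 ≤ B * κ ^ 2 := by nlinarith [sq_nonneg κ]
    have h4 : (C + 128 * K) * κ ^ 3 ≤ (C + 128 * K) * (B * κ ^ 2) := by gcongr
    have h5 : 0 ≤ 4 * (C + 128 * K) * κ ^ 2 := by positivity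
    calc _ = bigM k * (4 * C * κ ^ 2 + 4 * ((C + 128 * K) * κ ^ 3)) := by ring
      _ ≤ bigM k * ((4 * C + (4 * (C + 128 * K) + 4 * (C + 128 * K) * B)) * κ ^ 2) := by
          gcongr
          linarith
      _ = _ := by ring
  · intro hodd
    -- Parity gains the extra factor `κ` that offsets the smaller main term for odd `k`.
    have hzero : gaussFunctional k L Q = 0 := by
      refine gaussFunctional_eq_zero_of_even hodd L fun s => ?_
      rw [hQ]
      ring
    rw [hnorm, hzero, zero_add]
    refine hRT.trans ?_
    have h5 : 0 ≤ 4 * (C + 128 * K) * B := by positivity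
    calc _ = bigM k * (4 * (C + 128 * K) * κ ^ 3) := by ring
      _ ≤ bigM k * ((4 * C + (4 * (C + 128 * K) + 4 * (C + 128 * K) * B)) * κ ^ 3) := by
          gcongr
          linarith
      _ = _ := by ring

/-! ### The first range, uniformly for `x ≥ 3`. -/

theorem logLog_three_pos : 0 < logLog 3 := by
  refine Real.log_pos ?_
  rw [Real.lt_log_iff_exp_lt (by norm_num)]
  exact Real.exp_one_lt_three

theorem logLog_le_logLog {x y : ℝ} (hx : 1 < x) (hxy : x ≤ y) : logLog x ≤ logLog y :=
  Real.log_le_log (Real.log_pos hx) (Real.log_le_log (by linarith) hxy)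

theorem cardDistinctFactors_le_self (n : ℕ) : ArithmeticFunction.cardDistinctFactors n ≤ n := by
  rw [ArithmeticFunction.cardDistinctFactors_apply, ← List.card_toFinset]
  have h : n.primeFactorsList.toFinset ⊆ Finset.Icc 1 n := fun p hp => by
    have hp' := List.mem_toFinset.mp hp
    exact Finset.mem_Icc.mpr ⟨(Nat.prime_of_mem_primeFactorsList hp').pos,
      Nat.le_of_mem_primeFactorsList hp'⟩
  simpa using Finset.card_le_card h

theorem abs_omegaMoment_le {x D : ℝ} (hx : 1 ≤ x) (k : ℕ)
    (hD : ∀ n ∈ Finset.Icc 1 ⌊x⌋₊,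
      |((ArithmeticFunction.cardDistinctFactors n : ℝ) - logLog x) / √(logLog x)| ≤ D) :
    |omegaMoment x k| ≤ D ^ k := by
  have hN : (0 : ℝ) < ⌊x⌋₊ := by exact_mod_cast Nat.floor_pos.mpr hx
  rw [omegaMoment, uniformMean, abs_div, abs_of_pos hN, div_le_iff₀ hN]
  refine (Finset.abs_sum_le_sum_abs _ _).trans ?_
  have := Finset.sum_le_card_nsmul (Finset.Icc 1 ⌊x⌋₊) (fun n =>
    |(((ArithmeticFunction.cardDistinctFactors n : ℝ) - logLog x) / √(logLog x)) ^ k|) (D ^ k)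
    fun n hn => by
      rw [abs_pow]
      exact pow_le_pow_left₀ (abs_nonneg _) (hD n hn) k
  rw [Nat.card_Icc, Nat.add_sub_cancel, nsmul_eq_mul] at this
  linarith

theorem exists_eq_mul_one_add {m M t : ℝ} (hM : 0 < M) (h : |m - M| ≤ t * M) :
    ∃ θ : ℝ, |θ| ≤ t ∧ m = M * (1 + θ) := by
  refine ⟨(m - M) / M, ?_, by field_simp; ring⟩
  rwa [abs_div, abs_of_pos hM, div_le_iff₀ hM]

theorem min_mul_bigM_le_momentMain {x : ℝ} (hL : 0 < logLog x) {k : ℕ} (hk : 1 ≤ k) :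
    min 1 (min (1 / 6) meisselMertens * (k * (√(k : ℝ) / √(logLog x)))) * bigM k
      ≤ momentMain x k := by
  have hM := bigM_pos k
  rcases Nat.even_or_odd k with he | ho
  · rw [momentMain_of_even hk he]
    exact mul_le_of_le_one_left hM.le (min_le_left _ _)
  · refine le_trans ?_ (le_momentMain_of_odd hL ho)
    gcongr
    exact min_le_right _ _

/-- For `L ≥ L₀` the error is divided by `M_k` (even `k`) or by the lower bound `cκM_k` (odd `k`),
giving `O(κ²) = O(k³/L)` in both cases. For `L < L₀` both `x` and `k` are bounded, `k³/L ≥ 1/L₀`,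
and crude bounds suffice. -/
theorem exists_omegaMoment_eq_momentMain_mul {A : ℝ} (hA : 0 < A) :
    ∃ C : ℝ, ∀ x : ℝ, 3 ≤ x → ∀ k : ℕ, 1 ≤ k → (k : ℝ) ≤ A * logLog x ^ (1 / 3 : ℝ) →
      ∃ θ : ℝ, |θ| ≤ C * ((k : ℝ) ^ 3 / logLog x) ∧
        omegaMoment x k = momentMain x k * (1 + θ) := by
  obtain ⟨C, L₀, hC0, hL₀, hC⟩ := exists_abs_omegaMoment_sub_momentMain_le (B := A ^ 3 + 1)
    (by positivity)
  have hL₀0 : 0 < L₀ := by linarith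
  set c : ℝ := min (1 / 6) meisselMertens with hc
  have hc0 : 0 < c := lt_min (by norm_num) meisselMertens_pos
  set D : ℝ := (Real.exp (Real.exp L₀) + L₀) / √(logLog 3) with hD
  have hsl : 0 < √(logLog 3) := Real.sqrt_pos.mpr logLog_three_pos
  have hD0 : 0 ≤ D := by positivity
  set d : ℝ := min 1 (c / √L₀) with hd
  have hd0 : 0 < d := lt_min one_pos (by positivity)
  -- Serves only `L < L₀`: `D` bounds the normalized values of `ω`, `d M_k` bounds the main term
  -- from below, and summing over the finitely many possible `k` replaces taking a maximum.
  set S : ℝ := ∑ j ∈ Finset.range (⌊A * L₀ ^ (1 / 3 : ℝ)⌋₊ + 1), (D ^ j / (d * bigM j) + 1) with hS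
  have hSnn : ∀ j : ℕ, 0 ≤ D ^ j / (d * bigM j) + 1 := fun j => by
    have := bigM_pos j
    positivity
  have hS0 : 0 ≤ S := Finset.sum_nonneg fun j _ => hSnn j
  refine ⟨C + C / c + S * L₀, fun x hx k hk hkA => ?_⟩
  have hL3 : logLog 3 ≤ logLog x := logLog_le_logLog (by norm_num) hx
  have hL0 : 0 < logLog x := logLog_three_pos.trans_le hL3
  set L := logLog x with hLdef
  have hk0 : (0 : ℝ) < k := by exact_mod_cast hk
  have hk1 : (1 : ℝ) ≤ k := by exact_mod_cast hk
  have hM := bigM_pos k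
  have hsL : 0 < √L := Real.sqrt_pos.mpr hL0
  set κ : ℝ := k * (√(k : ℝ) / √L) with hκ
  have hκ0 : 0 < κ := by
    have := Real.sqrt_pos.mpr hk0
    positivity
  have hκ2 : κ ^ 2 = (k : ℝ) ^ 3 / L := by
    rw [hκ, mul_pow, div_pow, Real.sq_sqrt hk0.le, Real.sq_sqrt hL0.le]
    ring
  have hlow := min_mul_bigM_le_momentMain hL0 hk
  rw [← hLdef, ← hκ, ← hc] at hlow
  have hmain0 : 0 < momentMain x k :=
    lt_of_lt_of_le (mul_pos (lt_min one_pos (by positivity)) hM) hlow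
  refine exists_eq_mul_one_add hmain0 ?_
  rcases le_or_gt L₀ L with h | h
  · have hκB : κ ≤ A ^ 3 + 1 := by
      have h1 : (k : ℝ) ^ 3 ≤ A ^ 3 * L := by
        have e : (A * L ^ (1 / 3 : ℝ)) ^ 3 = A ^ 3 * L := by
          rw [mul_pow, ← Real.rpow_natCast (L ^ (1 / 3 : ℝ)) 3, ← Real.rpow_mul hL0.le]
          norm_num
        rw [← e]
        gcongr
      have h2 : κ ^ 2 ≤ A ^ 3 := by rwa [hκ2, div_le_iff₀ hL0]
      nlinarith [sq_nonneg (κ - 1)]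
    obtain ⟨h1, h2⟩ := hC x hx h k hk κ hκ hκB
    rw [← hκ2]
    have hSL : 0 ≤ S * L₀ := by positivity
    have hCc : 0 ≤ C / c := by positivity
    have hκm : 0 ≤ κ ^ 2 * momentMain x k := by positivity
    rcases Nat.even_or_odd k with he | ho
    · refine h1.trans ?_
      rw [← momentMain_of_even (x := x) hk he, mul_assoc, mul_assoc]
      exact mul_le_mul_of_nonneg_right (by linarith) hκm
    · have h3 := le_momentMain_of_odd hL0 ho
      rw [← hLdef, ← hκ, ← hc] at h3
      calc _ ≤ C * κ ^ 3 * bigM k := h2 ho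
        _ = C / c * κ ^ 2 * (c * κ * bigM k) := by field_simp
        _ ≤ C / c * κ ^ 2 * momentMain x k := by gcongr
        _ = C / c * (κ ^ 2 * momentMain x k) := by ring
        _ ≤ (C + C / c + S * L₀) * (κ ^ 2 * momentMain x k) :=
            mul_le_mul_of_nonneg_right (by linarith) hκm
        _ = _ := by ring
  · have hdlow : d * bigM k ≤ momentMain x k := by
      refine le_trans ?_ hlow
      gcongr
      rw [hd, div_eq_mul_one_div c]
      gcongr
      have : 1 / √L₀ ≤ √(k : ℝ) / √L := by
        gcongr
        exact Real.one_le_sqrt.mpr hk1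
      have h0 : 0 ≤ √(k : ℝ) / √L := by positivity
      rw [hκ]
      nlinarith
    have hlog : Real.log x ≤ Real.exp L₀ := by
      rw [← Real.log_le_iff_le_exp (Real.log_pos (by linarith))]
      exact h.le
    have hxX : x ≤ Real.exp (Real.exp L₀) := by
      rwa [← Real.log_le_iff_le_exp (by linarith)]
    have hm : |omegaMoment x k| ≤ D ^ k := by
      refine abs_omegaMoment_le (by linarith) k fun n hn => ?_
      rw [← hLdef, abs_div, abs_of_pos hsL, hD]
      have hn' : (n : ℝ) ≤ x := (Nat.le_floor_iff (by linarith)).mp (Finset.mem_Icc.mp hn).2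
      have hω : ((ArithmeticFunction.cardDistinctFactors n : ℕ) : ℝ) ≤ n := by
        exact_mod_cast cardDistinctFactors_le_self n
      have hω0 : (0 : ℝ) ≤ (ArithmeticFunction.cardDistinctFactors n : ℕ) := Nat.cast_nonneg _
      gcongr
      rw [abs_le]
      have := Real.exp_pos (Real.exp L₀)
      constructor <;> linarith
    have hkS : D ^ k / (d * bigM k) + 1 ≤ S := by
      refine Finset.single_le_sum (f := fun j => D ^ j / (d * bigM j) + 1) (fun j _ => hSnn j) ?_
      rw [Finset.mem_range, Nat.lt_succ_iff]
      refine Nat.le_floor (hkA.trans ?_)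
      gcongr
    have hkL : 1 / L₀ ≤ (k : ℝ) ^ 3 / L := by
      gcongr
      exact one_le_pow₀ hk1
    have hD2 : D ^ k ≤ D ^ k / (d * bigM k) * momentMain x k := by
      calc D ^ k = D ^ k / (d * bigM k) * (d * bigM k) := by field_simp
        _ ≤ _ := by gcongr
    calc |omegaMoment x k - momentMain x k| ≤ |omegaMoment x k| + |momentMain x k| := abs_sub _ _
      _ ≤ D ^ k / (d * bigM k) * momentMain x k + momentMain x k := by
          rw [abs_of_pos hmain0]
          linarith
      _ = (D ^ k / (d * bigM k) + 1) * momentMain x k := by ring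
      _ ≤ S * momentMain x k := by gcongr
      _ = S * L₀ * (1 / L₀) * momentMain x k := by field_simp
      _ ≤ (C + C / c + S * L₀) * ((k : ℝ) ^ 3 / L) * momentMain x k := by
          gcongr
          have : 0 ≤ C / c := by positivity
          linarith


/-! ### Limits in the second and third ranges. -/

/-- The exponent `k^{3/2} / (6 √(log log x))` of the transition range. -/
noncomputable def cubicTilt (x : ℝ) (k : ℕ) : ℝ :=
  logLog x * (√(k : ℝ) / √(logLog x)) ^ 3 / 6

theorem rpow_three_halves (k : ℕ) : (k : ℝ) ^ (3 / 2 : ℝ) = √(k : ℝ) ^ 3 := by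
  rw [Real.sqrt_eq_rpow, ← Real.rpow_natCast, ← Real.rpow_mul (Nat.cast_nonneg k)]
  norm_num

theorem cubicTilt_eq {x : ℝ} (hL : 0 < logLog x) (k : ℕ) :
    cubicTilt x k = (k : ℝ) ^ (3 / 2 : ℝ) / (6 * √(logLog x)) := by
  have hs : √(logLog x) ≠ 0 := (Real.sqrt_pos.mpr hL).ne'
  have hs2 : logLog x = √(logLog x) ^ 2 := (Real.sq_sqrt hL.le).symm
  rw [rpow_three_halves, cubicTilt]
  nth_rewrite 1 [hs2]
  field_simp

theorem cubicTilt_nonneg {x : ℝ} (hL : 0 < logLog x) (k : ℕ) : 0 ≤ cubicTilt x k := by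
  rw [cubicTilt_eq hL]
  positivity

theorem sq_cubicTilt {x : ℝ} (hL : 0 < logLog x) (k : ℕ) :
    36 * cubicTilt x k ^ 2 = (k : ℝ) ^ 3 / logLog x := by
  rw [cubicTilt_eq hL, rpow_three_halves, div_pow, mul_pow, Real.sq_sqrt hL.le,
    show (√(k : ℝ) ^ 3) ^ 2 = (√(k : ℝ) ^ 2) ^ 3 by ring, Real.sq_sqrt (Nat.cast_nonneg k)]
  field_simp
  ring

theorem transitionMain_eq {x : ℝ} (hL : 0 < logLog x) (k : ℕ) :
    transitionMain x k
      = (Real.exp (cubicTilt x k) + (-1) ^ k * Real.exp (-cubicTilt x k)) / 2 := by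
  have h1 : (k : ℝ) ^ (3 / 2 : ℝ) / (3 * √(logLog x)) = 2 * cubicTilt x k := by
    rw [cubicTilt_eq hL]
    ring
  have h2 : Real.exp (-cubicTilt x k)
      = Real.exp (cubicTilt x k) * Real.exp (-(2 * cubicTilt x k)) := by
    rw [← Real.exp_add]
    congr 1
    ring
  rw [transitionMain, h1, ← cubicTilt_eq hL, h2]
  ring

theorem tendsto_logLog_atTop : Tendsto logLog atTop atTop :=
  Real.tendsto_log_atTop.comp Real.tendsto_log_atTop

section Limits

variable {ι : Type*} {l : Filter ι} {x : ι → ℝ} {k : ι → ℕ}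

theorem tendsto_sq_div_logLog (hL : ∀ᶠ i in l, 1 ≤ logLog (x i))
    (ho : (fun i => (k i : ℝ)) =o[l] (fun i => √(logLog (x i)))) :
    Tendsto (fun i => (k i : ℝ) ^ 2 / logLog (x i)) l (nhds 0) := by
  have h := (ho.tendsto_div_nhds_zero).pow 2
  rw [zero_pow two_ne_zero] at h
  refine h.congr' ?_
  filter_upwards [hL] with i hi
  rw [div_pow, Real.sq_sqrt (by linarith)]

theorem tendsto_sqrt_div_sqrt_logLog (hL : ∀ᶠ i in l, 1 ≤ logLog (x i))
    (ho : (fun i => (k i : ℝ)) =o[l] (fun i => √(logLog (x i)))) :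
    Tendsto (fun i => √(k i : ℝ) / √(logLog (x i))) l (nhds 0) := by
  have h := ho.tendsto_div_nhds_zero
  refine squeeze_zero' (Eventually.of_forall fun i => by positivity) ?_ h
  filter_upwards [hL] with i hi
  have : √(k i : ℝ) ≤ k i := by
    rw [Real.sqrt_le_left (Nat.cast_nonneg _)]
    exact_mod_cast Nat.le_self_pow two_ne_zero _
  gcongr

/-- The normalized moments differ from the transition profile by a negligible amount. -/
theorem isLittleO_omegaMoment_sub_transitionMain (hx : Tendsto x l atTop)
    (hk : ∀ᶠ i in l, 1 ≤ k i)
    (ho : (fun i => (k i : ℝ)) =o[l] (fun i => √(logLog (x i)))) :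
    (fun i => (bigM (k i))⁻¹ * omegaMoment (x i) (k i) - transitionMain (x i) (k i))
      =o[l] (fun i => Real.exp (cubicTilt (x i) (k i))) := by
  obtain ⟨C, δ, hC0, hδ0, hC⟩ := exists_abs_omegaMoment_div_bigM_sub_le
  have hLtop := tendsto_logLog_atTop.comp hx
  have hL1 : ∀ᶠ i in l, 1 ≤ logLog (x i) := hLtop.eventually_ge_atTop 1
  have h1 := tendsto_sq_div_logLog hL1 ho
  have h2 := tendsto_sqrt_div_sqrt_logLog hL1 ho
  have h3 := ((h2.add h1).const_mul C)
  rw [add_zero, mul_zero] at h3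
  have hbig : (fun i => (bigM (k i))⁻¹ * omegaMoment (x i) (k i) - transitionMain (x i) (k i))
      =O[l] (fun i => C * (√(k i : ℝ) / √(logLog (x i)) + (k i : ℝ) ^ 2 / logLog (x i))
        * Real.exp (cubicTilt (x i) (k i))) := by
    refine IsBigO.of_bound 1 ?_
    filter_upwards [hL1, hk, hx.eventually_ge_atTop 3, h1.eventually_le_const one_pos,
      h2.eventually_le_const hδ0] with i hi hki hxi h1i h2i
    rw [one_mul, transitionMain_eq (by linarith)]
    refine (hC (x i) hxi hi (k i) hki h2i ((div_le_one (by linarith)).mp h1i) _ rfl).trans ?_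
    refine le_trans (le_of_eq ?_) (le_abs_self _)
    rw [cubicTilt]
    ring
  refine hbig.trans_isLittleO ?_
  have := ((isLittleO_one_iff ℝ).mpr h3).mul_isBigO
    (isBigO_refl (fun i => Real.exp (cubicTilt (x i) (k i))) l)
  simpa only [one_mul] using this

/-- The profile is `cosh y` or `sinh y` according to the parity of `k`; in either case it is at
least `sinh y ≥ y ≥ a`. -/
theorem transitionMain_isTheta_one (hL1 : ∀ᶠ i in l, 1 ≤ logLog (x i)) {a b : ℝ} (ha : 0 < a)
    (hab : ∀ᶠ i in l, a ≤ cubicTilt (x i) (k i) ∧ cubicTilt (x i) (k i) ≤ b) :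
    (fun i => transitionMain (x i) (k i)) =Θ[l] (fun _ => (1 : ℝ)) := by
  constructor
  · refine IsBigO.of_bound (Real.exp b) ?_
    filter_upwards [hL1, hab] with i hi hi'
    have h1 : Real.exp (cubicTilt (x i) (k i)) ≤ Real.exp b := Real.exp_le_exp.mpr hi'.2
    have h2 : Real.exp (-cubicTilt (x i) (k i)) ≤ Real.exp b := Real.exp_le_exp.mpr (by linarith)
    have h3 := Real.exp_pos (cubicTilt (x i) (k i))
    have h4 := Real.exp_pos (-cubicTilt (x i) (k i))
    rw [transitionMain_eq (by linarith), norm_one, mul_one, Real.norm_eq_abs, abs_le]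
    rcases neg_one_pow_eq_or ℝ (k i) with h | h <;> rw [h] <;> constructor <;> linarith
  · refine IsBigO.of_bound a⁻¹ ?_
    filter_upwards [hL1, hab] with i hi hi'
    have h1 : cubicTilt (x i) (k i) ≤ Real.sinh (cubicTilt (x i) (k i)) :=
      Real.self_le_sinh_iff.mpr (by linarith)
    rw [Real.sinh_eq] at h1
    have h4 := Real.exp_pos (-cubicTilt (x i) (k i))
    rw [transitionMain_eq (by linarith), norm_one, inv_mul_eq_div, one_le_div ha]
    refine le_trans ?_ (le_abs_self _)
    rcases neg_one_pow_eq_or ℝ (k i) with h | h <;> rw [h] <;> linarith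

theorem exists_cubicTilt_bounds (hL1 : ∀ᶠ i in l, 1 ≤ logLog (x i))
    (hk : (fun i => (k i : ℝ)) =Θ[l] (fun i => logLog (x i) ^ (1 / 3 : ℝ))) :
    ∃ a b : ℝ, 0 < a ∧ ∀ᶠ i in l, 1 ≤ k i ∧
      a ≤ cubicTilt (x i) (k i) ∧ cubicTilt (x i) (k i) ≤ b := by
  obtain ⟨b, hb0, hb⟩ := hk.1.exists_pos
  obtain ⟨a, ha0, ha⟩ := hk.2.exists_pos
  refine ⟨√((a⁻¹) ^ 3 / 36), √(b ^ 3 / 36), by positivity, ?_⟩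
  filter_upwards [hL1, hb.bound, ha.bound] with i hi hbi hai
  have hL0 : 0 < logLog (x i) := by linarith
  have hp : 0 < logLog (x i) ^ (1 / 3 : ℝ) := by positivity
  have hcube : (logLog (x i) ^ (1 / 3 : ℝ)) ^ 3 = logLog (x i) := by
    rw [← Real.rpow_natCast, ← Real.rpow_mul hL0.le]
    norm_num
  rw [Real.norm_of_nonneg (Nat.cast_nonneg _), Real.norm_of_nonneg hp.le] at hbi hai
  have hai' : a⁻¹ * logLog (x i) ^ (1 / 3 : ℝ) ≤ k i := by rwa [inv_mul_le_iff₀ ha0]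
  have hk0 : (0 : ℝ) < k i := lt_of_lt_of_le (by positivity) hai'
  have h36 := sq_cubicTilt hL0 (k i)
  have hub : (k i : ℝ) ^ 3 / logLog (x i) ≤ b ^ 3 := by
    rw [div_le_iff₀ hL0]
    calc (k i : ℝ) ^ 3 ≤ (b * logLog (x i) ^ (1 / 3 : ℝ)) ^ 3 := by gcongr
      _ = _ := by rw [mul_pow, hcube]
  have hlb : a⁻¹ ^ 3 ≤ (k i : ℝ) ^ 3 / logLog (x i) := by
    rw [le_div_iff₀ hL0]
    calc _ = (a⁻¹ * logLog (x i) ^ (1 / 3 : ℝ)) ^ 3 := by rw [mul_pow, hcube]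
      _ ≤ _ := by gcongr
  refine ⟨by exact_mod_cast hk0, ?_, ?_⟩
  · rw [Real.sqrt_le_left (cubicTilt_nonneg hL0 _)]
    linarith
  · refine Real.le_sqrt_of_sq_le ?_
    linarith

theorem isLittleO_sqrt_of_isTheta (hL : Tendsto (fun i => logLog (x i)) l atTop)
    (hk : (fun i => (k i : ℝ)) =Θ[l] (fun i => logLog (x i) ^ (1 / 3 : ℝ))) :
    (fun i => (k i : ℝ)) =o[l] (fun i => √(logLog (x i))) := by
  have h := (tendsto_rpow_neg_atTop (by norm_num : (0 : ℝ) < 1 / 6)).comp hL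
  refine hk.1.trans_isLittleO ((isLittleO_iff_tendsto' ?_).mpr (h.congr' ?_))
  · filter_upwards [hL.eventually_ge_atTop 1] with i hi h0
    exact absurd h0 (Real.sqrt_pos.mpr (by linarith)).ne'
  · filter_upwards [hL.eventually_ge_atTop 1] with i hi
    have hL0 : 0 < logLog (x i) := by linarith
    rw [Function.comp_apply, Real.sqrt_eq_rpow, ← Real.rpow_sub hL0]
    norm_num

theorem tendsto_cubicTilt_atTop (hL1 : ∀ᶠ i in l, 1 ≤ logLog (x i))
    (hk : Tendsto (fun i => (k i : ℝ) / logLog (x i) ^ (1 / 3 : ℝ)) l atTop) :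
    Tendsto (fun i => cubicTilt (x i) (k i)) l atTop := by
  have h := ((tendsto_rpow_atTop (by norm_num : (0 : ℝ) < 3 / 2)).comp hk).const_mul_atTop
    (by norm_num : (0 : ℝ) < 1 / 6)
  refine h.congr' ?_
  filter_upwards [hL1] with i hi
  have hL0 : 0 < logLog (x i) := by linarith
  rw [Function.comp_apply, Real.div_rpow (Nat.cast_nonneg _) (by positivity),
    ← Real.rpow_mul hL0.le, cubicTilt_eq hL0, Real.sqrt_eq_rpow]
  norm_num
  ring

theorem transitionMain_isEquivalent (hL1 : ∀ᶠ i in l, 1 ≤ logLog (x i))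
    (hy : Tendsto (fun i => cubicTilt (x i) (k i)) l atTop) :
    (fun i => transitionMain (x i) (k i))
      ~[l] (fun i => 1 / 2 * Real.exp (cubicTilt (x i) (k i))) := by
  have h1 : (fun i => Real.exp (-cubicTilt (x i) (k i)))
      =o[l] (fun i => Real.exp (cubicTilt (x i) (k i))) := by
    rw [Real.isLittleO_exp_comp_exp_comp]
    refine (hy.const_mul_atTop two_pos).congr fun i => ?_
    ring
  have h2 : (fun i => transitionMain (x i) (k i) - 1 / 2 * Real.exp (cubicTilt (x i) (k i)))
      =O[l] (fun i => Real.exp (-cubicTilt (x i) (k i))) := by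
    refine IsBigO.of_bound 1 ?_
    filter_upwards [hL1] with i hi
    have h4 := Real.exp_pos (-cubicTilt (x i) (k i))
    rw [transitionMain_eq (by linarith), Real.norm_eq_abs, Real.norm_of_nonneg h4.le, abs_le]
    rcases neg_one_pow_eq_or ℝ (k i) with h | h <;> rw [h] <;> constructor <;> linarith
  exact (h2.trans_isLittleO h1).trans_isBigO
    (isBigO_self_const_mul (by norm_num) _ l)

/-- The exponent `L(e^r - 1 - r - r²/2)` is `y + O(L r⁴)`, and `L r⁴ = k²/L → 0`. -/
theorem largeMain_isEquivalent (hx : Tendsto x l atTop)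
    (ho : (fun i => (k i : ℝ)) =o[l] (fun i => √(logLog (x i)))) :
    (fun i => largeMain (x i) (k i))
      ~[l] (fun i => 1 / 2 * Real.exp (cubicTilt (x i) (k i))) := by
  have hLtop := tendsto_logLog_atTop.comp hx
  have hL1 : ∀ᶠ i in l, 1 ≤ logLog (x i) := hLtop.eventually_ge_atTop 1
  have h1 := tendsto_sq_div_logLog hL1 ho
  have h2 := tendsto_sqrt_div_sqrt_logLog hL1 ho
  set r : ι → ℝ := fun i => √(k i : ℝ) / √(logLog (x i)) with hr
  set Y : ι → ℝ := fun i =>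
    logLog (x i) * (Real.exp (r i) - 1 - r i - r i ^ 2 / 2 - r i ^ 3 / 6) with hY
  have hY0 : Tendsto Y l (nhds 0) := by
    have h3 := h1.const_mul 2
    rw [mul_zero] at h3
    refine squeeze_zero_norm' ?_ h3
    filter_upwards [hL1, h2.eventually_le_const (by norm_num : (0 : ℝ) < 1 / 2)] with i hi hri
    have hL0 : 0 < logLog (x i) := by linarith
    have hr0 : 0 ≤ r i := by
      rw [hr]
      positivity
    have h4 := norm_exp_sub_cubic_le (s := (r i : ℂ))
      (by rwa [Complex.norm_real, Real.norm_of_nonneg hr0])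
    have e : Complex.exp (r i) - 1 - r i - (r i : ℂ) ^ 2 / 2 - (r i : ℂ) ^ 3 / 6
        = ((Real.exp (r i) - 1 - r i - r i ^ 2 / 2 - r i ^ 3 / 6 : ℝ) : ℂ) := by
      push_cast
      rfl
    rw [e, Complex.norm_real, Complex.norm_real, Real.norm_of_nonneg hr0] at h4
    rw [hY, norm_mul, Real.norm_of_nonneg hL0.le]
    have hLr2 : logLog (x i) * r i ^ 2 = k i := mul_sqrt_div_sqrt_sq hL0
    calc _ ≤ logLog (x i) * (2 * r i ^ 4) := by gcongr
      _ = 2 * ((k i : ℝ) ^ 2 / logLog (x i)) := by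
          rw [← hLr2]
          field_simp
  have heq : (fun i => largeMain (x i) (k i))
      =ᶠ[l] (fun i => Real.exp (Y i) * (1 / 2 * Real.exp (cubicTilt (x i) (k i)))) := by
    filter_upwards [hx.eventually_ge_atTop 3, hL1] with i hxi hi
    have hlog : 0 < Real.log (x i) := Real.log_pos (by linarith)
    have e : logLog (x i) * (Real.exp (r i) - (1 + r i + r i ^ 2 / 2))
        = Y i + cubicTilt (x i) (k i) := by
      rw [hY, cubicTilt]
      ring
    have e2 : √((k i : ℝ) / logLog (x i)) = r i := Real.sqrt_div (Nat.cast_nonneg _) _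
    rw [largeMain, e2, Real.rpow_def_of_pos hlog, ← logLog, e, Real.exp_add]
    ring
  have hexp : Tendsto (fun i => Real.exp (Y i)) l (nhds 1) := by
    simpa [Function.comp_def] using (Real.continuous_exp.tendsto 0).comp hY0
  exact isEquivalent_iff_exists_eq_mul.mpr ⟨_, hexp, heq⟩

end Limits

/-! ### Assembly of the three ranges. -/

theorem theorem2 :
    -- first range: the implied constant depends only on `A`
    (∀ A : ℝ, 0 < A → ∃ C : ℝ, ∀ x : ℝ, 3 ≤ x → ∀ k : ℕ, 1 ≤ k →
      (k : ℝ) ≤ A * logLog x ^ (1 / 3 : ℝ) →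
      ∃ θ : ℝ, |θ| ≤ C * ((k : ℝ) ^ 3 / logLog x) ∧
        omegaMoment x k =
          (gaussMoment k + ((k : ℝ) * ((k : ℝ) - 1) / 6 + (k : ℝ) * meisselMertens) *
            (gaussMoment (k - 1) / √(logLog x))) * (1 + θ)) ∧
    -- second range: `x → ∞` and `k ≍ (log log x)^{1/3}`, along any filter
    (∀ (ι : Type*) (l : Filter ι) (x : ι → ℝ) (k : ι → ℕ), Tendsto x l atTop →
      (fun i => (k i : ℝ)) =Θ[l] (fun i => logLog (x i) ^ (1 / 3 : ℝ)) →
      (fun i => (bigM (k i))⁻¹ * omegaMoment (x i) (k i)) ~[l]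
          (fun i => transitionMain (x i) (k i)) ∧
        (fun i => transitionMain (x i) (k i)) =Θ[l] (fun _ => (1 : ℝ)) ∧
        (fun i => (bigM (k i))⁻¹ * omegaMoment (x i) (k i)) =Θ[l] (fun _ => (1 : ℝ))) ∧
    -- third range: `x → ∞`, `k / (log log x)^{1/3} → ∞` and `k = o(√(log log x))`
    (∀ (ι : Type*) (l : Filter ι) (x : ι → ℝ) (k : ι → ℕ), Tendsto x l atTop →
      Tendsto (fun i => (k i : ℝ) / logLog (x i) ^ (1 / 3 : ℝ)) l atTop →
      (fun i => (k i : ℝ)) =o[l] (fun i => √(logLog (x i))) →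
      (fun i => (bigM (k i))⁻¹ * omegaMoment (x i) (k i)) ~[l]
          (fun i => largeMain (x i) (k i)) ∧
        Tendsto (fun i => largeMain (x i) (k i)) l atTop ∧
        Tendsto (fun i => (bigM (k i))⁻¹ * omegaMoment (x i) (k i)) l atTop) := by
  refine ⟨fun A hA => exists_omegaMoment_eq_momentMain_mul hA, fun ι l x k hx hk => ?_,
    fun ι l x k hx hk ho => ?_⟩
  · have hLtop := tendsto_logLog_atTop.comp hx
    have hL1 : ∀ᶠ i in l, 1 ≤ logLog (x i) := hLtop.eventually_ge_atTop 1
    obtain ⟨a, b, ha, hab⟩ := exists_cubicTilt_bounds hL1 hk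
    have htheta := transitionMain_isTheta_one hL1 ha (hab.mono fun i h => h.2)
    have hdiff := isLittleO_omegaMoment_sub_transitionMain hx (hab.mono fun i h => h.1)
      (isLittleO_sqrt_of_isTheta hLtop hk)
    have hexp : (fun i => Real.exp (cubicTilt (x i) (k i))) =O[l] (fun _ => (1 : ℝ)) := by
      refine IsBigO.of_bound (Real.exp b) ?_
      filter_upwards [hab] with i hi
      rw [norm_one, mul_one, Real.norm_of_nonneg (Real.exp_pos _).le]
      exact Real.exp_le_exp.mpr hi.2.2
    have hequiv : (fun i => (bigM (k i))⁻¹ * omegaMoment (x i) (k i)) ~[l]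
        (fun i => transitionMain (x i) (k i)) :=
      -- The error is `o(e^y)`. As `y` stays bounded and the profile is bounded below, this is `o`
      -- of the profile.
      hdiff.trans_isBigO (hexp.trans htheta.2)
    exact ⟨hequiv, htheta, hequiv.isTheta.trans htheta⟩
  · have hLtop := tendsto_logLog_atTop.comp hx
    have hL1 : ∀ᶠ i in l, 1 ≤ logLog (x i) := hLtop.eventually_ge_atTop 1
    have hy := tendsto_cubicTilt_atTop hL1 hk
    have hk1 : ∀ᶠ i in l, 1 ≤ k i := by
      filter_upwards [hk.eventually_gt_atTop 0] with i hi
      rw [Nat.one_le_iff_ne_zero]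
      rintro h0
      simp [h0] at hi
    have htrans := transitionMain_isEquivalent hL1 hy
    have hlarge := largeMain_isEquivalent hx ho
    have hmoment : (fun i => (bigM (k i))⁻¹ * omegaMoment (x i) (k i)) ~[l]
        (fun i => transitionMain (x i) (k i)) :=
      -- Here `y → ∞`, so the profile is itself of size `e^y` whatever the parity of `k`.
      (isLittleO_omegaMoment_sub_transitionMain hx hk1 ho).trans_isBigO
        ((isBigO_self_const_mul (by norm_num : (1 / 2 : ℝ) ≠ 0) _ l).trans htrans.isBigO_symm)
    have hequiv := (hmoment.trans htrans).trans hlarge.symm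
    have htop : Tendsto (fun i => largeMain (x i) (k i)) l atTop :=
      hlarge.symm.tendsto_atTop
        ((Real.tendsto_exp_atTop.comp hy).const_mul_atTop (by norm_num : (0 : ℝ) < 1 / 2))
    exact ⟨hequiv, htop, hequiv.symm.tendsto_atTop htop⟩
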